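/- **Setting.** Let $(\Omega,\mathcal F,P)$ be a probability space with a filtration $(\mathcal F_t)_{0\le t\le T}$ such that $\mathcal F_0$ contains all $P$-null events, and let $(S_t)_{0\le t\le T}$ be an adapted $\mathbb R^d$-valued process. Put $\Delta S_t=S_t-S_{t-1}$ for $1\le t\le T$ and $\Delta S_0=S_0$. Let $\Xi_t$ be the set of $\mathcal F_t$-measurable $\mathbb R^d$-valued random variables, and $\Phi$ the set of strategies $\phi=(\phi_t)_{1\le t\le T}$ with $\phi_t\in\Xi_{t-1}$. For $c\in\mathbb R$ put $V_t^{c,\phi}=c+\sum_{i=1}^t\langle\phi_i,\Delta S_i\rangle$. Let $\mathcal M$ be the set of random variables with finite moments of all orders. Let $D_{t+1}(\omega)$ be the smallest affine subspace of $\mathbb R^d$ containing the support of the regular conditional distribution of $\Delta S_{t+1}$ given $\mathcal F_t$, and let $\tilde\Xi_t$ be the set of $p\in\Xi_t$ with $p\in D_{t+1}$ a.s. and $|p|=1$ a.s. on $\{D_{t+1}\ne\{0\}\}$. **Hypotheses.** 1. $U:\mathbb R\to\mathbb R$ is concave, strictly increasing and continuously differentiable, $U(0)=0$, and at least one of the following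 holds: (a) there are $\tilde x>0$ and $0<\gamma<1$ with $U(\lambda x)\le\lambda^{\gamma}U(x)$ for all $x\ge\tilde x$, $\lambda\ge1$; (b) there are $\tilde x\le0$ and $\alpha>0$ with $U(\lambda x)\le\lambda^{1+\alpha}U(x)$ for all $x\le\tilde x$, $\lambda\ge1$. 2. For some constants $k,l,M,K\ge0$: $U'(x)\le K(|x|^k+1)$ for all $x\in\mathbb R$, and $M|x|^{-l}\le U'(x)$ for all $|x|\ge1$. 3. $|\Delta S_t|\in\mathcal M$ for $0\le t\le T$. 4. (NA) holds: for every $\phi\in\Phi$, if $V_T^{0,\phi}\ge0$ a.s. then $V_T^{0,\phi}=0$ a.s. Moreover, for every $0\le t\le T-1$ there are $\mathcal F_t$-measurable $\beta_t,\kappa_t>0$ with $1/\beta_t,1/\kappa_t\in\mathcal M$ such that, for every $p\in\tilde\Xi_t$, almost surely $$P(\langle p,\Delta S_{t+1}\rangle<-\beta_t\mid\mathcal F_t)\ge\kappa_t\quad\text{on }\{D_{t+1}\ne\{0\}\}.$$ **Conclusions.** (i) The random functions $U_T(x)=U(x)$ and, for $0\le t<T$, $$U_t(x)=\operatorname*{ess\,sup}_{\xi\in\Xi_t}E\big(U_{t+1}(x+\langle\xi,\Delta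 S_{t+1}\rangle)\mid\mathcal F_t\big)$$ are well defined (all these generalized conditional expectations exist, and the $U_t$ have versions that are a.s. finite, nondecreasing and concave in $x$; such versions are used on the right-hand side). In particular $U_t(x)<\infty$ a.s., and $EU_0(x)<\infty$ for all $x\in\mathbb R$. (ii) For every $c\in\mathbb R$ there is an optimal strategy, that is, a $\phi^*\in\Phi(U,c)$ with $$u(c):=\sup_{\phi\in\Phi(U,c)}EU(V_T^{c,\phi})=EU(V_T^{c,\phi^*})<\infty,$$ where $\Phi(U,c)$ is the set of $\phi\in\Phi$ for which $EU(V_T^{c,\phi})$ is well defined in $[-\infty,\infty]$. (iii) For every $c\in\mathbb R$ and every optimal strategy $\phi^*$ for $c$, $U'(V_T^{c,\phi^*})$ is $P$-integrable and $$\frac{dQ}{dP}=\frac{U'(V_T^{c,\phi^*})}{EU'(V_T^{c,\phi^*})}$$ defines a probability measure $Q$ equivalent to $P$ under which $(S_t)_{0\le t\le T}$ is a martingale with respect to $(\mathcal F_t)_{0\le t\le T}$. -/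

import Mathlib

open MeasureTheory ProbabilityTheory
open scoped ENNReal

noncomputable section

namespace UtilityMax

/-! ### Extended expectations and essential suprema -/

/-- The expectation of the real random variable `X` is well defined in `[-∞, ∞]`: at least one of
`E X⁺`, `E X⁻` is finite. -/
def ExpWellDefined {Ω : Type*} {mΩ : MeasurableSpace Ω} (P : Measure Ω) (X : Ω → ℝ) : Prop :=
  ∫⁻ ω, ENNReal.ofReal (X ω) ∂P ≠ ⊤ ∨ ∫⁻ ω, ENNReal.ofReal (-X ω) ∂P ≠ ⊤

/-- The expectation `E X = E X⁺ - E X⁻` in `[-∞, ∞]` (meaningful when `ExpWellDefined`). -/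
def extExp {Ω : Type*} {mΩ : MeasurableSpace Ω} (P : Measure Ω) (X : Ω → ℝ) : EReal :=
  ((∫⁻ ω, ENNReal.ofReal (X ω) ∂P : ℝ≥0∞) : EReal)
    - ((∫⁻ ω, ENNReal.ofReal (-X ω) ∂P : ℝ≥0∞) : EReal)

/-- The generalized conditional expectation of `X` given `m` is well defined: almost surely, at
least one of `E(X⁺ | m)`, `E(X⁻ | m)` is finite. -/
def CondExpWellDefined {Ω : Type*} {mΩ : MeasurableSpace Ω} (P : Measure Ω)
    (m : MeasurableSpace Ω) (X : Ω → ℝ) : Prop :=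
  ∀ᵐ ω ∂P, condLExp m P (fun ω' => ENNReal.ofReal (X ω')) ω ≠ ⊤ ∨
    condLExp m P (fun ω' => ENNReal.ofReal (-X ω')) ω ≠ ⊤

/-- The generalized conditional expectation `E(X | m) = E(X⁺ | m) - E(X⁻ | m)` in `[-∞, ∞]`. -/
def extCondExp {Ω : Type*} {mΩ : MeasurableSpace Ω} (P : Measure Ω)
    (m : MeasurableSpace Ω) (X : Ω → ℝ) (ω : Ω) : EReal :=
  ((condLExp m P (fun ω' => ENNReal.ofReal (X ω')) ω : ℝ≥0∞) : EReal)
    - ((condLExp m P (fun ω' => ENNReal.ofReal (-X ω')) ω : ℝ≥0∞) : EReal)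

/-- `G` is (a version of) the essential supremum of the family `Y i`, `i ∈ I`: it dominates
every member almost surely, and is almost surely below every random variable that does. -/
def IsEssSup {Ω ι : Type*} {mΩ : MeasurableSpace Ω} (P : Measure Ω) (I : Set ι)
    (Y : ι → Ω → EReal) (G : Ω → EReal) : Prop :=
  Measurable G ∧ (∀ i ∈ I, ∀ᵐ ω ∂P, Y i ω ≤ G ω) ∧
    ∀ Z : Ω → EReal, Measurable Z → (∀ i ∈ I, ∀ᵐ ω ∂P, Y i ω ≤ Z ω) → ∀ᵐ ω ∂P, G ω ≤ Z ω

/-- The random variable `X` has finite moments of all orders. -/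
def HasAllMoments {Ω : Type*} {mΩ : MeasurableSpace Ω} (P : Measure Ω) (X : Ω → ℝ) : Prop :=
  ∀ n : ℕ, MemLp X n P

/-! ### The market -/

/-- `ΔS_t = S_t - S_{t-1}` for `t ≥ 1`, with the convention `S_{-1} = 0`, that is `ΔS_0 = S_0`. -/
def increment {Ω : Type*} {d : ℕ} (S : ℕ → Ω → EuclideanSpace ℝ (Fin d)) :
    ℕ → Ω → EuclideanSpace ℝ (Fin d)
  | 0 => S 0
  | t + 1 => fun ω => S (t + 1) ω - S t ω

/-- Predictable trading strategies `(φ_t)_{1 ≤ t ≤ T}`: `φ_{t+1}` is `ℱ_t`-measurable. -/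
def IsStrategy {Ω : Type*} {mΩ : MeasurableSpace Ω} {d : ℕ} (ℱ : Filtration ℕ mΩ) (T : ℕ)
    (φ : ℕ → Ω → EuclideanSpace ℝ (Fin d)) : Prop :=
  ∀ t < T, Measurable[ℱ t] (φ (t + 1))

/-- The value `V_t^{c,φ} = c + ∑_{i=1}^t ⟨φ_i, ΔS_i⟩` of the portfolio `φ`. -/
def wealth {Ω : Type*} {d : ℕ} (S : ℕ → Ω → EuclideanSpace ℝ (Fin d)) (c : ℝ)
    (φ : ℕ → Ω → EuclideanSpace ℝ (Fin d)) (t : ℕ) (ω : Ω) : ℝ :=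
  c + ∑ i ∈ Finset.range t, inner ℝ (φ (i + 1) ω) (increment S (i + 1) ω)

/-- Absence of arbitrage. -/
def NoArbitrage {Ω : Type*} {mΩ : MeasurableSpace Ω} {d : ℕ} (P : Measure Ω)
    (ℱ : Filtration ℕ mΩ) (S : ℕ → Ω → EuclideanSpace ℝ (Fin d)) (T : ℕ) : Prop :=
  ∀ φ : ℕ → Ω → EuclideanSpace ℝ (Fin d), IsStrategy ℱ T φ →
    (∀ᵐ ω ∂P, 0 ≤ wealth S 0 φ T ω) → ∀ᵐ ω ∂P, wealth S 0 φ T ω = 0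

/-- A regular version of the conditional distribution of `Y` given the σ-algebra `m` (the
conditional distribution of `Y` given the identity map into `(Ω, m)`). -/
def condLaw {Ω : Type*} {mΩ : MeasurableSpace Ω} {d : ℕ} (P : Measure Ω) [IsFiniteMeasure P]
    (m : MeasurableSpace Ω) (Y : Ω → EuclideanSpace ℝ (Fin d)) :
    @Kernel Ω (EuclideanSpace ℝ (Fin d)) m _ :=
  @condDistrib Ω Ω (EuclideanSpace ℝ (Fin d)) _ _ _ mΩ m Y id P _

/-- The random set `D_t(ω)` for `t = s + 1`: the smallest affine subspace containing the support of
the conditional distribution of `ΔS_{s+1}` given `ℱ_s`. -/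
def nextSpan {Ω : Type*} {mΩ : MeasurableSpace Ω} {d : ℕ} (P : Measure Ω) [IsFiniteMeasure P]
    (ℱ : Filtration ℕ mΩ) (S : ℕ → Ω → EuclideanSpace ℝ (Fin d)) (s : ℕ) (ω : Ω) :
    AffineSubspace ℝ (EuclideanSpace ℝ (Fin d)) :=
  affineSpan ℝ (condLaw P (ℱ s) (increment S (s + 1)) ω).support

/-- The random set `D_{t+1}` is not reduced to the origin at `ω`. -/
def Nontriv {Ω : Type*} {mΩ : MeasurableSpace Ω} {d : ℕ} (P : Measure Ω) [IsFiniteMeasure P]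
    (ℱ : Filtration ℕ mΩ) (S : ℕ → Ω → EuclideanSpace ℝ (Fin d)) (t : ℕ) (ω : Ω) : Prop :=
  (nextSpan P ℱ S t ω : Set (EuclideanSpace ℝ (Fin d))) ≠ {0}

/-- The `ℱ_t`-measurable fields of directions `p` with `p ∈ D_{t+1}` a.s. and `|p| = 1` on
`{D_{t+1} ≠ {0}}`. -/
def unitDirections {Ω : Type*} {mΩ : MeasurableSpace Ω} {d : ℕ} (P : Measure Ω)
    [IsFiniteMeasure P] (ℱ : Filtration ℕ mΩ) (S : ℕ → Ω → EuclideanSpace ℝ (Fin d)) (t : ℕ) :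
    Set (Ω → EuclideanSpace ℝ (Fin d)) :=
  {p | Measurable[ℱ t] p ∧ (∀ᵐ ω ∂P, p ω ∈ nextSpan P ℱ S t ω) ∧
    ∀ᵐ ω ∂P, Nontriv P ℱ S t ω → ‖p ω‖ = 1}

/-- `β` and `κ` are `ℱ_t`-measurable, positive, and for all `p ∈ unitDirections P ℱ S t`,
`P(⟨p, ΔS_{t+1}⟩ < -β | ℱ_t) ≥ κ` on `{D_{t+1} ≠ {0}}` almost surely. -/
def IsNABound {Ω : Type*} {mΩ : MeasurableSpace Ω} {d : ℕ} (P : Measure Ω) [IsFiniteMeasure P]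
    (ℱ : Filtration ℕ mΩ) (S : ℕ → Ω → EuclideanSpace ℝ (Fin d)) (t : ℕ) (β κ : Ω → ℝ) : Prop :=
  Measurable[ℱ t] β ∧ Measurable[ℱ t] κ ∧ (∀ᵐ ω ∂P, 0 < β ω) ∧ (∀ᵐ ω ∂P, 0 < κ ω) ∧
    ∀ p ∈ unitDirections P ℱ S t, ∀ᵐ ω ∂P, Nontriv P ℱ S t ω →
      κ ω ≤ (P⟦{ω' | inner ℝ (p ω') (increment S (t + 1) ω') < -β ω'} | ℱ t⟧) ω

/-! ### Utility functions -/

/-- Concave nondecreasing, `U 0 = 0`, with reasonable asymptotic elasticity at `+∞`. -/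
def ElasticAtTop (U : ℝ → ℝ) : Prop :=
  ConcaveOn ℝ Set.univ U ∧ Monotone U ∧ U 0 = 0 ∧
    ∃ x₀ > 0, ∃ γ : ℝ, 0 < γ ∧ γ < 1 ∧ ∀ x ≥ x₀, ∀ l : ℝ, 1 ≤ l → U (l * x) ≤ l ^ γ * U x

/-- Concave nondecreasing, `U 0 = 0`, with reasonable asymptotic elasticity at `-∞`. -/
def ElasticAtBot (U : ℝ → ℝ) : Prop :=
  ConcaveOn ℝ Set.univ U ∧ Monotone U ∧ U 0 = 0 ∧
    ∃ x₀ ≤ 0, ∃ α : ℝ, 0 < α ∧ ∀ x ≤ x₀, ∀ l : ℝ, 1 ≤ l → U (l * x) ≤ l ^ (1 + α) * U x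

/-! ### The dynamic value functions -/

/-- `G t x ω` is a regular version of the random functions `U_t(x)`, `0 ≤ t ≤ T`, given by
`U_T = U` and `U_t(x) = ess sup_{ξ ∈ Ξ_t} E(U_{t+1}(x + ⟨ξ, ΔS_{t+1}⟩) | ℱ_t)`. All the
generalized conditional expectations are required to be well defined, all the essential suprema to
be finite, and almost all paths `x ↦ U_t(x)` to be nondecreasing and concave (this makes
`U_{t+1}(x + ⟨ξ, ΔS_{t+1}⟩)` independent of the choice of the version, up to null sets). -/
structure IsValueFunction {Ω : Type*} {mΩ : MeasurableSpace Ω} {d : ℕ} (P : Measure Ω)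
    (ℱ : Filtration ℕ mΩ) (S : ℕ → Ω → EuclideanSpace ℝ (Fin d)) (T : ℕ) (U : ℝ → ℝ)
    (G : ℕ → ℝ → Ω → ℝ) : Prop where
  terminal : ∀ x ω, G T x ω = U x
  measurable : ∀ t ≤ T, ∀ x, Measurable[ℱ t] (G t x)
  regular : ∀ t ≤ T, ∀ᵐ ω ∂P,
    Monotone (fun x => G t x ω) ∧ ConcaveOn ℝ Set.univ (fun x => G t x ω)
  wellDefined : ∀ t < T, ∀ x, ∀ ξ : Ω → EuclideanSpace ℝ (Fin d), Measurable[ℱ t] ξ →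
    CondExpWellDefined P (ℱ t)
      (fun ω => G (t + 1) (x + inner ℝ (ξ ω) (increment S (t + 1) ω)) ω)
  essSup : ∀ t < T, ∀ x,
    IsEssSup P {ξ : Ω → EuclideanSpace ℝ (Fin d) | Measurable[ℱ t] ξ}
      (fun ξ => extCondExp P (ℱ t)
        (fun ω => G (t + 1) (x + inner ℝ (ξ ω) (increment S (t + 1) ω)) ω))
      (fun ω => (G t x ω : EReal))

/-- The value functions `U_t(x)` are well defined and almost surely finite, and `E U_0(x) < ∞`
(that is, `E U_0(x)⁺ < ∞`) for every `x`. -/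
def WellPosed {Ω : Type*} {mΩ : MeasurableSpace Ω} {d : ℕ} (P : Measure Ω)
    (ℱ : Filtration ℕ mΩ) (S : ℕ → Ω → EuclideanSpace ℝ (Fin d)) (T : ℕ) (U : ℝ → ℝ) : Prop :=
  ∃ G : ℕ → ℝ → Ω → ℝ, IsValueFunction P ℱ S T U G ∧
    ∀ x, ∫⁻ ω, ENNReal.ofReal (G 0 x ω) ∂P < ⊤

/-! ### Optimal strategies and the martingale measure -/

/-- `Φ(U, c)`: the strategies for which `E U(V_T^{c,φ})` is well defined. -/
def admissible {Ω : Type*} {mΩ : MeasurableSpace Ω} {d : ℕ} (P : Measure Ω)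
    (ℱ : Filtration ℕ mΩ) (S : ℕ → Ω → EuclideanSpace ℝ (Fin d)) (T : ℕ) (U : ℝ → ℝ) (c : ℝ) :
    Set (ℕ → Ω → EuclideanSpace ℝ (Fin d)) :=
  {φ | IsStrategy ℱ T φ ∧ ExpWellDefined P (fun ω => U (wealth S c φ T ω))}

/-- `u(c) = sup_{φ ∈ Φ(U, c)} E U(V_T^{c,φ})`. -/
def optValue {Ω : Type*} {mΩ : MeasurableSpace Ω} {d : ℕ} (P : Measure Ω)
    (ℱ : Filtration ℕ mΩ) (S : ℕ → Ω → EuclideanSpace ℝ (Fin d)) (T : ℕ) (U : ℝ → ℝ) (c : ℝ) :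
    EReal :=
  ⨆ φ ∈ admissible P ℱ S T U c, extExp P (fun ω => U (wealth S c φ T ω))

/-- `φ` is an optimal strategy with finite value: `φ ∈ Φ(U, c)` and
`u(c) = E U(V_T^{c,φ}) < ∞`. -/
def IsOptimal {Ω : Type*} {mΩ : MeasurableSpace Ω} {d : ℕ} (P : Measure Ω)
    (ℱ : Filtration ℕ mΩ) (S : ℕ → Ω → EuclideanSpace ℝ (Fin d)) (T : ℕ) (U : ℝ → ℝ) (c : ℝ)
    (φ : ℕ → Ω → EuclideanSpace ℝ (Fin d)) : Prop :=
  φ ∈ admissible P ℱ S T U c ∧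
    optValue P ℱ S T U c = extExp P (fun ω => U (wealth S c φ T ω)) ∧
    extExp P (fun ω => U (wealth S c φ T ω)) < ⊤

/-- The measure `Q` with `dQ/dP = U'(V) / E U'(V)`. -/
def marginalMeasure {Ω : Type*} {mΩ : MeasurableSpace Ω} (P : Measure Ω) (U : ℝ → ℝ)
    (V : Ω → ℝ) : Measure Ω :=
  P.withDensity (fun ω => ENNReal.ofReal (deriv U (V ω) / ∫ ω', deriv U (V ω') ∂P))

/-- `Q` is an equivalent martingale measure for `(S_t)_{0 ≤ t ≤ T}`. -/
structure IsEquivMartingaleMeasure {Ω : Type*} {mΩ : MeasurableSpace Ω} {d : ℕ} (P Q : Measure Ω)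
    (ℱ : Filtration ℕ mΩ) (S : ℕ → Ω → EuclideanSpace ℝ (Fin d)) (T : ℕ) : Prop where
  isProbability : IsProbabilityMeasure Q
  absolutelyContinuous : Q ≪ P
  absolutelyContinuous' : P ≪ Q
  integrable : ∀ t ≤ T, Integrable (S t) Q
  martingale : ∀ s t, s ≤ t → t ≤ T → Q[S t | ℱ s] =ᵐ[Q] S s

end UtilityMax

end

/-!
The proof is by dynamic programming. Concavity and either elasticity condition give
`U (l * x) ≤ l ^ θ * (U x + C)` for `l ≥ 1` and some `θ ≠ 1`. The concave nondecreasing functions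
`g ≥ U` with this property, each paired with a depth `n` at which `g (-n) ≤ -(C + 1)`, form a Polish
space that contains `U` and is stable under one step backwards in time. So the value functions are
random elements of this space, and the conditional problem at time `t` becomes a family of
deterministic problems, one for each value of the regular conditional law of `(U_{t+1}, ΔS_{t+1})`.

In the deterministic problem, the no-arbitrage bound makes a position of norm `l` lose an amount of
order `l` with a probability bounded below. By elasticity the loss of utility is of order
`l ^ max 1 θ` and the gain at most of order `l ^ min 1 θ`, so the maximization takes place on a ball
whose radius is polynomial in the constants of the law. Therefore a maximizer exists, it can be
chosen measurably, and all the quantities of the next step still have finite moments of all orders.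

Pasting the one-step maximizers yields an optimal strategy `φ`. Conversely, an optimal strategy
solves each one-step problem, so its terminal wealth `V` has finite moments of all orders. Adding
`ε • 1_B • e` to its position at time `t + 1`, with `B` in `ℱ t`, and differentiating in `ε` gives
`E (U'(V) 1_B ⟨e, ΔS_{t+1}⟩) = 0`, so the density `U'(V) / E U'(V)` defines a martingale measure.
-/

noncomputable section

open Filter Topology TopologicalSpace

namespace UtilityMax

section Selection

variable {Ω X : Type*} {mΩ : MeasurableSpace Ω}

section Closed

variable [MetricSpace X] [SeparableSpace X] [MeasurableSpace X] [BorelSpace X]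

theorem exists_measurable_near {F : Ω → Set X}
    (hF : ∀ c : X, ∀ r > 0, MeasurableSet {ω | (F ω ∩ Metric.closedBall c r).Nonempty})
    {g : Ω → X} (hg : Measurable g) {r ε : ℝ} (hε : 0 < ε)
    (hgF : ∀ ω, (F ω ∩ Metric.closedBall (g ω) r).Nonempty) :
    ∃ g' : Ω → X, Measurable g' ∧ (∀ ω, (F ω ∩ Metric.closedBall (g' ω) ε).Nonempty) ∧
      ∀ ω, dist (g ω) (g' ω) ≤ r + ε := by
  classical
  rcases isEmpty_or_nonempty Ω with hΩ | ⟨⟨ω₀⟩⟩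
  · exact ⟨g, hg, hΩ.elim, hΩ.elim⟩
  have : Nonempty X := ⟨g ω₀⟩
  let q := denseSeq X
  have near : ∀ ω, ∃ n, (F ω ∩ Metric.closedBall (q n) ε).Nonempty ∧
      dist (g ω) (q n) ≤ r + ε := fun ω => by
    obtain ⟨x, hxF, hx⟩ := hgF ω
    obtain ⟨n, hn⟩ := (denseRange_denseSeq X).exists_dist_lt x hε
    exact ⟨n, ⟨x, hxF, hn.le⟩,
      (dist_triangle _ x _).trans (add_le_add (Metric.mem_closedBall'.1 hx) hn.le)⟩
  refine ⟨fun ω => q (Nat.find (near ω)),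
    (measurable_from_nat (f := q)).comp (measurable_find near fun n => ?_),
    fun ω => (Nat.find_spec (near ω)).1, fun ω => (Nat.find_spec (near ω)).2⟩
  exact (hF _ ε hε).inter (measurableSet_le (hg.dist measurable_const) measurable_const)

/-- The measurable selection theorem of Kuratowski and Ryll-Nardzewski. -/
theorem exists_measurable_selection [CompleteSpace X] {F : Ω → Set X}
    (hclosed : ∀ ω, IsClosed (F ω)) (hne : ∀ ω, (F ω).Nonempty)
    (hF : ∀ c : X, ∀ r > 0, MeasurableSet {ω | (F ω ∩ Metric.closedBall c r).Nonempty}) :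
    ∃ f : Ω → X, Measurable f ∧ ∀ ω, f ω ∈ F ω := by
  classical
  rcases isEmpty_or_nonempty Ω with hΩ | ⟨⟨ω₀⟩⟩
  · exact ⟨hΩ.elim, measurable_of_empty _, hΩ.elim⟩
  have : Nonempty X := (hne ω₀).to_type
  let r : ℕ → ℝ := fun k => 2⁻¹ ^ k
  have r_pos : ∀ k, 0 < r k := fun k => by positivity
  let Approx : ℕ → Type _ := fun k =>
    {g : Ω → X // Measurable g ∧ ∀ ω, (F ω ∩ Metric.closedBall (g ω) (r k)).Nonempty}
  have first : Nonempty (Approx 0) := by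
    let q := denseSeq X
    have near : ∀ ω, ∃ n, (F ω ∩ Metric.closedBall (q n) (r 0)).Nonempty := fun ω => by
      obtain ⟨x, hx⟩ := hne ω
      obtain ⟨n, hn⟩ := (denseRange_denseSeq X).exists_dist_lt x (r_pos 0)
      exact ⟨n, x, hx, hn.le⟩
    exact ⟨fun ω => q (Nat.find (near ω)), (measurable_from_nat (f := q)).comp
      (measurable_find near fun n => hF _ _ (r_pos 0)), fun ω => Nat.find_spec (near ω)⟩
  have refinement : ∀ k (g : Approx k), ∃ g' : Approx (k + 1), ∀ ω,
      dist (g.1 ω) (g'.1 ω) ≤ r k + r (k + 1) := fun k g => by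
    obtain ⟨g', hg', hg'F, hdist⟩ := exists_measurable_near hF g.2.1 (r_pos (k + 1)) g.2.2
    exact ⟨⟨g', hg', hg'F⟩, hdist⟩
  choose next hnext using refinement
  let G : ∀ k, Approx k := fun k => Nat.rec first.some next k
  have hG : ∀ ω k, dist ((G k).1 ω) ((G (k + 1)).1 ω) ≤ 2 * 2⁻¹ ^ k := fun ω k => by
    refine (hnext k (G k) ω).trans ?_
    have : (0 : ℝ) < 2⁻¹ ^ k := r_pos k
    simp only [r, pow_succ]
    linarith
  choose f hf using fun ω => cauchySeq_tendsto_of_complete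
    (cauchySeq_of_le_geometric _ _ (by norm_num) (hG ω))
  refine ⟨f, measurable_of_tendsto_metrizable (fun k => (G k).2.1) (tendsto_pi_nhds.2 hf),
    fun ω => ?_⟩
  choose x hxF hx using fun k => (G k).2.2 ω
  have hxf : Tendsto x atTop (𝓝 (f ω)) :=
    (hf ω).congr_dist (squeeze_zero (fun _ => dist_nonneg)
      (fun k => Metric.mem_closedBall'.1 (hx k))
      (tendsto_pow_atTop_nhds_zero_of_lt_one (by norm_num) (by norm_num)))
  exact (hclosed ω).mem_of_tendsto hxf (Eventually.of_forall hxF)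

end Closed

theorem measurableSet_exists_argmax_mem [TopologicalSpace X] [PseudoMetrizableSpace X]
    [SeparableSpace X] {h : Ω → X → ℝ} (hm : ∀ x, Measurable (h · x))
    (hc : ∀ ω, Continuous (h ω)) {K : Set X} (hK : IsCompact K) :
    MeasurableSet {ω | ∃ x ∈ K, ∀ y, h ω y ≤ h ω x} := by
  rcases K.eq_empty_or_nonempty with rfl | hKne
  · simp
  have : Nonempty X := hKne.to_type
  have : Nonempty K := hKne.to_subtype
  let := pseudoMetrizableSpacePseudoMetric X
  have : SeparableSpace K := hK.isSeparable.separableSpace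
  let q := denseSeq X
  let p := denseSeq K
  suffices key : {ω | ∃ x ∈ K, ∀ y, h ω y ≤ h ω x} =
      ⋂ j : ℕ, ⋂ k : ℕ, ⋃ n : ℕ, {ω | h ω (q j) - 1 / ((k : ℝ) + 1) < h ω (p n)} by
    rw [key]
    exact MeasurableSet.iInter fun j => MeasurableSet.iInter fun k => MeasurableSet.iUnion fun n =>
      measurableSet_lt ((hm _).sub_const _) (hm _)
  ext ω
  simp only [Set.mem_ofPred_eq, Set.mem_iInter, Set.mem_iUnion]
  constructor
  · rintro ⟨x, hxK, hx⟩ j k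
    have hopen : IsOpen {z : K | h ω x - 1 / ((k : ℝ) + 1) < h ω z} :=
      isOpen_lt continuous_const ((hc ω).comp continuous_subtype_val)
    obtain ⟨n, hn⟩ := (denseRange_denseSeq K).exists_mem_open hopen
      ⟨⟨x, hxK⟩, sub_lt_self (h ω x) (by positivity)⟩
    exact ⟨n, (sub_le_sub_right (hx (q j)) _).trans_lt hn⟩
  · intro hω
    obtain ⟨x, hxK, hx⟩ := hK.exists_isMaxOn hKne (hc ω).continuousOn
    have hq : ∀ j, h ω (q j) ≤ h ω x := fun j => le_of_forall_pos_lt_add fun ε hε => by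
      obtain ⟨k, hk⟩ := exists_nat_one_div_lt hε
      obtain ⟨n, hn⟩ := hω j k
      linarith [isMaxOn_iff.1 hx (p n) (p n).2]
    exact ⟨x, hxK, fun y => (denseRange_denseSeq X).induction_on y
      (isClosed_le (hc ω) continuous_const) hq⟩

theorem exists_measurable_argmax [MetricSpace X] [ProperSpace X] [MeasurableSpace X]
    [BorelSpace X] {h : Ω → X → ℝ} (hm : ∀ x, Measurable (h · x))
    (hc : ∀ ω, Continuous (h ω)) (hmax : ∀ ω, ∃ x, ∀ y, h ω y ≤ h ω x) :
    ∃ f : Ω → X, Measurable f ∧ ∀ ω y, h ω y ≤ h ω (f ω) := by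
  refine exists_measurable_selection (F := fun ω => {x | ∀ y, h ω y ≤ h ω x}) (fun ω => ?_) hmax
    fun c r _ => ?_
  · simp only [Set.ofPred_forall]
    exact isClosed_iInter fun y => isClosed_le continuous_const (hc ω)
  · refine (measurableSet_exists_argmax_mem hm hc (isCompact_closedBall c r)).congr ?_
    ext ω
    exact exists_congr fun x => and_comm

end Selection

theorem hasAllMoments_const {Ω : Type*} [MeasurableSpace Ω] {P : Measure Ω}
    [IsFiniteMeasure P] (c : ℝ) : HasAllMoments P (fun _ => c) := fun _ => memLp_const c

namespace HasAllMoments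

variable {Ω : Type*} {mΩ : MeasurableSpace Ω} {P : Measure Ω} {X Y : Ω → ℝ}

theorem aestronglyMeasurable (hX : HasAllMoments P X) : AEStronglyMeasurable X P := (hX 0).1

theorem integrable (hX : HasAllMoments P X) : Integrable X P := by
  simpa only [Nat.cast_one, memLp_one_iff_integrable] using hX 1

theorem mono (hX : HasAllMoments P X) (hY : AEStronglyMeasurable Y P)
    (h : ∀ᵐ ω ∂P, |Y ω| ≤ |X ω|) : HasAllMoments P Y :=
  fun n => (hX n).mono hY h

theorem add (hX : HasAllMoments P X) (hY : HasAllMoments P Y) :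
    HasAllMoments P (fun ω => X ω + Y ω) := fun n => (hX n).add (hY n)

theorem mul (hX : HasAllMoments P X) (hY : HasAllMoments P Y) :
    HasAllMoments P (fun ω => X ω * Y ω) := fun n => by
  have : ENNReal.HolderTriple ((2 * n : ℕ) : ℝ≥0∞) ((2 * n : ℕ) : ℝ≥0∞) (n : ℝ≥0∞) := by
    constructor
    push_cast
    rw [ENNReal.mul_inv (by simp) (by simp), ← add_mul, ENNReal.inv_two_add_inv_two, one_mul]
  exact (hY (2 * n)).mul (hX (2 * n))

theorem abs (hX : HasAllMoments P X) : HasAllMoments P (fun ω => |X ω|) :=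
  fun n => (hX n).norm

theorem condExp (hX : HasAllMoments P X) (m : MeasurableSpace Ω) :
    HasAllMoments P (P[X|m]) := fun n => by
  rcases Nat.eq_zero_or_pos n with rfl | hn
  · simpa using integrable_condExp.aestronglyMeasurable
  · exact (hX n).condExp (by exact_mod_cast hn)

theorem max_zero (hX : HasAllMoments P X) : HasAllMoments P fun ω => max (X ω) 0 :=
  hX.mono (hX.aestronglyMeasurable.sup aestronglyMeasurable_const) (ae_of_all _ fun ω => by
    rw [abs_of_nonneg (le_max_right _ _)]
    exact max_le (le_abs_self _) (abs_nonneg _))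

variable [IsFiniteMeasure P]

theorem const_mul (hX : HasAllMoments P X) (c : ℝ) : HasAllMoments P (fun ω => c * X ω) :=
  (hasAllMoments_const c).mul hX

theorem pow (hX : HasAllMoments P X) (j : ℕ) : HasAllMoments P (fun ω => X ω ^ j) := by
  induction j with
  | zero => simpa only [pow_zero] using hasAllMoments_const 1
  | succ j ih => simpa only [pow_succ] using ih.mul hX

end HasAllMoments

/-! ### Regular utility functions -/

instance : MeasurableSpace C(ℝ, ℝ) := borel _

instance : BorelSpace C(ℝ, ℝ) := ⟨rfl⟩

theorem measurable_continuousMap_of_eval {Ω : Type*} {mΩ : MeasurableSpace Ω} {f : Ω → C(ℝ, ℝ)}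
    (hf : ∀ x, Measurable fun ω => f ω x) : Measurable f := by
  have hcont : Continuous fun (g : C(ℝ, ℝ)) (q : ℚ) => g (q : ℝ) :=
    continuous_pi fun q => continuous_eval_const (q : ℝ)
  have hinj : Function.Injective fun (g : C(ℝ, ℝ)) (q : ℚ) => g (q : ℝ) := fun g₁ g₂ h =>
    ContinuousMap.coe_injective <| Rat.denseRange_cast.equalizer g₁.continuous g₂.continuous h
  exact (hcont.measurableEmbedding hinj).measurable_comp_iff.1
    (measurable_pi_iff.2 fun q => hf q)

theorem map_mul_le_of_concaveOn {g : ℝ → ℝ} (hg : ConcaveOn ℝ Set.univ g) (hg0 : 0 ≤ g 0) (x : ℝ)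
    {l : ℝ} (hl : 1 ≤ l) : g (l * x) ≤ l * g x := by
  have hl0 : 0 < l := zero_lt_one.trans_le hl
  have hinv : 0 ≤ 1 - l⁻¹ := sub_nonneg.2 (inv_le_one_of_one_le₀ hl)
  have hconc : l⁻¹ * g (l * x) + (1 - l⁻¹) * g 0 ≤ g x := by
    simpa only [smul_eq_mul, mul_zero, add_zero, inv_mul_cancel_left₀ hl0.ne'] using
      hg.2 (Set.mem_univ (l * x)) (Set.mem_univ 0) (inv_nonneg.2 hl0.le) hinv
        (add_sub_cancel _ _)
  exact (inv_mul_le_iff₀ hl0).1 (by linarith [mul_nonneg hinv hg0])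

/-- Growth conditions on the terminal utility `U`. The pair `(θ, C)` encodes the asymptotic
elasticity `g (l * x) ≤ l ^ θ * (g x + C)` of the functions `g ≥ U` under consideration, with
`θ < 1` for elasticity at `+∞` and `1 < θ` for elasticity at `-∞`; `L` and `m` bound `U` from below
by a polynomial. -/
structure GrowthData (U : ℝ → ℝ) (θ C L : ℝ) (m : ℕ) : Prop where
  zero : U 0 = 0
  mono : Monotone U
  exponent_pos : 0 < θ
  exponent_ne_one : θ ≠ 1
  const_nonneg : 0 ≤ C
  lower_nonneg : 0 ≤ L
  lower : ∀ x, -(L * (1 + |x|) ^ m) ≤ U x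

/-- The pairs `(g, n)` of a concave nondecreasing function `g ≥ U` of elasticity `θ` and a depth
`n ≥ 1` such that `g (-n) ≤ -(C + 1)`. -/
def regularUtilitySet (U : ℝ → ℝ) (θ C : ℝ) : Set (C(ℝ, ℝ) × ℝ) :=
  {p | ConcaveOn ℝ Set.univ p.1 ∧ Monotone p.1 ∧ (∀ x, U x ≤ p.1 x) ∧
    (∀ x l : ℝ, 1 ≤ l → p.1 (l * x) ≤ l ^ θ * (p.1 x + C)) ∧ 1 ≤ p.2 ∧ p.1 (-p.2) ≤ -(C + 1)}

theorem isClosed_setOf_concaveOn_univ : IsClosed {g : C(ℝ, ℝ) | ConcaveOn ℝ Set.univ g} := by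
  simp only [ConcaveOn, convex_univ, true_and, Set.mem_univ, forall_true_left, Set.ofPred_forall]
  refine isClosed_iInter fun x => isClosed_iInter fun y => isClosed_iInter fun a =>
    isClosed_iInter fun b => isClosed_iInter fun _ => isClosed_iInter fun _ =>
    isClosed_iInter fun _ => isClosed_le ?_ (continuous_eval_const _)
  exact ((continuous_eval_const x).const_smul a).add ((continuous_eval_const y).const_smul b)

theorem isClosed_setOf_monotone : IsClosed {g : C(ℝ, ℝ) | Monotone g} := by
  simp only [Monotone, Set.ofPred_forall]
  exact isClosed_iInter fun x => isClosed_iInter fun y => isClosed_iInter fun _ =>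
    isClosed_le (continuous_eval_const _) (continuous_eval_const _)

theorem isClosed_regularUtilitySet (U : ℝ → ℝ) (θ C : ℝ) :
    IsClosed (regularUtilitySet U θ C) := by
  have ev : ∀ x : ℝ, Continuous fun p : C(ℝ, ℝ) × ℝ => p.1 x := fun x =>
    (continuous_eval_const x).comp continuous_fst
  have hle : IsClosed {p : C(ℝ, ℝ) × ℝ | ∀ x, U x ≤ p.1 x} := by
    simp only [Set.ofPred_forall]
    exact isClosed_iInter fun x => isClosed_le continuous_const (ev x)
  have helastic : IsClosed {p : C(ℝ, ℝ) × ℝ |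
      ∀ x l : ℝ, 1 ≤ l → p.1 (l * x) ≤ l ^ θ * (p.1 x + C)} := by
    simp only [Set.ofPred_forall]
    exact isClosed_iInter fun x => isClosed_iInter fun l => isClosed_iInter fun _ =>
      isClosed_le (ev _) (((ev _).add continuous_const).const_mul _)
  have hdepth : IsClosed {p : C(ℝ, ℝ) × ℝ | p.1 (-p.2) ≤ -(C + 1)} :=
    isClosed_le (ContinuousEval.continuous_eval.comp
      (continuous_fst.prodMk continuous_snd.neg)) continuous_const
  exact (isClosed_setOf_concaveOn_univ.preimage continuous_fst).inter <|
    (isClosed_setOf_monotone.preimage continuous_fst).inter <| hle.inter <| helastic.inter <|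
    (isClosed_le continuous_const continuous_snd).inter hdepth

/-- The Polish space of the possible values of a random utility function: regular utilities
together with a depth. Recording the depth bounds all quantities of the one-step problem by
measurable functions with finite moments. -/
abbrev RegularUtility (U : ℝ → ℝ) (θ C : ℝ) := ↥(regularUtilitySet U θ C)

instance (U : ℝ → ℝ) (θ C : ℝ) : PolishSpace (RegularUtility U θ C) :=
  (isClosed_regularUtilitySet U θ C).polishSpace

namespace RegularUtility

variable {U : ℝ → ℝ} {θ C L : ℝ} {m : ℕ} (s : RegularUtility U θ C)

/-- The function underlying a regular utility. -/
abbrev fn : ℝ → ℝ := s.1.1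

/-- The depth of a regular utility: its value at `-depth` is at most `-(C + 1)`. -/
abbrev depth : ℝ := s.1.2

theorem concave : ConcaveOn ℝ Set.univ s.fn := s.2.1

theorem mono : Monotone s.fn := s.2.2.1

theorem le_fn (x : ℝ) : U x ≤ s.fn x := s.2.2.2.1 x

theorem elastic (x : ℝ) {l : ℝ} (hl : 1 ≤ l) : s.fn (l * x) ≤ l ^ θ * (s.fn x + C) :=
  s.2.2.2.2.1 x l hl

theorem one_le_depth : 1 ≤ s.depth := s.2.2.2.2.2.1

theorem fn_neg_depth : s.fn (-s.depth) ≤ -(C + 1) := s.2.2.2.2.2.2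

theorem continuous_fn_uncurry : Continuous fun p : RegularUtility U θ C × ℝ => p.1.fn p.2 :=
  ContinuousEval.continuous_eval.comp
    ((continuous_fst.comp (continuous_subtype_val.comp continuous_fst)).prodMk continuous_snd)

theorem continuous_depth : Continuous fun s : RegularUtility U θ C => s.depth :=
  continuous_snd.comp continuous_subtype_val

theorem fn_zero_nonneg (hU : GrowthData U θ C L m) : 0 ≤ s.fn 0 :=
  hU.zero.symm.le.trans (s.le_fn 0)

theorem fn_one_nonneg (hU : GrowthData U θ C L m) : 0 ≤ s.fn 1 :=
  (s.fn_zero_nonneg hU).trans (s.mono zero_le_one)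

theorem fn_mul_le (hU : GrowthData U θ C L m) (x : ℝ) {l : ℝ} (hl : 1 ≤ l) :
    s.fn (l * x) ≤ l * s.fn x :=
  map_mul_le_of_concaveOn s.concave (s.fn_zero_nonneg hU) x hl

theorem fn_le (hU : GrowthData U θ C L m) (x : ℝ) : s.fn x ≤ (1 + |x|) * s.fn 1 := by
  have hscale := s.fn_mul_le hU 1 (l := 1 + |x|) (by linarith [abs_nonneg x])
  rw [mul_one] at hscale
  exact (s.mono (by linarith [le_abs_self x])).trans hscale

theorem abs_fn_le (hU : GrowthData U θ C L m) (x : ℝ) :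
    |s.fn x| ≤ (1 + |x|) * s.fn 1 + L * (1 + |x|) ^ m := by
  have hlower := (hU.lower x).trans (s.le_fn x)
  have hL : 0 ≤ L * (1 + |x|) ^ m := mul_nonneg hU.lower_nonneg (by positivity)
  have hone : 0 ≤ (1 + |x|) * s.fn 1 := mul_nonneg (by positivity) (s.fn_one_nonneg hU)
  exact abs_le.2 ⟨by linarith, by linarith [s.fn_le hU x]⟩

theorem fn_mul_le_rpow_min (hU : GrowthData U θ C L m) (x : ℝ) {l : ℝ} (hl : 1 ≤ l) :
    s.fn (l * x) ≤ l ^ min 1 θ * ((1 + |x|) * s.fn 1 + C) := by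
  have hC := hU.const_nonneg
  have hx := s.fn_le hU x
  rcases le_total 1 θ with h | h
  · rw [min_eq_left h, Real.rpow_one]
    exact (s.fn_mul_le hU x hl).trans (by gcongr; linarith)
  · rw [min_eq_right h]
    exact (s.elastic x hl).trans (by gcongr)

theorem fn_neg_mul_depth (hU : GrowthData U θ C L m) {l : ℝ} (hl : 1 ≤ l) :
    s.fn (-(l * s.depth)) ≤ -l ^ max 1 θ := by
  have hdepth := s.fn_neg_depth
  rw [← mul_neg]
  rcases le_total 1 θ with h | h
  · rw [max_eq_right h]
    calc s.fn (l * -s.depth) ≤ l ^ θ * (s.fn (-s.depth) + C) := s.elastic _ hl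
      _ ≤ l ^ θ * -1 := by gcongr; linarith
      _ = -l ^ θ := mul_neg_one _
  · rw [max_eq_left h, Real.rpow_one]
    calc s.fn (l * -s.depth) ≤ l * s.fn (-s.depth) := s.fn_mul_le hU _ hl
      _ ≤ l * -1 := by gcongr; linarith [hU.const_nonneg]
      _ = -l := mul_neg_one _

theorem fn_neg_le_of_depth_le (hU : GrowthData U θ C L m) {c r : ℝ} (hc : s.depth ≤ c)
    (hr : c ≤ r) : s.fn (-r) ≤ -(r / c) ^ max 1 θ := by
  have hc0 : 0 < c := zero_lt_one.trans_le (s.one_le_depth.trans hc)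
  have hl : 1 ≤ r / c := (one_le_div hc0).2 hr
  refine (s.mono (neg_le_neg ?_)).trans (s.fn_neg_mul_depth hU hl)
  calc r / c * s.depth ≤ r / c * c := by gcongr
    _ = r := div_mul_cancel₀ _ hc0.ne'

theorem fn_neg_le_neg_div (hU : GrowthData U θ C L m) {c r : ℝ} (hc : s.depth ≤ c)
    (hr : c ≤ r) : s.fn (-r) ≤ -(r / c) := by
  have hl : 1 ≤ r / c := (one_le_div (zero_lt_one.trans_le (s.one_le_depth.trans hc))).2 hr
  refine (s.fn_neg_le_of_depth_le hU hc hr).trans (neg_le_neg ?_)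
  simpa only [Real.rpow_one] using Real.rpow_le_rpow_of_exponent_le hl (le_max_left 1 θ)

end RegularUtility

section Integral

variable {α : Type*} [MeasurableSpace α] {μ : Measure α} {f g : α → ℝ}

theorem integral_le_integral_sub_measureReal_mul [IsFiniteMeasure μ] (hf : Integrable f μ)
    (hg : Integrable g μ) {B : Set α} (hB : MeasurableSet B) {p D : ℝ} (hp : p ≤ μ.real B)
    (hD : 0 ≤ D) (hfg : f ≤ᵐ[μ] g) (hfB : ∀ᵐ z ∂μ, z ∈ B → f z ≤ g z - D) :
    ∫ z, f z ∂μ ≤ ∫ z, g z ∂μ - p * D := by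
  have hind : Integrable (B.indicator fun _ => D) μ := (integrable_const D).indicator hB
  have hle : f ≤ᵐ[μ] g - B.indicator fun _ => D := by
    filter_upwards [hfg, hfB] with z hz hzB
    by_cases hmem : z ∈ B
    · simpa only [Pi.sub_apply, Set.indicator_of_mem hmem] using hzB hmem
    · simpa only [Pi.sub_apply, Set.indicator_of_notMem hmem, sub_zero] using hz
  calc ∫ z, f z ∂μ ≤ ∫ z, (g - B.indicator fun _ => D) z ∂μ :=
        integral_mono_ae hf (hg.sub hind) hle
    _ = ∫ z, g z ∂μ - μ.real B * D := by
        rw [integral_sub' hg hind, integral_indicator_const _ hB, smul_eq_mul]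
    _ ≤ ∫ z, g z ∂μ - p * D := by gcongr

theorem measureReal_le_div_of_integral_le (hf0 : ∀ z, 0 ≤ f z) (hf : Integrable f μ) {A c : ℝ}
    (hA : ∫ z, f z ∂μ ≤ A) (hc : 0 < c) : μ.real {z | c ≤ f z} ≤ A / c := by
  rw [le_div_iff₀' hc]
  exact (mul_meas_ge_le_integral_of_nonneg (ae_of_all μ hf0) hf c).trans hA

end Integral

/-! ### The one-step problem -/

section OneStep

variable {U : ℝ → ℝ} {θ C L : ℝ} {m : ℕ}

/-- The base of the power `radius`. -/
def radiusBase (θ C A x W : ℝ) : ℝ :=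
  2 * ((1 + max x 0) * (A + C) + W) * A * (4 * A ^ 3) ^ ⌈max 1 θ⌉₊

/-- An a priori bound for the strategies whose expected utility from the initial wealth `x` is at
least `-W`, under a law with constant `A`. Beyond it, a loss of order `l ^ max 1 θ` outweighs any
gain, of order at most `l ^ min 1 θ`; integer exponents make it a polynomial in `A`. -/
def radius (θ C A x W : ℝ) : ℝ := radiusBase θ C A x W ^ ⌈(max 1 θ - min 1 θ)⁻¹⌉₊

/-- A depth of the value function of the one-step problem under a law with constant `A`. -/
def nextDepth (θ C A : ℝ) : ℝ :=
  16 * A * ((1 + radius θ C A 0 (C + 1)) * A + C + 1) + 8 * radius θ C A 0 (C + 1) * A + 8 * A + 1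

section Constants

variable {A x W l : ℝ}

theorem one_le_four_mul_pow_three (hA : 1 ≤ A) : 1 ≤ 4 * A ^ 3 := by
  linarith [one_le_pow₀ hA (n := 3)]

theorem le_radiusBase (hA : 1 ≤ A) (hC : 0 ≤ C) (hW : 0 ≤ W) :
    (1 + max x 0) * (2 * A * (4 * A ^ 3)) ≤ radiusBase θ C A x W := by
  have hexp : ⌈max 1 θ⌉₊ ≠ 0 := (Nat.ceil_pos.2 (lt_max_of_lt_left one_pos)).ne'
  calc (1 + max x 0) * (2 * A * (4 * A ^ 3)) = 2 * ((1 + max x 0) * 1 + 0) * A * (4 * A ^ 3) := by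
        ring
    _ ≤ 2 * ((1 + max x 0) * (A + C) + W) * A * (4 * A ^ 3) ^ ⌈max 1 θ⌉₊ := by
        gcongr
        · linarith
        · exact le_self_pow₀ (one_le_four_mul_pow_three hA) hexp

theorem one_le_radiusBase (hA : 1 ≤ A) (hC : 0 ≤ C) (hW : 0 ≤ W) : 1 ≤ radiusBase θ C A x W :=
  (one_le_mul_of_one_le_of_one_le (by linarith [le_max_right x 0]) <|
    one_le_mul_of_one_le_of_one_le (by linarith) (one_le_four_mul_pow_three hA)).trans
    (le_radiusBase hA hC hW)

theorem exponent_gap_pos (hθ : θ ≠ 1) : 0 < max 1 θ - min 1 θ :=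
  sub_pos.2 (min_lt_max.2 hθ.symm)

theorem radiusBase_le_radius (hθ : θ ≠ 1) (hA : 1 ≤ A) (hC : 0 ≤ C) (hW : 0 ≤ W) :
    radiusBase θ C A x W ≤ radius θ C A x W :=
  le_self_pow₀ (one_le_radiusBase hA hC hW)
    (Nat.ceil_pos.2 (inv_pos.2 (exponent_gap_pos hθ))).ne'

theorem radius_nonneg (hA : 1 ≤ A) (hC : 0 ≤ C) (hW : 0 ≤ W) : 0 ≤ radius θ C A x W :=
  pow_nonneg (zero_le_one.trans (one_le_radiusBase hA hC hW)) _

theorem one_le_nextDepth (hA : 1 ≤ A) (hC : 0 ≤ C) : 1 ≤ nextDepth θ C A := by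
  have hR := radius_nonneg (θ := θ) (x := 0) hA hC (add_nonneg hC zero_le_one)
  exact le_add_of_nonneg_left (by positivity)

theorem four_mul_pow_three_le_of_radius_lt (hθ : θ ≠ 1) (hA : 1 ≤ A) (hC : 0 ≤ C) (hW : 0 ≤ W)
    (hl : radius θ C A x W < l) : 4 * A ^ 3 ≤ l :=
  calc 4 * A ^ 3 ≤ (1 + max x 0) * (2 * A) * (4 * A ^ 3) :=
        le_mul_of_one_le_left (by positivity)
          (one_le_mul_of_one_le_of_one_le (by linarith [le_max_right x 0]) (by linarith))
    _ = (1 + max x 0) * (2 * A * (4 * A ^ 3)) := mul_assoc _ _ _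
    _ ≤ l := (le_radiusBase hA hC hW).trans ((radiusBase_le_radius hθ hA hC hW).trans hl.le)

theorem le_div_of_radius_lt (hθ : θ ≠ 1) (hA : 1 ≤ A) (hC : 0 ≤ C) (hW : 0 ≤ W)
    (hl : radius θ C A x W < l) : x ≤ l / (2 * A) := by
  rw [le_div_iff₀ (by positivity)]
  calc x * (2 * A) ≤ (1 + max x 0) * (2 * A) := by gcongr; linarith [le_max_left x 0]
    _ ≤ (1 + max x 0) * (2 * A * (4 * A ^ 3)) := by
        gcongr _ * ?_
        exact le_mul_of_one_le_right (by positivity) (one_le_four_mul_pow_three hA)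
    _ ≤ l := (le_radiusBase hA hC hW).trans ((radiusBase_le_radius hθ hA hC hW).trans hl.le)

theorem radiusBase_lt_rpow (hθ : θ ≠ 1) (hA : 1 ≤ A) (hC : 0 ≤ C) (hW : 0 ≤ W)
    (hl : radius θ C A x W < l) : radiusBase θ C A x W < l ^ (max 1 θ - min 1 θ) := by
  have hgap := exponent_gap_pos hθ
  have hbase := one_le_radiusBase (θ := θ) (x := x) hA hC hW
  have hexp : 1 ≤ ⌈(max 1 θ - min 1 θ)⁻¹⌉₊ * (max 1 θ - min 1 θ) :=
    (inv_le_iff_one_le_mul₀ hgap).1 (Nat.le_ceil _)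
  calc radiusBase θ C A x W
      ≤ radiusBase θ C A x W ^ (⌈(max 1 θ - min 1 θ)⁻¹⌉₊ * (max 1 θ - min 1 θ)) :=
        Real.self_le_rpow_of_one_le hbase hexp
    _ = radius θ C A x W ^ (max 1 θ - min 1 θ) := by
        rw [radius, ← Real.rpow_natCast, ← Real.rpow_mul (zero_le_one.trans hbase)]
    _ < l ^ (max 1 θ - min 1 θ) := Real.rpow_lt_rpow (radius_nonneg hA hC hW) hl hgap

theorem gain_lt_loss (hθ0 : 0 ≤ θ) (hθ : θ ≠ 1) (hA : 1 ≤ A) (hC : 0 ≤ C) (hW : 0 ≤ W)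
    (hl : radius θ C A x W < l) :
    l ^ min 1 θ * ((1 + max x 0) * A + C) + W < 1 / (2 * A) * (l / (4 * A ^ 3)) ^ max 1 θ := by
  have hA3 := one_le_four_mul_pow_three hA
  have hl1 : 1 ≤ l := hA3.trans (four_mul_pow_three_le_of_radius_lt hθ hA hC hW hl)
  have hl0 : 0 < l := zero_lt_one.trans_le hl1
  have hgain : 1 ≤ l ^ min 1 θ := Real.one_le_rpow hl1 (le_min zero_le_one hθ0)
  have hx : 0 ≤ max x 0 * C := by positivity
  have hceil : (4 * A ^ 3) ^ max 1 θ ≤ (4 * A ^ 3) ^ ⌈max 1 θ⌉₊ := by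
    rw [← Real.rpow_natCast _ ⌈max 1 θ⌉₊]
    exact Real.rpow_le_rpow_of_exponent_le hA3 (Nat.le_ceil _)
  rw [Real.div_rpow hl0.le (by positivity), div_mul_div_comm, one_mul, lt_div_iff₀ (by positivity)]
  calc (l ^ min 1 θ * ((1 + max x 0) * A + C) + W) * (2 * A * (4 * A ^ 3) ^ max 1 θ)
      ≤ (l ^ min 1 θ * ((1 + max x 0) * (A + C)) + l ^ min 1 θ * W) *
          (2 * A * (4 * A ^ 3) ^ ⌈max 1 θ⌉₊) := by
        gcongr
        · linarith
        · exact le_mul_of_one_le_left hW hgain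
    _ = l ^ min 1 θ * radiusBase θ C A x W := by rw [radiusBase]; ring
    _ < l ^ min 1 θ * l ^ (max 1 θ - min 1 θ) := by
        gcongr
        exact radiusBase_lt_rpow hθ hA hC hW hl
    _ = l ^ max 1 θ := by rw [← Real.rpow_add hl0, add_sub_cancel]

end Constants

variable {E : Type*} [NormedAddCommGroup E] [InnerProductSpace ℝ E]

theorem RegularUtility.fn_add_inner_le_gain (hU : GrowthData U θ C L m) (s : RegularUtility U θ C)
    (x : ℝ) {ξ : E} (y : E) {l : ℝ} (hl : 1 ≤ l) (hξ : ‖ξ‖ ≤ l) :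
    s.fn (x + inner ℝ ξ y) ≤
      l ^ min 1 θ * ((1 + max x 0) * ((1 + ‖y‖) * s.fn 1) + C) := by
  have hone := s.fn_one_nonneg hU
  have hx := le_max_right x 0
  have harg : x + inner ℝ ξ y ≤ l * (max x 0 + ‖y‖) :=
    calc x + inner ℝ ξ y ≤ max x 0 + ‖ξ‖ * ‖y‖ := add_le_add (le_max_left x 0)
          (real_inner_le_norm ξ y)
      _ ≤ l * max x 0 + l * ‖y‖ := by gcongr; exact le_mul_of_one_le_left hx hl
      _ = l * (max x 0 + ‖y‖) := (mul_add _ _ _).symm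
  refine (s.mono harg).trans ((s.fn_mul_le_rpow_min hU _ hl).trans ?_)
  rw [abs_of_nonneg (by positivity), ← mul_assoc]
  gcongr
  linarith [mul_nonneg hx (norm_nonneg y)]

theorem RegularUtility.fn_add_inner_le_loss (hU : GrowthData U θ C L m) (s : RegularUtility U θ C)
    {x A : ℝ} {ξ y : E} (hA : 0 < A) (hξ : 4 * A ^ 3 ≤ ‖ξ‖) (hx : x ≤ ‖ξ‖ / (2 * A))
    (hy : inner ℝ (‖ξ‖⁻¹ • ξ) y ≤ -(1 / A)) (hdepth : s.depth ≤ 2 * A ^ 2) :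
    s.fn (x + inner ℝ ξ y) ≤ -(‖ξ‖ / (4 * A ^ 3)) ^ max 1 θ := by
  have hξ0 : 0 < ‖ξ‖ := hξ.trans_lt' (by positivity)
  have hdepth' : 2 * A ^ 2 ≤ ‖ξ‖ / (2 * A) := by
    rw [le_div_iff₀ (by positivity)]
    linarith
  have hinner : inner ℝ ξ y ≤ -(‖ξ‖ / A) := by
    rw [real_inner_smul_left, inv_mul_le_iff₀ hξ0] at hy
    exact hy.trans_eq (by ring)
  have hhalf : ‖ξ‖ / A = ‖ξ‖ / (2 * A) + ‖ξ‖ / (2 * A) := by field_simp; norm_num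
  calc s.fn (x + inner ℝ ξ y) ≤ s.fn (-(‖ξ‖ / (2 * A))) := s.mono (by linarith)
    _ ≤ -(‖ξ‖ / (2 * A) / (2 * A ^ 2)) ^ max 1 θ := s.fn_neg_le_of_depth_le hU hdepth hdepth'
    _ = -(‖ξ‖ / (4 * A ^ 3)) ^ max 1 θ := by rw [div_div]; ring_nf

/-- The event that the unit position `p` loses at least `1 / A`, at moderate depth. -/
def lossEvent (A : ℝ) (p : E) : Set (RegularUtility U θ C × E) :=
  {z | inner ℝ p z.2 ≤ -(1 / A)} \ {z | 2 * A ^ 2 ≤ z.1.depth}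

/-- The event that a position of norm `R` cannot recover half of the debt `N`, and that the depth is
at most `4 * A`. -/
def moderateEvent (A R N : ℝ) : Set (RegularUtility U θ C × E) :=
  ({z | N / 2 ≤ R * ‖z.2‖} ∪ {z | 4 * A ≤ z.1.depth})ᶜ

variable [MeasurableSpace E]

/-- A joint law of a regular utility and of an increment, whose integrability and no-arbitrage
bounds are controlled by the constant `A`. -/
structure GoodLaw (m : ℕ) (A : ℝ) (μ : Measure (RegularUtility U θ C × E)) : Prop where
  one_le : 1 ≤ A
  integrable_pow : Integrable (fun z => (1 + ‖z.2‖) ^ m) μ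
  integrable_fn_one : Integrable (fun z => (1 + ‖z.2‖) * z.1.fn 1) μ
  integral_fn_one : ∫ z, (1 + ‖z.2‖) * z.1.fn 1 ∂μ ≤ A
  integrable_norm : Integrable (fun z => ‖z.2‖) μ
  integral_norm : ∫ z, ‖z.2‖ ∂μ ≤ A
  integrable_depth : Integrable (fun z => z.1.depth) μ
  integral_depth : ∫ z, z.1.depth ∂μ ≤ A
  noArbitrage : ∃ L : Submodule ℝ E, (∀ᵐ z ∂μ, z.2 ∈ L) ∧
    ∀ p ∈ L, ‖p‖ = 1 → 1 / A ≤ μ.real {z | inner ℝ p z.2 ≤ -(1 / A)}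

/-- The expected utility `∫ g (x + ⟨ξ, y⟩) dμ` under a joint law of utility and increment. -/
def expUtility (μ : Measure (RegularUtility U θ C × E)) (x : ℝ) (ξ : E) : ℝ :=
  ∫ z, z.1.fn (x + inner ℝ ξ z.2) ∂μ

/-- The value `sup_ξ ∫ g (x + ⟨ξ, y⟩) dμ` of the one-step problem. -/
def stepValue (μ : Measure (RegularUtility U θ C × E)) (x : ℝ) : ℝ := ⨆ ξ, expUtility μ x ξ

theorem expUtility_congr {μ : Measure (RegularUtility U θ C × E)} {x : ℝ} {ξ η : E}
    (h : ∀ᵐ z ∂μ, (inner ℝ ξ z.2 : ℝ) = inner ℝ η z.2) :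
    expUtility μ x ξ = expUtility μ x η :=
  integral_congr_ae (h.mono fun z hz => by simp only [hz])

namespace GoodLaw

variable {A : ℝ} {μ : Measure (RegularUtility U θ C × E)}

theorem const_pos (h : GoodLaw m A μ) : 0 < A := zero_lt_one.trans_le h.one_le

theorem measureReal_depth_le (h : GoodLaw m A μ) {c : ℝ} (hc : 0 < c) :
    μ.real {z | c ≤ z.1.depth} ≤ A / c :=
  measureReal_le_div_of_integral_le (fun z => zero_le_one.trans z.1.one_le_depth)
    h.integrable_depth h.integral_depth hc

theorem le_measureReal_lossEvent [IsFiniteMeasure μ] (h : GoodLaw m A μ) {p : E}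
    (hp : 1 / A ≤ μ.real {z | inner ℝ p z.2 ≤ -(1 / A)}) :
    1 / (2 * A) ≤ μ.real (lossEvent A p) := by
  have hA := h.const_pos
  have hdeep : μ.real {z | 2 * A ^ 2 ≤ z.1.depth} ≤ 1 / (2 * A) :=
    (h.measureReal_depth_le (by positivity)).trans_eq (by field_simp)
  have hhalf : 1 / A = 1 / (2 * A) + 1 / (2 * A) := by field_simp; norm_num
  refine le_trans ?_ le_measureReal_sdiff
  linarith

theorem exists_inner_ae_eq_noArbitrage [FiniteDimensional ℝ E] (h : GoodLaw m A μ) (ξ : E) :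
    ∃ η : E, (∀ᵐ z ∂μ, (inner ℝ ξ z.2 : ℝ) = inner ℝ η z.2) ∧
      (η ≠ 0 → 1 / A ≤ μ.real {z | inner ℝ (‖η‖⁻¹ • η) z.2 ≤ -(1 / A)}) := by
  obtain ⟨L, hL, hna⟩ := h.noArbitrage
  refine ⟨L.starProjection ξ, ?_, fun hne => hna _ (L.smul_mem _ (by simp)) ?_⟩
  · filter_upwards [hL] with z hz
    rw [Submodule.inner_starProjection_left_eq_right L ξ z.2,
      Submodule.starProjection_eq_self_iff.2 hz]
  · rw [norm_smul, norm_inv, norm_norm, inv_mul_cancel₀ (norm_ne_zero_iff.2 hne)]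

end GoodLaw

variable [FiniteDimensional ℝ E] [BorelSpace E]

theorem measurableSet_lossEvent (A : ℝ) (p : E) :
    MeasurableSet (lossEvent A p : Set (RegularUtility U θ C × E)) :=
  (measurableSet_le (by fun_prop) measurable_const).diff (measurableSet_le measurable_const
    (RegularUtility.continuous_depth.comp continuous_fst).measurable)

theorem measurableSet_moderateEvent (A R N : ℝ) :
    MeasurableSet (moderateEvent A R N : Set (RegularUtility U θ C × E)) :=
  ((measurableSet_le measurable_const (by fun_prop)).union (measurableSet_le measurable_const
    (RegularUtility.continuous_depth.comp continuous_fst).measurable)).compl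

namespace RegularUtility

theorem measurable_fn_add_inner :
    Measurable fun p : (ℝ × E) × (RegularUtility U θ C × E) =>
      p.2.1.fn (p.1.1 + inner ℝ p.1.2 p.2.2) := by
  refine (continuous_fn_uncurry.comp ((continuous_fst.comp continuous_snd).prodMk ?_)).measurable
  fun_prop

theorem measurable_fn_add_inner_right (x : ℝ) (ξ : E) :
    Measurable fun z : RegularUtility U θ C × E => z.1.fn (x + inner ℝ ξ z.2) :=
  measurable_fn_add_inner.comp ((measurable_const (a := (x, ξ))).prodMk measurable_id)

end RegularUtility

namespace GoodLaw

variable {A : ℝ} {μ : Measure (RegularUtility U θ C × E)}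

theorem integrable_fn (hU : GrowthData U θ C L m) (h : GoodLaw m A μ) (x : ℝ) (ξ : E) :
    Integrable (fun z => z.1.fn (x + inner ℝ ξ z.2)) μ := by
  have harg : ∀ y : E, 1 + |x + inner ℝ ξ y| ≤ (1 + |x| + ‖ξ‖) * (1 + ‖y‖) := fun y => by
    have := mul_nonneg (abs_nonneg x) (norm_nonneg y)
    linarith [abs_add_le x (inner ℝ ξ y), abs_real_inner_le_norm ξ y, norm_nonneg y,
      norm_nonneg ξ]
  refine ((h.integrable_fn_one.const_mul (1 + |x| + ‖ξ‖)).add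
    (h.integrable_pow.const_mul (L * (1 + |x| + ‖ξ‖) ^ m))).mono'
    (RegularUtility.measurable_fn_add_inner_right x ξ).aestronglyMeasurable
    (ae_of_all _ fun z => (z.1.abs_fn_le hU _).trans (add_le_add ?_ ?_))
  · simp only [← mul_assoc]
    exact mul_le_mul_of_nonneg_right (harg z.2) (z.1.fn_one_nonneg hU)
  · simp only [mul_assoc, ← mul_pow]
    exact mul_le_mul_of_nonneg_left (pow_le_pow_left₀ (by positivity) (harg z.2) _) hU.lower_nonneg

theorem expUtility_concave (hU : GrowthData U θ C L m) (h : GoodLaw m A μ) {x₁ x₂ : ℝ}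
    {ξ₁ ξ₂ : E} {a b : ℝ} (ha : 0 ≤ a) (hb : 0 ≤ b) (hab : a + b = 1) :
    a * expUtility μ x₁ ξ₁ + b * expUtility μ x₂ ξ₂ ≤
      expUtility μ (a * x₁ + b * x₂) (a • ξ₁ + b • ξ₂) := by
  have h₁ := (h.integrable_fn hU x₁ ξ₁).const_mul a
  have h₂ := (h.integrable_fn hU x₂ ξ₂).const_mul b
  simp only [expUtility]
  rw [← integral_const_mul, ← integral_const_mul, ← integral_add h₁ h₂]
  refine integral_mono (h₁.add h₂) (h.integrable_fn hU _ _) fun z => ?_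
  refine (z.1.concave.2 (Set.mem_univ (x₁ + inner ℝ ξ₁ z.2)) (Set.mem_univ (x₂ + inner ℝ ξ₂ z.2))
    ha hb hab).trans_eq (congrArg z.1.fn ?_)
  simp only [smul_eq_mul, inner_add_left, real_inner_smul_left]
  ring

theorem continuous_expUtility (hU : GrowthData U θ C L m) (h : GoodLaw m A μ) (x : ℝ) :
    Continuous (expUtility μ x) := by
  rw [← continuousOn_univ]
  refine ConcaveOn.continuousOn isOpen_univ ⟨convex_univ, fun ξ₁ _ ξ₂ _ a b ha hb hab => ?_⟩
  simpa only [smul_eq_mul, ← add_mul, hab, one_mul] using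
    h.expUtility_concave hU (x₁ := x) (x₂ := x) (ξ₁ := ξ₁) (ξ₂ := ξ₂) ha hb hab

variable [IsProbabilityMeasure μ]

theorem le_expUtility_zero (hU : GrowthData U θ C L m) (h : GoodLaw m A μ) (x : ℝ) :
    U x ≤ expUtility μ x 0 :=
  calc U x = ∫ _, U x ∂μ := by rw [integral_const, probReal_univ, one_smul]
    _ ≤ expUtility μ x 0 := integral_mono (integrable_const _) (h.integrable_fn hU x 0) fun z => by
        simpa only [inner_zero_left, add_zero] using z.1.le_fn x

theorem norm_le_radius (hU : GrowthData U θ C L m) (h : GoodLaw m A μ) {ξ : E}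
    (hξ : ξ ≠ 0 → 1 / A ≤ μ.real {z | inner ℝ (‖ξ‖⁻¹ • ξ) z.2 ≤ -(1 / A)})
    {x W : ℝ} (hW : 0 ≤ W) (hle : -W ≤ expUtility μ x ξ) : ‖ξ‖ ≤ radius θ C A x W := by
  by_contra! hlt
  have hA := h.const_pos
  have hC := hU.const_nonneg
  have hA3 := four_mul_pow_three_le_of_radius_lt hU.exponent_ne_one h.one_le hC hW hlt
  have hxξ := le_div_of_radius_lt hU.exponent_ne_one h.one_le hC hW hlt
  have hξ1 : 1 ≤ ‖ξ‖ := (one_le_four_mul_pow_three h.one_le).trans hA3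
  have hgain : Integrable (fun z : RegularUtility U θ C × E =>
      ‖ξ‖ ^ min 1 θ * ((1 + max x 0) * ((1 + ‖z.2‖) * z.1.fn 1) + C)) μ :=
    ((h.integrable_fn_one.const_mul _).add (integrable_const C)).const_mul _
  have hgain_nonneg : ∀ z : RegularUtility U θ C × E,
      0 ≤ ‖ξ‖ ^ min 1 θ * ((1 + max x 0) * ((1 + ‖z.2‖) * z.1.fn 1) + C) := fun z => by
    have := z.1.fn_one_nonneg hU
    positivity
  have hbound : expUtility μ x ξ ≤ ‖ξ‖ ^ min 1 θ * ((1 + max x 0) * A + C) -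
      1 / (2 * A) * (‖ξ‖ / (4 * A ^ 3)) ^ max 1 θ := by
    refine (integral_le_integral_sub_measureReal_mul (D := (‖ξ‖ / (4 * A ^ 3)) ^ max 1 θ)
      (h.integrable_fn hU x ξ) hgain (measurableSet_lossEvent A _)
      (h.le_measureReal_lossEvent (hξ (norm_pos_iff.1 (zero_lt_one.trans_le hξ1)))) (by positivity)
      (ae_of_all _ fun z => z.1.fn_add_inner_le_gain hU x z.2 hξ1 le_rfl)
      (ae_of_all _ fun z hz => (z.1.fn_add_inner_le_loss hU hA hA3 hxξ hz.1
        (not_le.1 hz.2).le).trans ?_)).trans ?_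
    · linarith [hgain_nonneg z]
    · rw [integral_const_mul, integral_add (h.integrable_fn_one.const_mul _) (integrable_const C),
        integral_const_mul, integral_const, probReal_univ, one_smul]
      gcongr
      exact h.integral_fn_one
  linarith [gain_lt_loss hU.exponent_pos.le hU.exponent_ne_one h.one_le hC hW hlt]

theorem exists_max (hU : GrowthData U θ C L m) (h : GoodLaw m A μ) (x : ℝ) :
    ∃ ξ, ∀ η, expUtility μ x η ≤ expUtility μ x ξ := by
  have : ProperSpace E := FiniteDimensional.proper ℝ E
  let W := max 0 (-expUtility μ x 0)
  have hW : 0 ≤ W := le_max_left _ _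
  have hR := radius_nonneg (θ := θ) (x := x) h.one_le hU.const_nonneg hW
  obtain ⟨ξ, -, hξ⟩ := (isCompact_closedBall (0 : E) (radius θ C A x W)).exists_isMaxOn
    (Metric.nonempty_closedBall.2 hR) (h.continuous_expUtility hU x).continuousOn
  refine ⟨ξ, fun η => ?_⟩
  obtain ⟨η', hη', hna⟩ := h.exists_inner_ae_eq_noArbitrage η
  rw [expUtility_congr hη']
  by_cases hle : -W ≤ expUtility μ x η'
  · exact hξ (mem_closedBall_zero_iff.2 (h.norm_le_radius hU hna hW hle))
  · calc expUtility μ x η' ≤ -W := (not_le.1 hle).le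
      _ ≤ expUtility μ x 0 := neg_le.1 (le_max_right _ _)
      _ ≤ expUtility μ x ξ := hξ (Metric.mem_closedBall_self hR)

theorem ae_abs_inner_le (hU : GrowthData U θ C L m) (h : GoodLaw m A μ) {ξ : E} {x W : ℝ}
    (hW : 0 ≤ W) (hle : -W ≤ expUtility μ x ξ) :
    ∀ᵐ z ∂μ, |inner ℝ ξ z.2| ≤ radius θ C A x W * ‖z.2‖ := by
  obtain ⟨η, hη, hna⟩ := h.exists_inner_ae_eq_noArbitrage ξ
  have hnorm := h.norm_le_radius hU hna hW (hle.trans_eq (expUtility_congr hη))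
  filter_upwards [hη] with z hz
  rw [hz]
  exact (abs_real_inner_le_norm _ _).trans (by gcongr)

theorem expUtility_le_stepValue (hU : GrowthData U θ C L m) (h : GoodLaw m A μ) (x : ℝ) (ξ : E) :
    expUtility μ x ξ ≤ stepValue μ x := by
  obtain ⟨ξ₀, hξ₀⟩ := h.exists_max hU x
  exact le_ciSup ⟨_, Set.forall_mem_range.2 hξ₀⟩ ξ

theorem exists_eq_stepValue (hU : GrowthData U θ C L m) (h : GoodLaw m A μ) (x : ℝ) :
    ∃ ξ, stepValue μ x = expUtility μ x ξ := by
  obtain ⟨ξ, hξ⟩ := h.exists_max hU x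
  exact ⟨ξ, le_antisymm (ciSup_le hξ) (h.expUtility_le_stepValue hU x ξ)⟩

theorem le_stepValue (hU : GrowthData U θ C L m) (h : GoodLaw m A μ) (x : ℝ) :
    U x ≤ stepValue μ x :=
  (h.le_expUtility_zero hU x).trans (h.expUtility_le_stepValue hU x 0)

theorem concaveOn_stepValue (hU : GrowthData U θ C L m) (h : GoodLaw m A μ) :
    ConcaveOn ℝ Set.univ (stepValue μ) := by
  refine ⟨convex_univ, fun x₁ _ x₂ _ a b ha hb hab => ?_⟩
  obtain ⟨ξ₁, h₁⟩ := h.exists_eq_stepValue hU x₁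
  obtain ⟨ξ₂, h₂⟩ := h.exists_eq_stepValue hU x₂
  simp only [smul_eq_mul, h₁, h₂]
  exact (h.expUtility_concave hU ha hb hab).trans (h.expUtility_le_stepValue hU _ _)

theorem monotone_stepValue (hU : GrowthData U θ C L m) (h : GoodLaw m A μ) :
    Monotone (stepValue μ) := fun x₁ x₂ hx => by
  obtain ⟨ξ, hξ⟩ := h.exists_eq_stepValue hU x₁
  calc stepValue μ x₁ = expUtility μ x₁ ξ := hξ
    _ ≤ expUtility μ x₂ ξ := integral_mono (h.integrable_fn hU _ _) (h.integrable_fn hU _ _)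
        fun z => z.1.mono (add_le_add_left hx _)
    _ ≤ stepValue μ x₂ := h.expUtility_le_stepValue hU x₂ ξ

theorem continuous_stepValue (hU : GrowthData U θ C L m) (h : GoodLaw m A μ) :
    Continuous (stepValue μ) :=
  continuousOn_univ.1 ((h.concaveOn_stepValue hU).continuousOn isOpen_univ)

theorem expUtility_mul_le (hU : GrowthData U θ C L m) (h : GoodLaw m A μ) (x : ℝ) (ξ : E) {l : ℝ}
    (hl : 1 ≤ l) : expUtility μ (l * x) ξ ≤ l ^ θ * (expUtility μ x (l⁻¹ • ξ) + C) := by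
  have hint := h.integrable_fn hU x (l⁻¹ • ξ)
  have hl0 : l ≠ 0 := (zero_lt_one.trans_le hl).ne'
  calc expUtility μ (l * x) ξ
      ≤ ∫ z, l ^ θ * (z.1.fn (x + inner ℝ (l⁻¹ • ξ) z.2) + C) ∂μ := by
        refine integral_mono (h.integrable_fn hU _ _)
          ((hint.add (integrable_const C)).const_mul _) fun z => ?_
        simpa only [real_inner_smul_left, mul_add, mul_inv_cancel_left₀ hl0] using
          z.1.elastic (x + inner ℝ (l⁻¹ • ξ) z.2) hl
    _ = l ^ θ * (expUtility μ x (l⁻¹ • ξ) + C) := by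
        rw [integral_const_mul, integral_add hint (integrable_const C), integral_const,
          probReal_univ, one_smul, expUtility]

theorem stepValue_elastic (hU : GrowthData U θ C L m) (h : GoodLaw m A μ) (x : ℝ) {l : ℝ}
    (hl : 1 ≤ l) : stepValue μ (l * x) ≤ l ^ θ * (stepValue μ x + C) := by
  obtain ⟨ξ, hξ⟩ := h.exists_eq_stepValue hU (l * x)
  rw [hξ]
  refine (h.expUtility_mul_le hU x ξ hl).trans ?_
  gcongr
  exact h.expUtility_le_stepValue hU x (l⁻¹ • ξ)

theorem stepValue_one_le (hU : GrowthData U θ C L m) (h : GoodLaw m A μ) :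
    stepValue μ 1 ≤ (2 + radius θ C A 1 0) * A := by
  obtain ⟨ξ, hξ⟩ := h.exists_eq_stepValue hU 1
  have hU1 : 0 ≤ U 1 := hU.zero.symm.le.trans (hU.mono zero_le_one)
  have hR := radius_nonneg (θ := θ) (x := 1) h.one_le hU.const_nonneg le_rfl
  have hinner := h.ae_abs_inner_le hU (ξ := ξ) (x := 1) le_rfl
    (by rw [← hξ, neg_zero]; exact hU1.trans (h.le_stepValue hU 1))
  calc stepValue μ 1 = expUtility μ 1 ξ := hξ
    _ ≤ ∫ z, (2 + radius θ C A 1 0) * ((1 + ‖z.2‖) * z.1.fn 1) ∂μ := by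
        refine integral_mono_ae (h.integrable_fn hU _ _) (h.integrable_fn_one.const_mul _) ?_
        filter_upwards [hinner] with z hz
        refine (z.1.fn_le hU _).trans ?_
        rw [← mul_assoc]
        refine mul_le_mul_of_nonneg_right ?_ (z.1.fn_one_nonneg hU)
        have := abs_add_le 1 (inner ℝ ξ z.2)
        rw [abs_one] at this
        linarith [norm_nonneg z.2]
    _ ≤ (2 + radius θ C A 1 0) * A := by
        rw [integral_const_mul]
        gcongr
        exact h.integral_fn_one

theorem half_le_measureReal_moderateEvent (h : GoodLaw m A μ) {R N : ℝ} (hR : 0 ≤ R) (hN : 0 < N)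
    (hRN : 8 * (R * A) ≤ N) :
    1 / 2 ≤ μ.real (moderateEvent A R N) := by
  have hA := h.const_pos
  have hnorm : μ.real {z | N / 2 ≤ R * ‖z.2‖} ≤ 1 / 4 := by
    refine (measureReal_le_div_of_integral_le (A := R * A) (fun z => by positivity)
      (h.integrable_norm.const_mul R) ?_ (half_pos hN)).trans ?_
    · rw [integral_const_mul]
      gcongr
      exact h.integral_norm
    · rw [div_le_iff₀ (half_pos hN)]
      linarith
  have hdepth : μ.real {z | 4 * A ≤ z.1.depth} ≤ 1 / 4 :=
    (h.measureReal_depth_le (by positivity)).trans_eq (by field_simp)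
  rw [moderateEvent, probReal_compl_eq_one_sub (measurableSet_moderateEvent A R N).of_compl]
  linarith [measureReal_union_le (μ := μ) {z | N / 2 ≤ R * ‖z.2‖} {z | 4 * A ≤ z.1.depth}]

theorem expUtility_neg_le (hU : GrowthData U θ C L m) (h : GoodLaw m A μ) {ξ : E} {R N : ℝ}
    (hR : 0 ≤ R) (hξ : ∀ᵐ z ∂μ, |inner ℝ ξ z.2| ≤ R * ‖z.2‖) (hRN : 8 * (R * A) ≤ N)
    (hAN : 8 * A ≤ N) : expUtility μ (-N) ξ ≤ (1 + R) * A - N / (16 * A) := by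
  have hA := h.const_pos
  have hN : 0 < N := by linarith
  have hgain : ∀ᵐ z ∂μ, z.1.fn (-N + inner ℝ ξ z.2) ≤ (1 + R) * ((1 + ‖z.2‖) * z.1.fn 1) := by
    filter_upwards [hξ] with z hz
    have hone := z.1.fn_one_nonneg hU
    calc z.1.fn (-N + inner ℝ ξ z.2) ≤ z.1.fn (R * ‖z.2‖) :=
          z.1.mono (by linarith [(le_abs_self _).trans hz])
      _ ≤ (1 + R * ‖z.2‖) * z.1.fn 1 := by
          simpa only [abs_of_nonneg (mul_nonneg hR (norm_nonneg z.2))] using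
            z.1.fn_le hU (R * ‖z.2‖)
      _ ≤ (1 + R) * ((1 + ‖z.2‖) * z.1.fn 1) := by
          rw [← mul_assoc]
          gcongr
          linarith [norm_nonneg z.2]
  have hloss : ∀ᵐ z ∂μ, z ∈ moderateEvent A R N →
      z.1.fn (-N + inner ℝ ξ z.2) ≤ (1 + R) * ((1 + ‖z.2‖) * z.1.fn 1) - N / (8 * A) := by
    filter_upwards [hξ] with z hz hmod
    simp only [moderateEvent, Set.mem_compl_iff, Set.mem_union, Set.mem_ofPred_eq, not_or,
      not_le] at hmod
    have hone := z.1.fn_one_nonneg hU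
    have hpos : 0 ≤ (1 + R) * ((1 + ‖z.2‖) * z.1.fn 1) := by positivity
    calc z.1.fn (-N + inner ℝ ξ z.2) ≤ z.1.fn (-(N / 2)) :=
          z.1.mono (by linarith [(le_abs_self _).trans hz])
      _ ≤ -(N / 2 / (4 * A)) := z.1.fn_neg_le_neg_div hU hmod.2.le (by linarith)
      _ = 0 - N / (8 * A) := by rw [div_div]; ring
      _ ≤ _ := by gcongr
  refine (integral_le_integral_sub_measureReal_mul (h.integrable_fn hU _ ξ)
    (h.integrable_fn_one.const_mul (1 + R)) (measurableSet_moderateEvent A R N)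
    (h.half_le_measureReal_moderateEvent hR hN hRN) (by positivity) hgain hloss).trans ?_
  rw [integral_const_mul, show 1 / 2 * (N / (8 * A)) = N / (16 * A) by ring]
  gcongr
  exact h.integral_fn_one

theorem stepValue_neg_nextDepth (hU : GrowthData U θ C L m) (h : GoodLaw m A μ) :
    stepValue μ (-nextDepth θ C A) ≤ -(C + 1) := by
  by_contra! hlt
  obtain ⟨ξ, hξ⟩ := h.exists_eq_stepValue hU (-nextDepth θ C A)
  have hA := h.const_pos
  have hC1 : 0 ≤ C + 1 := add_nonneg hU.const_nonneg zero_le_one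
  have hN0 := zero_le_one.trans (one_le_nextDepth (θ := θ) h.one_le hU.const_nonneg)
  have hradius : radius θ C A (-nextDepth θ C A) (C + 1) = radius θ C A 0 (C + 1) := by
    simp only [radius, radiusBase, max_self, max_eq_right (neg_nonpos.2 hN0)]
  have hinner := h.ae_abs_inner_le hU (ξ := ξ) (x := -nextDepth θ C A) hC1
    (by rw [← hξ]; exact hlt.le)
  rw [hradius] at hinner
  have hR := radius_nonneg (θ := θ) (x := 0) h.one_le hU.const_nonneg hC1
  have hN : nextDepth θ C A = 16 * A * ((1 + radius θ C A 0 (C + 1)) * A + C + 1) +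
    8 * radius θ C A 0 (C + 1) * A + 8 * A + 1 := rfl
  have hRA : 0 ≤ 8 * radius θ C A 0 (C + 1) * A := by positivity
  have hmain : 0 ≤ 16 * A * ((1 + radius θ C A 0 (C + 1)) * A + C + 1) := by
    rw [add_assoc]
    positivity
  have hle := h.expUtility_neg_le (N := nextDepth θ C A) hU hR hinner (by linarith) (by linarith)
  have hloss : (1 + radius θ C A 0 (C + 1)) * A + C + 1 ≤ nextDepth θ C A / (16 * A) := by
    rw [le_div_iff₀' (by positivity)]
    linarith
  linarith

/-- The value function of the one-step problem, as a regular utility. -/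
def next (hU : GrowthData U θ C L m) (h : GoodLaw m A μ) : RegularUtility U θ C :=
  ⟨(⟨stepValue μ, h.continuous_stepValue hU⟩, nextDepth θ C A), h.concaveOn_stepValue hU,
    h.monotone_stepValue hU, h.le_stepValue hU, fun x _ hl => h.stepValue_elastic hU x hl,
    one_le_nextDepth h.one_le hU.const_nonneg, h.stepValue_neg_nextDepth hU⟩

end GoodLaw

end OneStep

/-! ### Regular conditional laws -/

section CondDistrib

variable {Ω β 𝒵 : Type*} {mΩ : MeasurableSpace Ω} {mβ : MeasurableSpace β}
  {m𝒵 : MeasurableSpace 𝒵} [StandardBorelSpace 𝒵] [Nonempty 𝒵] {P : Measure Ω}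
  [IsFiniteMeasure P] {X : Ω → β} {Z : Ω → 𝒵}

theorem ae_condDistrib_iff (hX : Measurable X) (hZ : Measurable Z) {s : Set (β × 𝒵)}
    (hs : MeasurableSet s) :
    (∀ᵐ ω ∂P, ∀ᵐ z ∂condDistrib Z X P (X ω), (X ω, z) ∈ s) ↔ ∀ᵐ ω ∂P, (X ω, Z ω) ∈ s := by
  have hsection : MeasurableSet {x | ∀ᵐ z ∂condDistrib Z X P x, (x, z) ∈ s} :=
    Kernel.measurable_kernel_prodMk_left hs.compl (measurableSet_singleton 0)
  rw [← ae_map_iff hX.aemeasurable hsection,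
    ← ae_map_iff (p := (· ∈ s)) (hX.prodMk hZ).aemeasurable hs,
    ← compProd_map_condDistrib hZ.aemeasurable]
  exact (Measure.ae_compProd_iff hs).symm

theorem lintegral_comp_eq_lintegral_condDistrib (hX : Measurable X) (hZ : Measurable Z)
    {F : β × 𝒵 → ℝ≥0∞} (hF : Measurable F) :
    ∫⁻ ω, F (X ω, Z ω) ∂P = ∫⁻ ω, ∫⁻ z, F (X ω, z) ∂condDistrib Z X P (X ω) ∂P := by
  rw [← lintegral_map hF (hX.prodMk hZ), ← compProd_map_condDistrib hZ.aemeasurable,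
    Measure.lintegral_compProd hF, lintegral_map hF.lintegral_kernel_prod_right' hX]

end CondDistrib

section RegularLaw

variable {Ω 𝒵 : Type*} {m mΩ : MeasurableSpace Ω} {m𝒵 : MeasurableSpace 𝒵}
  [StandardBorelSpace 𝒵] [Nonempty 𝒵] {P : Measure Ω} [IsFiniteMeasure P] {Z : Ω → 𝒵}

/-- A regular conditional law of `Z` given the σ-algebra `m`: `condLaw` for variables in any
standard Borel space. -/
def regularLaw (P : Measure Ω) [IsFiniteMeasure P] (m : MeasurableSpace Ω) (Z : Ω → 𝒵) :
    @Kernel Ω 𝒵 m m𝒵 :=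
  @condDistrib Ω Ω 𝒵 _ _ _ mΩ m Z id P _

instance : @IsMarkovKernel Ω 𝒵 m m𝒵 (regularLaw P m Z) := by
  unfold regularLaw
  infer_instance

instance (ω : Ω) : IsProbabilityMeasure (regularLaw P m Z ω) :=
  IsMarkovKernel.isProbabilityMeasure (mα := m) (κ := regularLaw P m Z) ω

theorem measurableSet_ae_regularLaw {s : Set (Ω × 𝒵)} (hs : MeasurableSet[m.prod m𝒵] s) :
    MeasurableSet[m] {ω | ∀ᵐ z ∂regularLaw P m Z ω, (ω, z) ∈ s} :=
  Kernel.measurable_kernel_prodMk_left (κ := regularLaw P m Z) hs.compl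
    (measurableSet_singleton 0)

theorem measurable_lintegral_regularLaw {F : Ω × 𝒵 → ℝ≥0∞} (hF : Measurable[m.prod m𝒵] F) :
    Measurable[m] fun ω => ∫⁻ z, F (ω, z) ∂regularLaw P m Z ω :=
  @Measurable.lintegral_kernel_prod_right' Ω 𝒵 m m𝒵 (regularLaw P m Z) _ F hF

theorem measurable_integral_regularLaw {F : Type*} [NormedAddCommGroup F] [NormedSpace ℝ F]
    [MeasurableSpace F] [BorelSpace F] [SecondCountableTopology F] {f : Ω × 𝒵 → F}
    (hf : Measurable[m.prod m𝒵] f) :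
    Measurable[m] fun ω => ∫ z, f (ω, z) ∂regularLaw P m Z ω :=
  (StronglyMeasurable.integral_kernel_prod_right' (κ := regularLaw P m Z)
    hf.stronglyMeasurable).measurable

theorem ae_regularLaw_iff (hm : m ≤ mΩ) (hZ : Measurable Z) {s : Set (Ω × 𝒵)}
    (hs : MeasurableSet[m.prod m𝒵] s) :
    (∀ᵐ ω ∂P, ∀ᵐ z ∂regularLaw P m Z ω, (ω, z) ∈ s) ↔ ∀ᵐ ω ∂P, (ω, Z ω) ∈ s :=
  ae_condDistrib_iff (mβ := m) (measurable_id'' hm) hZ hs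

theorem lintegral_comp_eq_lintegral_regularLaw (hm : m ≤ mΩ) (hZ : Measurable Z)
    {F : Ω × 𝒵 → ℝ≥0∞} (hF : Measurable[m.prod m𝒵] F) :
    ∫⁻ ω, F (ω, Z ω) ∂P = ∫⁻ ω, ∫⁻ z, F (ω, z) ∂regularLaw P m Z ω ∂P :=
  lintegral_comp_eq_lintegral_condDistrib (mβ := m) (measurable_id'' hm) hZ hF

theorem condLExp_comp_ae_eq (hm : m ≤ mΩ) (hZ : Measurable Z) {F : Ω × 𝒵 → ℝ≥0∞}
    (hF : Measurable[m.prod m𝒵] F) :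
    (fun ω => ∫⁻ z, F (ω, z) ∂regularLaw P m Z ω) =ᵐ[P] condLExp m P fun ω => F (ω, Z ω) := by
  refine ae_eq_condLExp hm P _ (measurable_lintegral_regularLaw hF) fun s hs => ?_
  have hcylinder : MeasurableSet[m.prod m𝒵] (Prod.fst ⁻¹' s : Set (Ω × 𝒵)) :=
    @measurable_fst _ _ m m𝒵 s hs
  have hindicator := lintegral_comp_eq_lintegral_regularLaw (P := P) hm hZ
    (hF.indicator hcylinder)
  rw [← lintegral_indicator (hm s hs), ← lintegral_indicator (hm s hs)]
  refine (lintegral_congr fun ω => ?_).trans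
    (hindicator.symm.trans (lintegral_congr fun ω => ?_)) <;>
  by_cases hω : ω ∈ s <;> simp [Set.indicator, hω]

theorem integrable_regularLaw (hm : m ≤ mΩ) (hZ : Measurable Z) {f : Ω × 𝒵 → ℝ}
    (hf : Measurable[m.prod m𝒵] f) (hint : Integrable (fun ω => f (ω, Z ω)) P) :
    ∀ᵐ ω ∂P, Integrable (fun z => f (ω, z)) (regularLaw P m Z ω) := by
  have hnorm : Measurable[m.prod m𝒵] fun p => ‖f p‖ₑ := measurable_enorm.comp hf
  have hfin := hint.2
  rw [HasFiniteIntegral, lintegral_comp_eq_lintegral_regularLaw hm hZ hnorm] at hfin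
  filter_upwards [ae_lt_top ((measurable_lintegral_regularLaw hnorm).mono hm le_rfl) hfin.ne]
    with ω hω
  exact ⟨(hf.comp measurable_prodMk_left).aestronglyMeasurable, hω⟩

theorem condExp_comp_ae_eq {F : Type*} [NormedAddCommGroup F] [NormedSpace ℝ F] [CompleteSpace F]
    (hm : m ≤ mΩ) (hZ : Measurable Z) {f : Ω × 𝒵 → F} (hf : StronglyMeasurable[m.prod m𝒵] f)
    (hint : Integrable (fun ω => f (ω, Z ω)) P) :
    P[fun ω => f (ω, Z ω) | m] =ᵐ[P] fun ω => ∫ z, f (ω, z) ∂regularLaw P m Z ω := by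
  have h := condExp_prod_ae_eq_integral_condDistrib (μ := P) (X := (id : Ω → Ω)) (mβ := m)
    (measurable_id'' hm) hZ.aemeasurable hf hint
  rwa [MeasurableSpace.comap_id] at h

theorem condProb_comp_ae_eq (hm : m ≤ mΩ) (hZ : Measurable Z) {s : Set (Ω × 𝒵)}
    (hs : MeasurableSet[m.prod m𝒵] s) :
    P⟦{ω | (ω, Z ω) ∈ s} | m⟧ =ᵐ[P] fun ω => (regularLaw P m Z ω).real {z | (ω, z) ∈ s} := by
  have hpair : Measurable[mΩ, m.prod m𝒵] fun ω => (ω, Z ω) := (measurable_id'' hm).prodMk hZ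
  have hindicator : StronglyMeasurable[m.prod m𝒵] (s.indicator fun _ => (1 : ℝ)) :=
    stronglyMeasurable_const.indicator hs
  have hint : Integrable (fun ω => s.indicator (fun _ => (1 : ℝ)) (ω, Z ω)) P :=
    (integrable_const (1 : ℝ)).indicator (hpair hs)
  filter_upwards [condExp_comp_ae_eq hm hZ hindicator hint] with ω hω
  exact hω.trans (integral_indicator_one (measurable_prodMk_left hs))

theorem integrable_integral_regularLaw (hm : m ≤ mΩ) (hZ : Measurable Z) {f : Ω × 𝒵 → ℝ}
    (hf : Measurable[m.prod m𝒵] f) (hint : Integrable (fun ω => f (ω, Z ω)) P) :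
    Integrable (fun ω => ∫ z, f (ω, z) ∂regularLaw P m Z ω) P :=
  integrable_condExp.congr (condExp_comp_ae_eq hm hZ hf.stronglyMeasurable hint)

theorem integral_comp_eq_integral_regularLaw (hm : m ≤ mΩ) (hZ : Measurable Z) {f : Ω × 𝒵 → ℝ}
    (hf : Measurable[m.prod m𝒵] f) (hint : Integrable (fun ω => f (ω, Z ω)) P) :
    ∫ ω, f (ω, Z ω) ∂P = ∫ ω, ∫ z, f (ω, z) ∂regularLaw P m Z ω ∂P := by
  rw [← integral_condExp hm,
    integral_congr_ae (condExp_comp_ae_eq hm hZ hf.stronglyMeasurable hint)]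

end RegularLaw

/-! ### The linear span of a law -/

section WeightedMoment

variable {E : Type*} [NormedAddCommGroup E] [InnerProductSpace ℝ E]

theorem exists_inner_eq_one_of_zero_notMem {D : AffineSubspace ℝ E} [FiniteDimensional ℝ E]
    (h0 : (0 : E) ∉ D) : ∃ p : E, ∀ y ∈ D, inner ℝ p y = (1 : ℝ) := by
  rcases D.eq_bot_or_nonempty with rfl | hD
  · exact ⟨0, fun y hy => (AffineSubspace.notMem_bot ℝ E y hy).elim⟩
  have := hD.to_subtype
  obtain ⟨q, hq⟩ : ∃ q, q = EuclideanGeometry.orthogonalProjection D (0 : E) := ⟨_, rfl⟩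
  have hq0 : (q : E) ≠ 0 := fun h => h0 (h ▸ q.2)
  have hinner : ∀ y ∈ D, inner ℝ (q : E) y = inner ℝ (q : E) (q : E) := fun y hy => by
    have horth := EuclideanGeometry.orthogonalProjection_vsub_mem_direction_orthogonal D (0 : E)
    rw [← hq, vsub_eq_sub, sub_zero] at horth
    have := Submodule.inner_left_of_mem_orthogonal
      (AffineSubspace.vsub_mem_direction hy q.2) horth
    rwa [vsub_eq_sub, inner_sub_right, sub_eq_zero] at this
  refine ⟨(inner ℝ (q : E) (q : E) : ℝ)⁻¹ • (q : E), fun y hy => ?_⟩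
  rw [real_inner_smul_left, hinner y hy, inv_mul_cancel₀ (inner_self_ne_zero.2 hq0)]

theorem integral_mem_submodule {α : Type*} [MeasurableSpace α] {μ : Measure α} {f : α → E}
    [FiniteDimensional ℝ E] {K : Submodule ℝ E} (hf : ∀ᵐ a ∂μ, f a ∈ K) : ∫ a, f a ∂μ ∈ K := by
  by_cases hint : Integrable f μ
  · rw [← Submodule.starProjection_eq_self_iff, ← ContinuousLinearMap.integral_comp_comm _ hint]
    exact integral_congr_ae (hf.mono fun a ha => Submodule.starProjection_eq_self_iff.2 ha)
  · rw [integral_undef hint]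
    exact K.zero_mem

variable [MeasurableSpace E]

/-- The mean `∫ (1 + ‖y‖²)⁻¹ y dν`, whose weight makes it converge for every finite law. -/
def weightedMean (ν : Measure E) : E := ∫ y, (1 + ‖y‖ ^ 2)⁻¹ • y ∂ν

variable [FiniteDimensional ℝ E] [BorelSpace E] {ν : Measure E} [IsFiniteMeasure ν]

theorem integrable_weightedMoment (v : E) :
    Integrable (fun y => ((1 + ‖y‖ ^ 2)⁻¹ * inner ℝ v y) • y) ν := by
  refine (integrable_const ‖v‖).mono' (by fun_prop) (ae_of_all _ fun y => ?_)
  rw [norm_smul, norm_mul, norm_inv, Real.norm_of_nonneg (by positivity : 0 ≤ 1 + ‖y‖ ^ 2),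
    mul_assoc, inv_mul_le_iff₀ (by positivity)]
  calc ‖inner ℝ v y‖ * ‖y‖ ≤ ‖v‖ * ‖y‖ * ‖y‖ := by gcongr; exact norm_inner_le_norm v y
    _ ≤ (1 + ‖y‖ ^ 2) * ‖v‖ := by linarith [norm_nonneg v]

/-- The second moment operator `v ↦ ∫ (1 + ‖y‖²)⁻¹ ⟨v, y⟩ y dν`, weighted as `weightedMean`. Its
range is the linear span of the support of `ν`. -/
def weightedMoment (ν : Measure E) [IsFiniteMeasure ν] : E →ₗ[ℝ] E where
  toFun v := ∫ y, ((1 + ‖y‖ ^ 2)⁻¹ * inner ℝ v y) • y ∂ν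
  map_add' v w := by
    rw [← integral_add (integrable_weightedMoment v) (integrable_weightedMoment w)]
    simp only [inner_add_left, mul_add, add_smul]
  map_smul' r v := by
    rw [RingHom.id_apply, ← integral_smul]
    simp only [real_inner_smul_left, smul_smul, mul_left_comm]

theorem weightedMoment_apply (v : E) :
    weightedMoment ν v = ∫ y, ((1 + ‖y‖ ^ 2)⁻¹ * inner ℝ v y) • y ∂ν := rfl

theorem ae_inner_eq_zero_of_inner_weightedMoment {v : E}
    (hv : inner ℝ v (weightedMoment ν v) = (0 : ℝ)) : ∀ᵐ y ∂ν, (inner ℝ v y : ℝ) = 0 := by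
  have hint := (integrable_weightedMoment (ν := ν) v).const_inner (𝕜 := ℝ) v
  rw [weightedMoment_apply, ← integral_inner (integrable_weightedMoment v)] at hv
  simp only [real_inner_smul_right] at hv hint
  rw [integral_eq_zero_iff_of_nonneg (fun y => ?_) hint] at hv
  · filter_upwards [hv] with y hy
    have hweight : (1 + ‖y‖ ^ 2)⁻¹ ≠ 0 := by positivity
    simpa [hweight] using hy
  · simp only [Pi.zero_apply, mul_assoc]
    exact mul_nonneg (by positivity) (mul_self_nonneg _)

omit [BorelSpace E] [IsFiniteMeasure ν] in
theorem ae_mem_span_support : ∀ᵐ y ∂ν, y ∈ Submodule.span ℝ ν.support := by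
  filter_upwards [Measure.support_mem_ae (μ := ν)] with y hy using Submodule.subset_span hy

theorem range_weightedMoment :
    LinearMap.range (weightedMoment ν) = Submodule.span ℝ ν.support := by
  refine le_antisymm ?_ ?_
  · rintro _ ⟨v, rfl⟩
    exact integral_mem_submodule (ae_mem_span_support.mono fun y hy => Submodule.smul_mem _ _ hy)
  · rw [← Submodule.orthogonal_le_orthogonal_iff]
    intro w hw
    have hker := ae_inner_eq_zero_of_inner_weightedMoment
      (Submodule.inner_left_of_mem_orthogonal (LinearMap.mem_range_self _ w) hw)
    have hsupport : ν.support ⊆ {y : E | (inner ℝ w y : ℝ) = 0} :=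
      Measure.support_subset_of_isClosed (isClosed_eq (by fun_prop) continuous_const) hker
    exact (Submodule.mem_orthogonal' _ _).2 fun y hy =>
      Submodule.span_induction (p := fun y _ => (inner ℝ w y : ℝ) = 0) (fun y hy => hsupport hy)
        (inner_zero_right w) (fun y z _ _ hy hz => by rw [inner_add_right, hy, hz, add_zero])
        (fun r y _ hy => by rw [real_inner_smul_right, hy, mul_zero]) hy

theorem weightedMean_mem_range : weightedMean ν ∈ LinearMap.range (weightedMoment ν) := by
  rw [range_weightedMoment]
  exact integral_mem_submodule (ae_mem_span_support.mono fun y hy => Submodule.smul_mem _ _ hy)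

theorem ae_inner_eq_one_of_zero_notMem {p : E} (hp : weightedMoment ν p = weightedMean ν)
    (h0 : (0 : E) ∉ affineSpan ℝ ν.support) : ∀ᵐ y ∂ν, (inner ℝ p y : ℝ) = 1 := by
  obtain ⟨q, hq⟩ := exists_inner_eq_one_of_zero_notMem h0
  have hq1 : ∀ᵐ y ∂ν, (inner ℝ q y : ℝ) = 1 := by
    filter_upwards [Measure.support_mem_ae (μ := ν)] with y hy
    exact hq y (subset_affineSpan ℝ _ hy)
  have hqmean : weightedMoment ν q = weightedMean ν :=
    integral_congr_ae (hq1.mono fun y hy => by simp only [hy, mul_one])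
  have hker : inner ℝ (p - q) (weightedMoment ν (p - q)) = (0 : ℝ) := by
    rw [map_sub, hp, hqmean, sub_self, inner_zero_right]
  filter_upwards [hq1, ae_inner_eq_zero_of_inner_weightedMoment hker] with y hqy hpy
  rwa [inner_sub_left, hqy, sub_eq_zero] at hpy

theorem le_measureReal_of_tendsto {p : ℕ → E} {q : E} (hp : Tendsto p atTop (𝓝 q)) {β κ : ℝ}
    (hκ : ∀ n, κ ≤ ν.real {y | (inner ℝ (p n) y : ℝ) < β}) :
    κ ≤ ν.real {y | (inner ℝ q y : ℝ) ≤ β} := by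
  let tail : ℕ → Set E := fun n => ⋃ k ≥ n, {y | (inner ℝ (p k) y : ℝ) < β}
  have htail : ∀ n, NullMeasurableSet (tail n) ν := fun n =>
    (MeasurableSet.biUnion (Set.to_countable _) fun k _ =>
      measurableSet_lt (by fun_prop) measurable_const).nullMeasurableSet
  have hanti : Antitone tail := fun i j hij =>
    Set.biUnion_subset_biUnion_left fun k hk => le_trans hij hk
  have hlim : Tendsto (fun n => ν.real (tail n)) atTop (𝓝 (ν.real (⋂ n, tail n))) :=
    (ENNReal.tendsto_toReal (measure_ne_top _ _)).comp
      (tendsto_measure_iInter_atTop htail hanti ⟨0, measure_ne_top _ _⟩)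
  have hle : κ ≤ ν.real (⋂ n, tail n) := ge_of_tendsto' hlim fun n =>
    (hκ n).trans (measureReal_mono (Set.subset_iUnion₂_of_subset n le_rfl subset_rfl)
      (measure_ne_top _ _))
  refine hle.trans (measureReal_mono fun y hy => ?_)
  by_contra hlt
  have hinner : Tendsto (fun n => (inner ℝ (p n) y : ℝ)) atTop (𝓝 (inner ℝ q y)) :=
    hp.inner tendsto_const_nhds
  obtain ⟨n, hn⟩ := eventually_atTop.1 (hinner.eventually (lt_mem_nhds (not_le.1 hlt)))
  obtain ⟨k, hk, hky⟩ := Set.mem_iUnion₂.1 (Set.mem_iInter.1 hy n)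
  exact lt_asymm (hn k hk) hky

end WeightedMoment

/-! ### Measurable fields of directions -/

theorem exists_measurable_ne_zero {Ω E : Type*} [Zero E] [MeasurableSpace E]
    [MeasurableSingletonClass E] {m : MeasurableSpace Ω} {a : ℕ → Ω → E}
    (ha : ∀ n, Measurable (a n)) :
    ∃ e : Ω → E, Measurable e ∧ ∀ ω, (∃ n, e ω = a n ω) ∧ (e ω = 0 → ∀ n, a n ω = 0) := by
  classical
  have hzero : ∀ n, MeasurableSet {ω | a n ω = 0} := fun n => ha n (measurableSet_singleton 0)
  have hex : ∀ ω, ∃ n, a n ω = 0 → ∀ i, a i ω = 0 := fun ω => by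
    by_contra! h
    obtain ⟨n, hn⟩ := (h 0).2
    exact hn (h n).1
  have hmeas : ∀ n, MeasurableSet {ω | a n ω = 0 → ∀ i, a i ω = 0} := fun n => by
    simp only [imp_iff_not_or, Set.ofPred_or, Set.ofPred_forall]
    exact (hzero n).compl.union (MeasurableSet.iInter hzero)
  have hpair : Measurable fun q : Ω × ℕ => a q.2 q.1 :=
    measurable_from_prod_countable_left ha
  exact ⟨fun ω => a (Nat.find (hex ω)) ω,
    hpair.comp (measurable_id.prodMk (measurable_find hex hmeas)),
    fun ω => ⟨⟨_, rfl⟩, Nat.find_spec (hex ω)⟩⟩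

section Directions

variable {Ω E : Type*} [NormedAddCommGroup E] [InnerProductSpace ℝ E] [FiniteDimensional ℝ E]
  [MeasurableSpace E] [BorelSpace E] {m mΩ : MeasurableSpace Ω}

theorem exists_measurable_normalized {a : ℕ → Ω → E} (ha : ∀ n, Measurable[m] (a n)) :
    ∃ p : ℕ → Ω → E, (∀ n, Measurable[m] (p n)) ∧ (∀ n ω, ∃ (r : ℝ) (k : ℕ), p n ω = r • a k ω) ∧
      (∀ n ω, (∃ k, a k ω ≠ 0) → ‖p n ω‖ = 1) ∧
      ∀ n ω, a n ω ≠ 0 → p n ω = ‖a n ω‖⁻¹ • a n ω := by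
  classical
  obtain ⟨e, he, he_spec⟩ := exists_measurable_ne_zero ha
  let v : ℕ → Ω → E := fun n ω => if a n ω = 0 then e ω else a n ω
  have hv : ∀ n, Measurable[m] (v n) := fun n =>
    Measurable.ite (ha n (measurableSet_singleton 0)) he (ha n)
  refine ⟨fun n ω => ‖v n ω‖⁻¹ • v n ω,
    fun n => (measurable_norm.comp (hv n)).inv.smul (hv n), fun n ω => ?_, fun n ω hne => ?_,
    fun n ω hn => by simp only [v, if_neg hn]⟩
  · by_cases hn : a n ω = 0
    · obtain ⟨k, hk⟩ := (he_spec ω).1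
      exact ⟨‖v n ω‖⁻¹, k, by simp only [v, if_pos hn, hk]⟩
    · exact ⟨‖v n ω‖⁻¹, n, by simp only [v, if_neg hn]⟩
  · have hvn : v n ω ≠ 0 := by
      by_cases hn : a n ω = 0
      · simp only [v, if_pos hn]
        exact fun h0 => hne.elim fun k hk => hk ((he_spec ω).2 h0 k)
      · simpa only [v, if_neg hn] using hn
    rw [norm_smul, norm_inv, norm_norm, inv_mul_cancel₀ (norm_ne_zero_iff.2 hvn)]

variable {P : Measure Ω} [IsFiniteMeasure P] {Y : Ω → E}

theorem measurable_weightedMoment_regularLaw {p : Ω → E} (hp : Measurable[m] p) :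
    Measurable[m] fun ω => weightedMoment (regularLaw P m Y ω) (p ω) := by
  have hp' : Measurable[m.prod inferInstance] fun q : Ω × E => p q.1 := hp.comp measurable_fst
  have hweight : Measurable[m.prod inferInstance] fun q : Ω × E => (1 + ‖q.2‖ ^ 2)⁻¹ :=
    ((measurable_norm.comp measurable_snd).pow_const 2).const_add 1 |>.inv
  exact measurable_integral_regularLaw
    ((hweight.mul (hp'.inner measurable_snd)).smul measurable_snd)

theorem measurable_weightedMean_regularLaw :
    Measurable[m] fun ω => weightedMean (regularLaw P m Y ω) := by
  have hweight : Measurable[m.prod inferInstance] fun q : Ω × E => (1 + ‖q.2‖ ^ 2)⁻¹ :=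
    ((measurable_norm.comp measurable_snd).pow_const 2).const_add 1 |>.inv
  exact measurable_integral_regularLaw (hweight.smul measurable_snd)

theorem exists_measurable_weightedMoment_eq_weightedMean :
    ∃ p : Ω → E, Measurable[m] p ∧
      ∀ ω, weightedMoment (regularLaw P m Y ω) (p ω) = weightedMean (regularLaw P m Y ω) := by
  let h : Ω → E → ℝ := fun ω v =>
    -‖weightedMoment (regularLaw P m Y ω) v - weightedMean (regularLaw P m Y ω)‖
  have hsolution : ∀ ω, ∃ v, h ω v = 0 := fun ω => by
    obtain ⟨v, hv⟩ := weightedMean_mem_range (ν := regularLaw P m Y ω)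
    exact ⟨v, by simp only [h, hv, sub_self, norm_zero, neg_zero]⟩
  have hnonpos : ∀ ω v, h ω v ≤ 0 := fun ω v => neg_nonpos.2 (norm_nonneg _)
  obtain ⟨p, hp, hmax⟩ := exists_measurable_argmax (h := h)
    (fun v => (measurable_norm.comp ((measurable_weightedMoment_regularLaw measurable_const).sub
      measurable_weightedMean_regularLaw)).neg)
    (fun ω => (((weightedMoment _).continuous_of_finiteDimensional.sub
      continuous_const).norm).neg)
    (fun ω => (hsolution ω).imp fun v hv w => (hnonpos ω w).trans_eq hv.symm)
  refine ⟨p, hp, fun ω => ?_⟩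
  obtain ⟨v, hv⟩ := hsolution ω
  have hzero : h ω (p ω) = 0 := (hnonpos ω _).antisymm (hv ▸ hmax ω v)
  rwa [neg_eq_zero, norm_eq_zero, sub_eq_zero] at hzero

theorem exists_dense_directions :
    ∃ p : ℕ → Ω → E, (∀ n, Measurable[m] (p n)) ∧ ∀ ω,
      (∀ n, p n ω ∈ Submodule.span ℝ (regularLaw P m Y ω).support) ∧
      (∀ n, Submodule.span ℝ (regularLaw P m Y ω).support ≠ ⊥ → ‖p n ω‖ = 1) ∧
      ∀ q ∈ Submodule.span ℝ (regularLaw P m Y ω).support, ‖q‖ = 1 →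
        ∃ u : ℕ → ℕ, Tendsto (fun k => p (u k) ω) atTop (𝓝 q) := by
  obtain ⟨p, hp, hpa, hp1, hpn⟩ := exists_measurable_normalized
    (a := fun n ω => weightedMoment (regularLaw P m Y ω) (denseSeq E n))
    fun n => measurable_weightedMoment_regularLaw measurable_const
  refine ⟨p, hp, fun ω => ?_⟩
  simp only [← range_weightedMoment]
  have hcont := (weightedMoment (regularLaw P m Y ω)).continuous_of_finiteDimensional
  refine ⟨fun n => ?_, fun n hne => ?_, fun q hq hq1 => ?_⟩
  · obtain ⟨r, k, hrk⟩ := hpa n ω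
    exact hrk ▸ Submodule.smul_mem _ r (LinearMap.mem_range_self _ _)
  · by_contra hpn1
    exact hne <| LinearMap.range_eq_bot.2 <| LinearMap.ext fun x =>
      (denseRange_denseSeq E).induction_on x (isClosed_eq hcont continuous_const)
        fun k => by_contra fun hk => hpn1 (hp1 n ω ⟨k, hk⟩)
  · obtain ⟨w, rfl⟩ := hq
    obtain ⟨s, hs, hsw⟩ := mem_closure_iff_seq_limit.1 (denseRange_denseSeq E w)
    choose u hu using hs
    have hlim : Tendsto (fun k => weightedMoment (regularLaw P m Y ω) (denseSeq E (u k))) atTop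
        (𝓝 (weightedMoment (regularLaw P m Y ω) w)) := by
      simpa only [hu, Function.comp_def] using (hcont.tendsto w).comp hsw
    have hne := hlim.eventually_ne (norm_ne_zero_iff.1 (by simp [hq1]))
    have hnormalized := (hlim.norm.inv₀ (by simp [hq1])).smul hlim
    rw [hq1, inv_one, one_smul] at hnormalized
    exact ⟨u, hnormalized.congr' (hne.mono fun k hk => (hpn (u k) ω hk).symm)⟩

end Directions

/-! ### The conditional laws of the increments -/

section Market

variable {Ω : Type*} {mΩ : MeasurableSpace Ω} {P : Measure Ω} [IsProbabilityMeasure P]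
  {T d : ℕ} {ℱ : Filtration ℕ mΩ} {S : ℕ → Ω → EuclideanSpace ℝ (Fin d)}

theorem measurable_increment (hS : ∀ t ≤ T, Measurable[ℱ t] (S t)) {t : ℕ} (ht : t ≤ T) :
    Measurable[ℱ t] (increment S t) := by
  cases t with
  | zero => exact hS 0 ht
  | succ t => exact (hS _ ht).sub ((hS t (by omega)).mono (ℱ.mono t.le_succ) le_rfl)

theorem isStrategy_single {t : ℕ} {p : Ω → EuclideanSpace ℝ (Fin d)} (hp : Measurable[ℱ t] p) :
    IsStrategy ℱ T fun s => if s = t + 1 then p else 0 := fun s _ => by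
  by_cases hst : s = t
  · subst hst
    simpa only [if_true] using hp
  · simp only [add_left_inj, hst, if_false]
    exact measurable_const (a := 0)

theorem wealth_single {t : ℕ} (ht : t < T) (p : Ω → EuclideanSpace ℝ (Fin d)) (c : ℝ) (ω : Ω) :
    wealth S c (fun s => if s = t + 1 then p else 0) T ω =
      c + inner ℝ (p ω) (increment S (t + 1) ω) := by
  unfold wealth
  rw [Finset.sum_eq_single_of_mem t (Finset.mem_range.2 ht) fun i _ hi => by simp [hi]]
  simp

theorem NoArbitrage.ae_zero_mem_affineSpan (hna : NoArbitrage P ℱ S T)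
    (hS : ∀ t ≤ T, Measurable[ℱ t] (S t)) {t : ℕ} (ht : t < T) :
    ∀ᵐ ω ∂P, (0 : EuclideanSpace ℝ (Fin d)) ∈
      affineSpan ℝ (regularLaw P (ℱ t) (increment S (t + 1)) ω).support := by
  have hY : Measurable (increment S (t + 1)) := (measurable_increment hS ht).mono (ℱ.le _) le_rfl
  obtain ⟨p, hp, hpmean⟩ := exists_measurable_weightedMoment_eq_weightedMean
    (P := P) (m := ℱ t) (Y := increment S (t + 1))
  have hp' : Measurable[(ℱ t).prod inferInstance]
      fun q : Ω × EuclideanSpace ℝ (Fin d) => p q.1 := hp.comp measurable_fst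
  -- On `A`, the portfolio `p` yields the sure gain `1`.
  let A : Set Ω := {ω | ∀ᵐ y ∂regularLaw P (ℱ t) (increment S (t + 1)) ω, inner ℝ (p ω) y = (1 : ℝ)}
  have hA : MeasurableSet[ℱ t] A := measurableSet_ae_regularLaw
    (measurableSet_eq_fun (hp'.inner measurable_snd) measurable_const)
  have hgain : ∀ᵐ ω ∂P, ω ∈ A → inner ℝ (p ω) (increment S (t + 1) ω) = (1 : ℝ) := by
    have hmeas : MeasurableSet[(ℱ t).prod inferInstance]
        {q : Ω × EuclideanSpace ℝ (Fin d) | q.1 ∈ A → inner ℝ (p q.1) q.2 = (1 : ℝ)} := by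
      simp only [imp_iff_not_or, Set.ofPred_or]
      exact (measurable_fst hA).compl.union
        (measurableSet_eq_fun (hp'.inner measurable_snd) measurable_const)
    refine (ae_regularLaw_iff (ℱ.le t) hY hmeas).1 (ae_of_all _ fun ω => ?_)
    by_cases hω : ω ∈ A
    · have hsure : ∀ᵐ y ∂regularLaw P (ℱ t) (increment S (t + 1)) ω, (inner ℝ (p ω) y : ℝ) = 1 := hω
      exact hsure.mono fun y hy _ => hy
    · exact ae_of_all _ fun y hy => (hω hy).elim
  have hwealth : ∀ᵐ ω ∂P, wealth S 0 (fun s => if s = t + 1 then A.indicator p else 0) T ω =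
      A.indicator 1 ω := by
    filter_upwards [hgain] with ω hω
    rw [wealth_single ht, zero_add]
    by_cases hωA : ω ∈ A
    · simp [hωA, hω hωA]
    · simp [hωA]
  have hzero := hna _ (isStrategy_single (hp.indicator hA)) <| hwealth.mono fun ω hω => by
    rw [hω]
    exact Set.indicator_nonneg (fun _ _ => zero_le_one) ω
  filter_upwards [hwealth, hzero] with ω hω hω0
  by_contra h0
  have hωA : ω ∈ A := ae_inner_eq_one_of_zero_notMem (hpmean ω) h0
  rw [hω, Set.indicator_of_mem hωA] at hω0
  exact one_ne_zero hω0

theorem NoArbitrage.ae_nextSpan_eq_span (hna : NoArbitrage P ℱ S T)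
    (hS : ∀ t ≤ T, Measurable[ℱ t] (S t)) {t : ℕ} (ht : t < T) :
    ∀ᵐ ω ∂P, (nextSpan P ℱ S t ω : Set (EuclideanSpace ℝ (Fin d))) =
      Submodule.span ℝ (regularLaw P (ℱ t) (increment S (t + 1)) ω).support := by
  filter_upwards [hna.ae_zero_mem_affineSpan hS ht] with ω hω
  rw [← affineSpan_insert_zero, affineSpan_insert_eq_affineSpan ℝ hω]
  rfl

theorem NoArbitrage.ae_nontriv_iff (hna : NoArbitrage P ℱ S T)
    (hS : ∀ t ≤ T, Measurable[ℱ t] (S t)) {t : ℕ} (ht : t < T) :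
    ∀ᵐ ω ∂P, Nontriv P ℱ S t ω ↔
      Submodule.span ℝ (regularLaw P (ℱ t) (increment S (t + 1)) ω).support ≠ ⊥ := by
  filter_upwards [hna.ae_nextSpan_eq_span hS ht] with ω hω
  rw [Nontriv, hω, ← Submodule.bot_coe (R := ℝ), Ne, SetLike.coe_set_eq]

theorem IsNABound.ae_forall_direction (hna : NoArbitrage P ℱ S T)
    (hS : ∀ t ≤ T, Measurable[ℱ t] (S t)) {t : ℕ} (ht : t < T) {β κ : Ω → ℝ}
    (hb : IsNABound P ℱ S t β κ) :
    ∀ᵐ ω ∂P, ∀ q ∈ Submodule.span ℝ (regularLaw P (ℱ t) (increment S (t + 1)) ω).support,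
      ‖q‖ = 1 → κ ω ≤ (regularLaw P (ℱ t) (increment S (t + 1)) ω).real
        {y | (inner ℝ q y : ℝ) ≤ -β ω} := by
  have hY : Measurable (increment S (t + 1)) := (measurable_increment hS ht).mono (ℱ.le _) le_rfl
  obtain ⟨hβ, -, -, -, hbound⟩ := hb
  obtain ⟨p, hp, hdense⟩ :=
    exists_dense_directions (P := P) (m := ℱ t) (Y := increment S (t + 1))
  have hunit : ∀ n, p n ∈ unitDirections P ℱ S t := fun n => by
    refine ⟨hp n, ?_, ?_⟩
    · filter_upwards [hna.ae_nextSpan_eq_span hS ht] with ω hω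
      exact (Set.ext_iff.1 hω _).2 ((hdense ω).1 n)
    · filter_upwards [hna.ae_nontriv_iff hS ht] with ω hω hnontriv
      exact (hdense ω).2.1 n (hω.1 hnontriv)
  have hsequence : ∀ᵐ ω ∂P, ∀ n, Nontriv P ℱ S t ω → κ ω ≤
      (regularLaw P (ℱ t) (increment S (t + 1)) ω).real
        {y | (inner ℝ (p n ω) y : ℝ) < -β ω} := by
    refine ae_all_iff.2 fun n => ?_
    have hp' : Measurable[(ℱ t).prod inferInstance]
      fun q : Ω × EuclideanSpace ℝ (Fin d) => p n q.1 := (hp n).comp measurable_fst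
    filter_upwards [hbound _ (hunit n), condProb_comp_ae_eq (ℱ.le t) hY (measurableSet_lt
      (hp'.inner measurable_snd) (hβ.comp measurable_fst).neg)] with ω hω hcond hnontriv
    exact (hω hnontriv).trans_eq hcond
  filter_upwards [hsequence, hna.ae_nontriv_iff hS ht] with ω hω hnontriv q hq hq1
  obtain ⟨u, hu⟩ := (hdense ω).2.2 q hq hq1
  refine le_measureReal_of_tendsto hu fun n => hω _ (hnontriv.2 fun hbot => ?_)
  rw [hbot, Submodule.mem_bot] at hq
  exact zero_ne_one (by rw [← hq1, hq, norm_zero])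

end Market

/-! ### The conditional one-step problem -/

section RegularLaw

variable {Ω 𝒵 : Type*} {m mΩ : MeasurableSpace Ω} {m𝒵 : MeasurableSpace 𝒵}
  [StandardBorelSpace 𝒵] [Nonempty 𝒵] {P : Measure Ω} [IsProbabilityMeasure P] {Z : Ω → 𝒵}

theorem regularLaw_comp_ae_eq_map {𝒴 : Type*} {m𝒴 : MeasurableSpace 𝒴} [StandardBorelSpace 𝒴]
    [Nonempty 𝒴] (hm : m ≤ mΩ) (hZ : Measurable Z) {f : 𝒵 → 𝒴} (hf : Measurable f) :
    ∀ᵐ ω ∂P, regularLaw P m (fun ω => f (Z ω)) ω = (regularLaw P m Z ω).map f := by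
  have htrim : ∀ᵐ ω ∂(P.trim hm),
      regularLaw P m (fun ω => f (Z ω)) ω = ((regularLaw P m Z).map f) ω := by
    rw [trim_eq_map]
    exact @condDistrib_comp Ω Ω 𝒵 _ _ _ mΩ P _ Z m 𝒴 _ _ _ id hZ.aemeasurable f hf
  filter_upwards [ae_of_ae_trim hm htrim] with ω hω
  rw [hω, Kernel.map_apply _ hf]

theorem HasAllMoments.integral_regularLaw (hm : m ≤ mΩ) (hZ : Measurable Z) {f : 𝒵 → ℝ}
    (hf : Measurable f) (h : HasAllMoments P fun ω => f (Z ω)) :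
    HasAllMoments P fun ω => ∫ z, f z ∂regularLaw P m Z ω := fun n =>
  (memLp_congr_ae (condExp_comp_ae_eq hm hZ (f := fun p : Ω × 𝒵 => f p.2)
    (hf.comp measurable_snd).stronglyMeasurable h.integrable)).1 (h.condExp m n)

end RegularLaw

section Moments

variable {Ω : Type*} {mΩ : MeasurableSpace Ω} {P : Measure Ω} [IsFiniteMeasure P] {A X W : Ω → ℝ}

theorem HasAllMoments.radius (θ C : ℝ) (hA : HasAllMoments P A) (hX : HasAllMoments P X)
    (hW : HasAllMoments P W) : HasAllMoments P fun ω => radius θ C (A ω) (X ω) (W ω) :=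
  ((((((hasAllMoments_const 1).add hX.max_zero).mul (hA.add (hasAllMoments_const C))).add
    hW).const_mul 2).mul hA |>.mul (((hA.pow 3).const_mul 4).pow _)).pow _

theorem HasAllMoments.nextDepth (θ C : ℝ) (hA : HasAllMoments P A) :
    HasAllMoments P fun ω => nextDepth θ C (A ω) := by
  have hR := hA.radius θ C (hasAllMoments_const 0) (hasAllMoments_const (C + 1))
  exact ((hA.const_mul 16).mul (((((hasAllMoments_const 1).add hR).mul hA).add
    (hasAllMoments_const C)).add (hasAllMoments_const 1))).add ((hR.const_mul 8).mul hA) |>.add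
      (hA.const_mul 8) |>.add (hasAllMoments_const 1)

end Moments

theorem continuous_nextDepth (θ C : ℝ) : Continuous (nextDepth θ C) := by
  unfold nextDepth radius radiusBase
  fun_prop

theorem measurable_depth_fst {U : ℝ → ℝ} {θ C : ℝ} {E : Type*} [MeasurableSpace E] :
    Measurable fun z : RegularUtility U θ C × E => z.1.depth :=
  RegularUtility.continuous_depth.measurable.comp measurable_fst

theorem measurable_one_add_norm_mul_fn_one {U : ℝ → ℝ} {θ C : ℝ} {E : Type*}
    [NormedAddCommGroup E] [MeasurableSpace E] [OpensMeasurableSpace E] :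
    Measurable fun z : RegularUtility U θ C × E => (1 + ‖z.2‖) * z.1.fn 1 :=
  (measurable_snd.norm.const_add 1).mul
    (RegularUtility.continuous_fn_uncurry.measurable.comp (measurable_fst.prodMk measurable_const))

section Step

variable {U : ℝ → ℝ} {θ C L : ℝ} {r : ℕ} {E : Type*} [NormedAddCommGroup E]
  [InnerProductSpace ℝ E] [FiniteDimensional ℝ E] [MeasurableSpace E] [BorelSpace E]

theorem GoodLaw.stepValue_eq_iSup_denseSeq (hU : GrowthData U θ C L r) {A : ℝ}
    {μ : Measure (RegularUtility U θ C × E)} [IsProbabilityMeasure μ] (h : GoodLaw r A μ) (x : ℝ) :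
    stepValue μ x = ⨆ n, expUtility μ x (denseSeq E n) := by
  obtain ⟨ξ, hξ⟩ := h.exists_eq_stepValue hU x
  refine le_antisymm ?_ (ciSup_le fun n => h.expUtility_le_stepValue hU x _)
  have hbdd : BddAbove (Set.range fun n => expUtility μ x (denseSeq E n)) :=
    ⟨stepValue μ x, Set.forall_mem_range.2 fun n => h.expUtility_le_stepValue hU x _⟩
  rw [hξ]
  exact (denseRange_denseSeq E).induction_on
    (p := fun ξ => expUtility μ x ξ ≤ ⨆ n, expUtility μ x (denseSeq E n)) ξ
    (isClosed_le (h.continuous_expUtility hU x) continuous_const) fun n => le_ciSup hbdd n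

variable {Ω : Type*} {m mΩ : MeasurableSpace Ω} {P : Measure Ω} [StandardBorelSpace E]
  [Nonempty (RegularUtility U θ C)]

section Measurable

variable [IsFiniteMeasure P] {Z : Ω → RegularUtility U θ C × E} {β κ : Ω → ℝ}

theorem measurable_expUtility_regularLaw {x : Ω → ℝ} {ξ : Ω → E} (hx : Measurable[m] x)
    (hξ : Measurable[m] ξ) :
    Measurable[m] fun ω => expUtility (regularLaw P m Z ω) (x ω) (ξ ω) := by
  have harg : Measurable[m.prod inferInstance] fun p : Ω × (RegularUtility U θ C × E) =>
      ((x p.1, ξ p.1), p.2) :=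
    ((hx.comp measurable_fst).prodMk (hξ.comp measurable_fst)).prodMk measurable_snd
  exact measurable_integral_regularLaw (f := fun p : Ω × (RegularUtility U θ C × E) =>
    p.2.1.fn (x p.1 + inner ℝ (ξ p.1) p.2.2)) (RegularUtility.measurable_fn_add_inner.comp harg)

/-- A constant for the one-step problem given `m`: it dominates the reciprocals of the bounds `β`
and `κ` of the no-arbitrage condition and the conditional moments entering `GoodLaw`. -/
def lawConst (P : Measure Ω) [IsFiniteMeasure P] (m : MeasurableSpace Ω)
    (Z : Ω → RegularUtility U θ C × E) (β κ : Ω → ℝ) (ω : Ω) : ℝ :=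
  1 + |1 / β ω| + |1 / κ ω| + ∫ z, (1 + ‖z.2‖) * z.1.fn 1 ∂regularLaw P m Z ω +
    ∫ z, ‖z.2‖ ∂regularLaw P m Z ω + ∫ z, z.1.depth ∂regularLaw P m Z ω

omit [InnerProductSpace ℝ E] [FiniteDimensional ℝ E] in
theorem measurable_lawConst (hβ : Measurable[m] β) (hκ : Measurable[m] κ) :
    Measurable[m] (lawConst P m Z β κ) := by
  have hintegral : ∀ {f : RegularUtility U θ C × E → ℝ}, Measurable f →
      Measurable[m] fun ω => ∫ z, f z ∂regularLaw P m Z ω := fun hf =>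
    measurable_integral_regularLaw (f := fun p => _) (hf.comp measurable_snd)
  exact (((((measurable_norm.comp (hβ.const_div 1)).const_add 1).add
    (measurable_norm.comp (hκ.const_div 1))).add
      (hintegral measurable_one_add_norm_mul_fn_one)).add
      (hintegral measurable_snd.norm)).add (hintegral measurable_depth_fst)

end Measurable

section JointLaw

variable [IsProbabilityMeasure P] {X : Ω → RegularUtility U θ C} {Y : Ω → E} {β κ : Ω → ℝ}

omit [InnerProductSpace ℝ E] [FiniteDimensional ℝ E] in
theorem hasAllMoments_lawConst (hm : m ≤ mΩ) (hX : Measurable X) (hY : Measurable Y)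
    (hX1 : HasAllMoments P fun ω => (X ω).fn 1) (hXd : HasAllMoments P fun ω => (X ω).depth)
    (hYm : HasAllMoments P fun ω => ‖Y ω‖) (hβ : HasAllMoments P fun ω => 1 / β ω)
    (hκ : HasAllMoments P fun ω => 1 / κ ω) :
    HasAllMoments P (lawConst P m (fun ω => (X ω, Y ω)) β κ) := by
  have hZ : Measurable fun ω => (X ω, Y ω) := hX.prodMk hY
  exact (((((hasAllMoments_const 1).add hβ.abs).add hκ.abs).add
    (.integral_regularLaw hm hZ measurable_one_add_norm_mul_fn_one
      (((hasAllMoments_const 1).add hYm).mul hX1))).add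
    (.integral_regularLaw hm hZ measurable_snd.norm hYm)).add
    (.integral_regularLaw hm hZ measurable_depth_fst hXd)

theorem ae_exists_submodule_noArbitrage (hm : m ≤ mΩ) (hX : Measurable X) (hY : Measurable Y)
    (hdir : ∀ᵐ ω ∂P, ∀ q ∈ Submodule.span ℝ (regularLaw P m Y ω).support,
      ‖q‖ = 1 → κ ω ≤ (regularLaw P m Y ω).real {y | (inner ℝ q y : ℝ) ≤ -β ω}) :
    ∀ᵐ ω ∂P, ∃ K : Submodule ℝ E,
      (∀ᵐ z ∂regularLaw P m (fun ω => (X ω, Y ω)) ω, z.2 ∈ K) ∧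
      ∀ q ∈ K, ‖q‖ = 1 →
        κ ω ≤ (regularLaw P m (fun ω => (X ω, Y ω)) ω).real {z | inner ℝ q z.2 ≤ -β ω} := by
  filter_upwards [regularLaw_comp_ae_eq_map hm (hX.prodMk hY) measurable_snd, hdir]
    with ω hmap hω
  refine ⟨_, ae_of_ae_map measurable_snd.aemeasurable (hmap ▸ ae_mem_span_support),
    fun q hq hq1 => (hω q hq hq1).trans_eq ?_⟩
  rw [hmap, map_measureReal_apply measurable_snd (measurableSet_le (by fun_prop) measurable_const)]
  rfl

theorem ae_goodLaw (hU : GrowthData U θ C L r) (hm : m ≤ mΩ) (hX : Measurable X)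
    (hY : Measurable Y) (hX1 : HasAllMoments P fun ω => (X ω).fn 1)
    (hXd : HasAllMoments P fun ω => (X ω).depth) (hYm : HasAllMoments P fun ω => ‖Y ω‖)
    (hβ : ∀ᵐ ω ∂P, 0 < β ω) (hκ : ∀ᵐ ω ∂P, 0 < κ ω)
    (hdir : ∀ᵐ ω ∂P, ∀ q ∈ Submodule.span ℝ (regularLaw P m Y ω).support,
      ‖q‖ = 1 → κ ω ≤ (regularLaw P m Y ω).real {y | (inner ℝ q y : ℝ) ≤ -β ω}) :
    ∀ᵐ ω ∂P, GoodLaw r (lawConst P m (fun ω => (X ω, Y ω)) β κ ω)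
      (regularLaw P m (fun ω => (X ω, Y ω)) ω) := by
  have hint : ∀ {f : RegularUtility U θ C × E → ℝ}, Measurable f →
      HasAllMoments P (fun ω => f (X ω, Y ω)) →
      ∀ᵐ ω ∂P, Integrable f (regularLaw P m (fun ω => (X ω, Y ω)) ω) := fun hf h =>
    integrable_regularLaw hm (hX.prodMk hY) (f := fun p => _) (hf.comp measurable_snd)
      h.integrable
  have hone : HasAllMoments P fun ω => 1 + ‖Y ω‖ := (hasAllMoments_const 1).add hYm
  filter_upwards [hint measurable_one_add_norm_mul_fn_one (hone.mul hX1),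
    hint measurable_snd.norm hYm, hint measurable_depth_fst hXd,
    hint ((measurable_snd.norm.const_add 1).pow_const r) (hone.pow r),
    ae_exists_submodule_noArbitrage hm hX hY hdir, hβ, hκ]
    with ω hfn hnorm hdepth hpow ⟨K, hK, hKdir⟩ hβω hκω
  have hfn0 : 0 ≤ ∫ z, (1 + ‖z.2‖) * z.1.fn 1 ∂regularLaw P m (fun ω => (X ω, Y ω)) ω :=
    integral_nonneg fun z => mul_nonneg (by positivity) (z.1.fn_one_nonneg hU)
  have hnorm0 : 0 ≤ ∫ z, ‖z.2‖ ∂regularLaw P m (fun ω => (X ω, Y ω)) ω :=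
    integral_nonneg fun z => norm_nonneg _
  have hdepth0 : 0 ≤ ∫ z, z.1.depth ∂regularLaw P m (fun ω => (X ω, Y ω)) ω :=
    integral_nonneg fun z => zero_le_one.trans z.1.one_le_depth
  have hβinv : 0 < 1 / β ω := by positivity
  have hκinv : 0 < 1 / κ ω := by positivity
  have hA := lawConst.eq_def P m (fun ω => (X ω, Y ω)) β κ ω
  rw [abs_of_pos hβinv, abs_of_pos hκinv] at hA
  have hAβ : 1 / lawConst P m (fun ω => (X ω, Y ω)) β κ ω ≤ β ω := by
    rw [one_div_le (by linarith) hβω]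
    linarith
  have hAκ : 1 / lawConst P m (fun ω => (X ω, Y ω)) β κ ω ≤ κ ω := by
    rw [one_div_le (by linarith) hκω]
    linarith
  exact ⟨by linarith, hpow, hfn, by linarith, hnorm, by linarith, hdepth, by linarith, K, hK,
    fun q hq hq1 => hAκ.trans ((hKdir q hq hq1).trans
      (measureReal_mono fun z hz => le_trans hz (neg_le_neg hAβ)))⟩

end JointLaw

variable [IsFiniteMeasure P] {Z : Ω → RegularUtility U θ C × E} {A : Ω → ℝ}

theorem exists_measurable_eq_next (hU : GrowthData U θ C L r)
    (hnull : ∀ s, MeasurableSet s → P s = 0 → MeasurableSet[m] s) (hA : Measurable[m] A)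
    (hgood : ∀ᵐ ω ∂P, GoodLaw r (A ω) (regularLaw P m Z ω)) :
    ∃ X : Ω → RegularUtility U θ C, Measurable[m] X ∧
      ∀ᵐ ω ∂P, ∃ h : GoodLaw r (A ω) (regularLaw P m Z ω), X ω = h.next hU := by
  classical
  obtain ⟨N, hbad, hN, hN0⟩ := exists_measurable_superset_of_null (ae_iff.1 hgood)
  have hNm : MeasurableSet[m] N := hnull N hN hN0
  have hg : ∀ ω, ω ∉ N → GoodLaw r (A ω) (regularLaw P m Z ω) := fun ω hω =>
    not_not.1 fun h => hω (hbad h)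
  let s₀ : RegularUtility U θ C := Classical.arbitrary _
  let X : Ω → RegularUtility U θ C := fun ω => if h : ω ∈ N then s₀ else (hg ω h).next hU
  have hXfn : ∀ x, Measurable[m] fun ω => (X ω).fn x := fun x => by
    have hX : (fun ω => (X ω).fn x) = fun ω => if ω ∈ N then s₀.fn x else
        ⨆ n, expUtility (regularLaw P m Z ω) x (denseSeq E n) := by
      funext ω
      by_cases h : ω ∈ N
      · simp only [X, h, dite_true, if_true]
      · simp only [X, h, dite_false, if_false]
        exact (hg ω h).stepValue_eq_iSup_denseSeq hU x
    rw [hX]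
    exact Measurable.ite hNm measurable_const (Measurable.iSup fun n =>
      measurable_expUtility_regularLaw measurable_const measurable_const)
  have hXdepth : Measurable[m] fun ω => (X ω).depth := by
    have hX : (fun ω => (X ω).depth) = fun ω => if ω ∈ N then s₀.depth else
        nextDepth θ C (A ω) := by
      funext ω
      by_cases h : ω ∈ N
      · simp only [X, h, dite_true, if_true]
      · simp only [X, h, dite_false, if_false]
        rfl
    rw [hX]
    exact Measurable.ite hNm measurable_const ((continuous_nextDepth θ C).measurable.comp hA)
  refine ⟨X, Measurable.subtype_mk ((measurable_continuousMap_of_eval hXfn).prodMk hXdepth), ?_⟩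
  filter_upwards [measure_eq_zero_iff_ae_notMem.1 hN0] with ω hω
  exact ⟨hg ω hω, dif_neg hω⟩

theorem exists_measurable_fn_eq_stepValue (hU : GrowthData U θ C L r) (hm : m ≤ mΩ)
    (hnull : ∀ s, MeasurableSet s → P s = 0 → MeasurableSet[m] s) (hA : Measurable[m] A)
    (hAm : HasAllMoments P A) (hgood : ∀ᵐ ω ∂P, GoodLaw r (A ω) (regularLaw P m Z ω)) :
    ∃ X : Ω → RegularUtility U θ C, Measurable[m] X ∧
      HasAllMoments P (fun ω => (X ω).fn 1) ∧ HasAllMoments P (fun ω => (X ω).depth) ∧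
      ∀ᵐ ω ∂P, (X ω).fn = stepValue (regularLaw P m Z ω) := by
  obtain ⟨X, hX, hnext⟩ := exists_measurable_eq_next hU hnull hA hgood
  have hXΩ : Measurable X := hX.mono hm le_rfl
  have hstep : ∀ᵐ ω ∂P, (X ω).fn = stepValue (regularLaw P m Z ω) :=
    hnext.mono fun ω ⟨h, hω⟩ => hω ▸ rfl
  refine ⟨X, hX, ?_, ?_, hstep⟩
  · refine (((hasAllMoments_const 2).add (hAm.radius θ C (hasAllMoments_const 1)
      (hasAllMoments_const 0))).mul hAm).mono (RegularUtility.continuous_fn_uncurry.measurable.comp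
        (hXΩ.prodMk measurable_const)).aestronglyMeasurable ?_
    filter_upwards [hnext, hstep] with ω ⟨h, _⟩ hω
    rw [abs_of_nonneg ((X ω).fn_one_nonneg hU), hω]
    exact (h.stepValue_one_le hU).trans (le_abs_self _)
  · refine (hAm.nextDepth θ C).mono
      (RegularUtility.continuous_depth.measurable.comp hXΩ).aestronglyMeasurable ?_
    filter_upwards [hnext] with ω ⟨h, hω⟩
    rw [hω]
    rfl

theorem exists_measurable_expUtility_eq_stepValue (hU : GrowthData U θ C L r)
    (hnull : ∀ s, MeasurableSet s → P s = 0 → MeasurableSet[m] s)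
    (hgood : ∀ᵐ ω ∂P, GoodLaw r (A ω) (regularLaw P m Z ω)) {x : Ω → ℝ} (hx : Measurable[m] x) :
    ∃ ξ : Ω → E, Measurable[m] ξ ∧
      ∀ᵐ ω ∂P, expUtility (regularLaw P m Z ω) (x ω) (ξ ω) =
        stepValue (regularLaw P m Z ω) (x ω) := by
  classical
  obtain ⟨N, hbad, hN, hN0⟩ := exists_measurable_superset_of_null (ae_iff.1 hgood)
  have hg : ∀ ω, ω ∉ N → GoodLaw r (A ω) (regularLaw P m Z ω) := fun ω hω =>
    not_not.1 fun h => hω (hbad h)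
  let J : Ω → E → ℝ := fun ω η => if ω ∈ N then 0 else expUtility (regularLaw P m Z ω) (x ω) η
  have hJ : ∀ {ω}, ω ∉ N → J ω = expUtility (regularLaw P m Z ω) (x ω) := fun hω =>
    funext fun _ => if_neg hω
  have hJN : ∀ {ω}, ω ∈ N → J ω = fun _ => 0 := fun hω => funext fun _ => if_pos hω
  obtain ⟨ξ, hξ, hmax⟩ := exists_measurable_argmax (mΩ := m) (h := J)
    (fun η => Measurable.ite (hnull N hN hN0) measurable_const
      (measurable_expUtility_regularLaw hx measurable_const))
    (fun ω => by
      by_cases hω : ω ∈ N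
      · exact hJN hω ▸ continuous_const
      · exact hJ hω ▸ (hg ω hω).continuous_expUtility hU _)
    (fun ω => by
      by_cases hω : ω ∈ N
      · exact ⟨0, fun η => by rw [hJN hω]⟩
      · exact hJ hω ▸ (hg ω hω).exists_max hU (x ω))
  refine ⟨ξ, hξ, ?_⟩
  filter_upwards [measure_eq_zero_iff_ae_notMem.1 hN0] with ω hω
  refine le_antisymm ((hg ω hω).expUtility_le_stepValue hU _ _) (ciSup_le fun η => ?_)
  simpa only [hJ hω] using hmax ω η

end Step

/-! ### Growth of the utility function -/

section Utility

variable {U : ℝ → ℝ}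

theorem ElasticAtTop.exists_le_rpow_mul (h : ElasticAtTop U) :
    ∃ θ C : ℝ, 0 < θ ∧ θ ≠ 1 ∧ 0 ≤ C ∧ ∀ x l : ℝ, 1 ≤ l → U (l * x) ≤ l ^ θ * (U x + C) := by
  obtain ⟨hc, hm, h0, x₀, hx₀, γ, hγ0, hγ1, hγ⟩ := h
  have hC : 0 ≤ U x₀ := h0.symm.le.trans (hm hx₀.le)
  refine ⟨γ, U x₀, hγ0, hγ1.ne, hC, fun x l hl => ?_⟩
  rcases le_total x₀ x with hx | hx
  · exact (hγ x hx l hl).trans (by gcongr; linarith)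
  rcases le_total 0 x with hx0 | hx0
  · have hUx : 0 ≤ U x := h0.symm.le.trans (hm hx0)
    calc U (l * x) ≤ U (l * x₀) := hm (by gcongr)
      _ ≤ l ^ γ * U x₀ := hγ x₀ le_rfl l hl
      _ ≤ l ^ γ * (U x + U x₀) := by gcongr; linarith
  · have hUx : U x ≤ 0 := (hm hx0).trans h0.le
    have hlγ : l ^ γ ≤ l := by simpa using Real.rpow_le_rpow_of_exponent_le hl hγ1.le
    calc U (l * x) ≤ l * U x := map_mul_le_of_concaveOn hc h0.ge x hl
      _ ≤ l ^ γ * U x := mul_le_mul_of_nonpos_right hlγ hUx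
      _ ≤ l ^ γ * (U x + U x₀) := by gcongr; linarith

theorem ElasticAtBot.exists_le_rpow_mul (h : ElasticAtBot U) :
    ∃ θ C : ℝ, 0 < θ ∧ θ ≠ 1 ∧ 0 ≤ C ∧ ∀ x l : ℝ, 1 ≤ l → U (l * x) ≤ l ^ θ * (U x + C) := by
  obtain ⟨hc, hm, h0, x₀, hx₀, α, hα, hαU⟩ := h
  have hC : 0 ≤ -U x₀ := by linarith [(hm hx₀).trans h0.le]
  refine ⟨1 + α, -U x₀, by linarith, by linarith, hC, fun x l hl => ?_⟩
  rcases le_total x x₀ with hx | hx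
  · exact (hαU x hx l hl).trans (by gcongr; linarith)
  rcases le_total 0 x with hx0 | hx0
  · have hUx : 0 ≤ U x := h0.symm.le.trans (hm hx0)
    have hlα : l ≤ l ^ (1 + α) := by
      simpa using Real.rpow_le_rpow_of_exponent_le hl (show (1 : ℝ) ≤ 1 + α by linarith)
    calc U (l * x) ≤ l * U x := map_mul_le_of_concaveOn hc h0.ge x hl
      _ ≤ l ^ (1 + α) * U x := by gcongr
      _ ≤ l ^ (1 + α) * (U x + -U x₀) := by gcongr; linarith
  · calc U (l * x) ≤ U 0 := hm (mul_nonpos_of_nonneg_of_nonpos (by linarith) hx0)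
      _ = 0 := h0
      _ ≤ l ^ (1 + α) * (U x + -U x₀) := by
        have := hm hx
        exact mul_nonneg (by positivity) (by linarith)

theorem le_mul_one_add_abs_pow_of_le_rpow {f : ℝ → ℝ} {k K : ℝ} (hK : 0 ≤ K) (hk : 0 ≤ k)
    (hf : ∀ x : ℝ, f x ≤ K * (|x| ^ k + 1)) (x : ℝ) :
    f x ≤ 2 * K * (1 + |x|) ^ ⌈k⌉₊ := by
  have hrpow : |x| ^ k ≤ (1 + |x|) ^ ⌈k⌉₊ := by
    rw [← Real.rpow_natCast]
    exact (Real.rpow_le_rpow (abs_nonneg x) (by linarith) hk).trans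
      (Real.rpow_le_rpow_of_exponent_le (by linarith [abs_nonneg x]) (Nat.le_ceil k))
  have hone : 1 ≤ (1 + |x|) ^ ⌈k⌉₊ := one_le_pow₀ (by linarith [abs_nonneg x])
  calc f x ≤ K * (|x| ^ k + 1) := hf x
    _ ≤ K * ((1 + |x|) ^ ⌈k⌉₊ + (1 + |x|) ^ ⌈k⌉₊) := by gcongr
    _ = 2 * K * (1 + |x|) ^ ⌈k⌉₊ := by ring

theorem neg_mul_one_add_abs_pow_le_of_deriv_le (h0 : U 0 = 0) (hm : Monotone U)
    (hd : Differentiable ℝ U) {L : ℝ} (hL : 0 ≤ L) {r : ℕ}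
    (h : ∀ x, deriv U x ≤ L * (1 + |x|) ^ r) (x : ℝ) : -(L * (1 + |x|) ^ (r + 1)) ≤ U x := by
  have hpow : 0 ≤ L * (1 + |x|) ^ (r + 1) := by positivity
  rcases le_or_gt 0 x with hx | hx
  · linarith [h0.symm.le.trans (hm hx)]
  · obtain ⟨c, ⟨hxc, hc0⟩, hc⟩ := exists_deriv_eq_slope U hx hd.continuous.continuousOn
      hd.differentiableOn
    have hcx : |c| ≤ |x| := by
      rw [abs_of_neg hc0, abs_of_neg hx]
      linarith
    rw [h0, eq_div_iff (by linarith)] at hc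
    have hslope : deriv U c * (0 - x) ≤ L * (1 + |x|) ^ r * (1 + |x|) := by
      refine mul_le_mul ((h c).trans (by gcongr)) ?_ (by linarith) (by positivity)
      linarith [neg_abs_le x]
    rw [pow_succ, ← mul_assoc]
    linarith

theorem exists_regularUtility_fn_eq (hc : ConcaveOn ℝ Set.univ U) (hm : StrictMono U)
    (h0 : U 0 = 0) {θ C : ℝ} (hel : ∀ x l : ℝ, 1 ≤ l → U (l * x) ≤ l ^ θ * (U x + C)) :
    ∃ s : RegularUtility U θ C, s.fn = U := by
  have hcont : Continuous U := continuousOn_univ.1 (hc.continuousOn isOpen_univ)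
  have hneg : U (-1) < 0 := h0 ▸ hm (by norm_num)
  obtain ⟨n, hn, hCn⟩ : ∃ n : ℝ, 1 ≤ n ∧ (C + 1) / -U (-1) ≤ n :=
    ⟨_, le_max_left _ _, le_max_right _ _⟩
  have hdepth : U (-n) ≤ -(C + 1) := by
    have hscale := map_mul_le_of_concaveOn hc h0.ge (-1) hn
    rw [div_le_iff₀ (neg_pos.2 hneg)] at hCn
    rw [mul_neg_one] at hscale
    linarith
  exact ⟨⟨(⟨U, hcont⟩, n), hc, hm.monotone, fun x => le_rfl, hel, hn, hdepth⟩, rfl⟩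

end Utility

/-! ### The value functions -/

theorem exists_backward_sequence {α : Type*} {p : ℕ → α → Prop} {R : ℕ → α → α → Prop} (T : ℕ)
    (a : α) (ha : p T a) (h : ∀ t < T, ∀ x, p (t + 1) x → ∃ y, p t y ∧ R t y x) :
    ∃ f : ℕ → α, f T = a ∧ (∀ t ≤ T, p t (f t)) ∧ ∀ t < T, R t (f t) (f (t + 1)) := by
  induction T generalizing a with
  | zero => exact ⟨fun _ => a, rfl, fun t ht => (Nat.le_zero.1 ht).symm ▸ ha, by simp⟩
  | succ T ih =>
    obtain ⟨y, hy, hR⟩ := h T (by omega) a ha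
    obtain ⟨f, hfT, hfp, hfR⟩ := ih y hy fun t ht => h t (by omega)
    refine ⟨Function.update f (T + 1) a, by simp, fun t ht => ?_, fun t ht => ?_⟩
    · rcases ht.eq_or_lt with rfl | ht
      · simpa using ha
      · simpa [ht.ne] using hfp t (by omega)
    · rcases (Nat.lt_succ_iff.1 ht).eq_or_lt with rfl | htT
      · simpa [hfT] using hR
      · simpa [ht.ne, htT.ne] using hfR t htT

theorem extExp_of_integrable {Ω : Type*} {mΩ : MeasurableSpace Ω} {P : Measure Ω} {X : Ω → ℝ}
    (h : Integrable X P) : extExp P X = ((∫ ω, X ω ∂P : ℝ) : EReal) := by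
  have hpos : ∫⁻ ω, ENNReal.ofReal (X ω) ∂P ≠ ⊤ := h.lintegral_lt_top.ne
  have hneg : ∫⁻ ω, ENNReal.ofReal (-X ω) ∂P ≠ ⊤ := h.neg.lintegral_lt_top.ne
  rw [extExp, integral_eq_lintegral_pos_part_sub_lintegral_neg_part h, EReal.coe_sub,
    EReal.coe_ennreal_toReal hpos, EReal.coe_ennreal_toReal hneg]

section Value

variable {U : ℝ → ℝ} {θ C L : ℝ} {r : ℕ} {Ω : Type*} {mΩ : MeasurableSpace Ω}
  {P : Measure Ω} [IsProbabilityMeasure P] {T d : ℕ} {ℱ : Filtration ℕ mΩ}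
  {S : ℕ → Ω → EuclideanSpace ℝ (Fin d)} [Nonempty (RegularUtility U θ C)]

/-- The conditional joint law, given `ℱ t`, of the random function `X (t + 1)` and of the increment
`ΔS_{t+1}`: the law of the one-step problem at time `t`. -/
def stepLaw (P : Measure Ω) [IsFiniteMeasure P] (ℱ : Filtration ℕ mΩ)
    (S : ℕ → Ω → EuclideanSpace ℝ (Fin d)) (X : ℕ → Ω → RegularUtility U θ C) (t : ℕ) (ω : Ω) :
    Measure (RegularUtility U θ C × EuclideanSpace ℝ (Fin d)) :=
  regularLaw P (ℱ t) (fun ω => (X (t + 1) ω, increment S (t + 1) ω)) ω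

instance (X : ℕ → Ω → RegularUtility U θ C) (t : ℕ) (ω : Ω) :
    IsProbabilityMeasure (stepLaw P ℱ S X t ω) := by
  unfold stepLaw
  infer_instance

/-- `X` is a version of the process of the value functions `U_t`, and `A t` bounds the data of the
one-step problem at time `t` in the sense of `GoodLaw`. -/
structure IsValueProcess (P : Measure Ω) [IsFiniteMeasure P] (ℱ : Filtration ℕ mΩ)
    (S : ℕ → Ω → EuclideanSpace ℝ (Fin d)) (T r : ℕ) (X : ℕ → Ω → RegularUtility U θ C)
    (A : ℕ → Ω → ℝ) : Prop where
  terminal : ∀ ω, (X T ω).fn = U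
  measurable : ∀ t ≤ T, Measurable[ℱ t] (X t)
  hasAllMoments_fn_one : ∀ t ≤ T, HasAllMoments P fun ω => (X t ω).fn 1
  measurable_bound : ∀ t < T, Measurable[ℱ t] (A t)
  hasAllMoments_bound : ∀ t < T, HasAllMoments P (A t)
  goodLaw : ∀ t < T, ∀ᵐ ω ∂P, GoodLaw r (A t ω) (stepLaw P ℱ S X t ω)
  step : ∀ t < T, ∀ᵐ ω ∂P, (X t ω).fn = stepValue (stepLaw P ℱ S X t ω)

theorem exists_isValueProcess (hU : GrowthData U θ C L r) {s : RegularUtility U θ C}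
    (hs : s.fn = U) (hnull : ∀ s, MeasurableSet s → P s = 0 → MeasurableSet[ℱ 0] s)
    (hS : ∀ t ≤ T, Measurable[ℱ t] (S t))
    (hmom : ∀ t ≤ T, HasAllMoments P fun ω => ‖increment S t ω‖) (hna : NoArbitrage P ℱ S T)
    {β κ : ℕ → Ω → ℝ} (hb : ∀ t < T, IsNABound P ℱ S t (β t) (κ t))
    (hβ : ∀ t < T, HasAllMoments P fun ω => 1 / β t ω)
    (hκ : ∀ t < T, HasAllMoments P fun ω => 1 / κ t ω) :
    ∃ (X : ℕ → Ω → RegularUtility U θ C) (A : ℕ → Ω → ℝ), IsValueProcess P ℱ S T r X A := by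
  let Z : ℕ → (Ω → RegularUtility U θ C) → Ω → RegularUtility U θ C × EuclideanSpace ℝ (Fin d) :=
    fun t X ω => (X ω, increment S (t + 1) ω)
  let A : ℕ → (Ω → RegularUtility U θ C) → Ω → ℝ := fun t X =>
    lawConst P (ℱ t) (Z t X) (β t) (κ t)
  obtain ⟨X, hXT, hX, hstep⟩ := exists_backward_sequence (α := Ω → RegularUtility U θ C)
    (p := fun t X => Measurable[ℱ t] X ∧ HasAllMoments P (fun ω => (X ω).fn 1) ∧
      HasAllMoments P (fun ω => (X ω).depth))
    (R := fun t X' X => Measurable[ℱ t] (A t X) ∧ HasAllMoments P (A t X) ∧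
      (∀ᵐ ω ∂P, GoodLaw r (A t X ω) (regularLaw P (ℱ t) (Z t X) ω)) ∧
      ∀ᵐ ω ∂P, (X' ω).fn = stepValue (regularLaw P (ℱ t) (Z t X) ω))
    T (fun _ => s) ⟨measurable_const, hasAllMoments_const _, hasAllMoments_const _⟩
    fun t ht X ⟨hX, hX1, hXd⟩ => by
      have hXΩ : Measurable X := hX.mono (ℱ.le _) le_rfl
      have hY : Measurable (increment S (t + 1)) :=
        (measurable_increment hS ht).mono (ℱ.le _) le_rfl
      have hdir := (hb t ht).ae_forall_direction hna hS ht
      obtain ⟨hβm, hκm, hβ0, hκ0, -⟩ := hb t ht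
      have hA : Measurable[ℱ t] (A t X) := measurable_lawConst hβm hκm
      have hAm : HasAllMoments P (A t X) := hasAllMoments_lawConst (ℱ.le t) hXΩ hY hX1 hXd
        (hmom (t + 1) ht) (hβ t ht) (hκ t ht)
      have hgood := ae_goodLaw hU (ℱ.le t) hXΩ hY hX1 hXd (hmom (t + 1) ht) hβ0 hκ0 hdir
      obtain ⟨X', hX', hX'1, hX'd, hstep⟩ := exists_measurable_fn_eq_stepValue hU (ℱ.le t)
        (fun s hs hs0 => ℱ.mono t.zero_le _ (hnull s hs hs0)) hA hAm hgood
      exact ⟨X', ⟨hX', hX'1, hX'd⟩, hA, hAm, hgood, hstep⟩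
  exact ⟨X, fun t => A t (X (t + 1)), fun ω => by rw [hXT]; exact hs, fun t ht => (hX t ht).1,
    fun t ht => (hX t ht).2.1, fun t ht => (hstep t ht).1, fun t ht => (hstep t ht).2.1,
    fun t ht => (hstep t ht).2.2.1, fun t ht => (hstep t ht).2.2.2⟩

namespace IsValueProcess

variable {X : ℕ → Ω → RegularUtility U θ C} {A : ℕ → Ω → ℝ}

theorem measurable_fn (hX : IsValueProcess P ℱ S T r X A) {t : ℕ} (ht : t ≤ T) {V : Ω → ℝ}
    (hV : Measurable[ℱ t] V) : Measurable[ℱ t] fun ω => (X t ω).fn (V ω) :=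
  RegularUtility.continuous_fn_uncurry.measurable.comp ((hX.measurable t ht).prodMk hV)

variable {t : ℕ} {V : Ω → ℝ} {ξ : Ω → EuclideanSpace ℝ (Fin d)}

theorem measurable_pair (hX : IsValueProcess P ℱ S T r X A)
    (hS : ∀ t ≤ T, Measurable[ℱ t] (S t)) (ht : t < T) :
    Measurable fun ω => (X (t + 1) ω, increment S (t + 1) ω) :=
  ((hX.measurable _ ht).mono (ℱ.le _) le_rfl).prodMk
    ((measurable_increment hS ht).mono (ℱ.le _) le_rfl)

omit [Nonempty (RegularUtility U θ C)] in
theorem measurable_integrand (hV : Measurable[ℱ t] V) (hξ : Measurable[ℱ t] ξ) :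
    Measurable[(ℱ t).prod inferInstance]
      fun p : Ω × (RegularUtility U θ C × EuclideanSpace ℝ (Fin d)) =>
        p.2.1.fn (V p.1 + inner ℝ (ξ p.1) p.2.2) := by
  have harg : Measurable[(ℱ t).prod inferInstance]
      fun p : Ω × (RegularUtility U θ C × EuclideanSpace ℝ (Fin d)) => ((V p.1, ξ p.1), p.2) :=
    ((hV.comp measurable_fst).prodMk (hξ.comp measurable_fst)).prodMk measurable_snd
  exact RegularUtility.measurable_fn_add_inner.comp harg

theorem condLExp_ae_eq (hX : IsValueProcess P ℱ S T r X A)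
    (hS : ∀ t ≤ T, Measurable[ℱ t] (S t)) (ht : t < T) (hV : Measurable[ℱ t] V)
    (hξ : Measurable[ℱ t] ξ) {ψ : ℝ → ℝ≥0∞} (hψ : Measurable ψ) :
    condLExp (ℱ t) P
        (fun ω => ψ ((X (t + 1) ω).fn (V ω + inner ℝ (ξ ω) (increment S (t + 1) ω)))) =ᵐ[P]
      fun ω => ∫⁻ z, ψ (z.1.fn (V ω + inner ℝ (ξ ω) z.2)) ∂stepLaw P ℱ S X t ω :=
  (condLExp_comp_ae_eq (ℱ.le t) (hX.measurable_pair hS ht)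
    (hψ.comp (measurable_integrand hV hξ))).symm

theorem extCondExp_ae_eq (hU : GrowthData U θ C L r) (hX : IsValueProcess P ℱ S T r X A)
    (hS : ∀ t ≤ T, Measurable[ℱ t] (S t)) (ht : t < T) (hV : Measurable[ℱ t] V)
    (hξ : Measurable[ℱ t] ξ) :
    ∀ᵐ ω ∂P, extCondExp P (ℱ t)
        (fun ω => (X (t + 1) ω).fn (V ω + inner ℝ (ξ ω) (increment S (t + 1) ω))) ω =
      (expUtility (stepLaw P ℱ S X t ω) (V ω) (ξ ω) : EReal) := by
  filter_upwards [hX.condLExp_ae_eq hS ht hV hξ ENNReal.measurable_ofReal,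
    hX.condLExp_ae_eq hS ht hV hξ (ENNReal.measurable_ofReal.comp measurable_neg),
    hX.goodLaw t ht] with ω hpos hneg hgood
  rw [extCondExp, hpos]
  exact (congrArg _ (congrArg _ hneg)).trans
    (extExp_of_integrable (hgood.integrable_fn hU (V ω) (ξ ω)))

theorem condExpWellDefined (hU : GrowthData U θ C L r) (hX : IsValueProcess P ℱ S T r X A)
    (hS : ∀ t ≤ T, Measurable[ℱ t] (S t)) (ht : t < T) (hV : Measurable[ℱ t] V)
    (hξ : Measurable[ℱ t] ξ) :
    CondExpWellDefined P (ℱ t)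
      fun ω => (X (t + 1) ω).fn (V ω + inner ℝ (ξ ω) (increment S (t + 1) ω)) := by
  filter_upwards [hX.condLExp_ae_eq hS ht hV hξ ENNReal.measurable_ofReal, hX.goodLaw t ht]
    with ω hpos hgood
  left
  rw [hpos]
  exact (hgood.integrable_fn hU (V ω) (ξ ω)).lintegral_lt_top.ne

theorem ae_expUtility_le (hU : GrowthData U θ C L r) (hX : IsValueProcess P ℱ S T r X A)
    (ht : t < T) (V : Ω → ℝ) (ξ : Ω → EuclideanSpace ℝ (Fin d)) :
    ∀ᵐ ω ∂P, expUtility (stepLaw P ℱ S X t ω) (V ω) (ξ ω) ≤ (X t ω).fn (V ω) := by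
  filter_upwards [hX.goodLaw t ht, hX.step t ht] with ω hgood hstep
  rw [hstep]
  exact hgood.expUtility_le_stepValue hU _ _

theorem exists_measurable_expUtility_eq (hU : GrowthData U θ C L r)
    (hX : IsValueProcess P ℱ S T r X A)
    (hnull : ∀ s, MeasurableSet s → P s = 0 → MeasurableSet[ℱ 0] s) (ht : t < T)
    (hV : Measurable[ℱ t] V) :
    ∃ ξ : Ω → EuclideanSpace ℝ (Fin d), Measurable[ℱ t] ξ ∧
      ∀ᵐ ω ∂P, expUtility (stepLaw P ℱ S X t ω) (V ω) (ξ ω) = (X t ω).fn (V ω) := by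
  obtain ⟨ξ, hξ, hmax⟩ := exists_measurable_expUtility_eq_stepValue hU
    (fun s hs hs0 => ℱ.mono t.zero_le _ (hnull s hs hs0)) (hX.goodLaw t ht) hV
  refine ⟨ξ, hξ, ?_⟩
  filter_upwards [hmax, hX.step t ht] with ω hω hstep
  rw [hstep]
  exact hω

theorem isEssSup (hU : GrowthData U θ C L r) (hX : IsValueProcess P ℱ S T r X A)
    (hnull : ∀ s, MeasurableSet s → P s = 0 → MeasurableSet[ℱ 0] s)
    (hS : ∀ t ≤ T, Measurable[ℱ t] (S t)) (ht : t < T) (x : ℝ) :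
    IsEssSup P {ξ : Ω → EuclideanSpace ℝ (Fin d) | Measurable[ℱ t] ξ}
      (fun ξ => extCondExp P (ℱ t)
        fun ω => (X (t + 1) ω).fn (x + inner ℝ (ξ ω) (increment S (t + 1) ω)))
      (fun ω => ((X t ω).fn x : EReal)) := by
  have hx : Measurable[ℱ t] fun _ : Ω => x := measurable_const
  refine ⟨((hX.measurable_fn ht.le hx).mono (ℱ.le t) le_rfl).coe_real_ereal, fun ξ hξ => ?_,
    fun G _ hle => ?_⟩
  · filter_upwards [hX.extCondExp_ae_eq hU hS ht hx hξ, hX.ae_expUtility_le hU ht _ ξ]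
      with ω heq hle
    rw [heq]
    exact EReal.coe_le_coe_iff.2 hle
  · obtain ⟨ξ, hξ, hmax⟩ := hX.exists_measurable_expUtility_eq hU hnull ht hx
    filter_upwards [hle ξ hξ, hX.extCondExp_ae_eq hU hS ht hx hξ, hmax] with ω hG heq hmax
    rwa [heq, hmax] at hG

theorem isValueFunction (hU : GrowthData U θ C L r) (hX : IsValueProcess P ℱ S T r X A)
    (hnull : ∀ s, MeasurableSet s → P s = 0 → MeasurableSet[ℱ 0] s)
    (hS : ∀ t ≤ T, Measurable[ℱ t] (S t)) :
    IsValueFunction P ℱ S T U (fun t x ω => (X t ω).fn x) where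
  terminal x ω := by rw [hX.terminal]
  measurable _ ht _ := hX.measurable_fn ht measurable_const
  regular t _ := ae_of_all _ fun ω => ⟨(X t ω).mono, (X t ω).concave⟩
  wellDefined _ ht _ _ hξ := hX.condExpWellDefined hU hS ht measurable_const hξ
  essSup _ ht x := hX.isEssSup hU hnull hS ht x

theorem wellPosed (hU : GrowthData U θ C L r) (hX : IsValueProcess P ℱ S T r X A)
    (hnull : ∀ s, MeasurableSet s → P s = 0 → MeasurableSet[ℱ 0] s)
    (hS : ∀ t ≤ T, Measurable[ℱ t] (S t)) : WellPosed P ℱ S T U := by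
  refine ⟨_, hX.isValueFunction hU hnull hS, fun x => ?_⟩
  have hint : Integrable (fun ω => (1 + |x|) * (X 0 ω).fn 1) P :=
    (hX.hasAllMoments_fn_one 0 T.zero_le).integrable.const_mul _
  exact (lintegral_mono fun ω => ENNReal.ofReal_le_ofReal ((X 0 ω).fn_le hU x)).trans_lt
    hint.lintegral_lt_top

end IsValueProcess

end Value

/-! ### Expected utility along a strategy -/

theorem ofReal_neg_integral_le {α : Type*} {mα : MeasurableSpace α} {μ : Measure α} {f : α → ℝ}
    (hf : Integrable f μ) :
    ENNReal.ofReal (-∫ x, f x ∂μ) ≤ ∫⁻ x, ENNReal.ofReal (-f x) ∂μ := by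
  rw [integral_eq_lintegral_pos_part_sub_lintegral_neg_part hf]
  refine ENNReal.ofReal_le_of_le_toReal ?_
  linarith [ENNReal.toReal_nonneg (a := ∫⁻ x, ENNReal.ofReal (f x) ∂μ)]

theorem lintegral_ofReal_le_add {α : Type*} {mα : MeasurableSpace α} {μ : Measure α} {f : α → ℝ}
    (hf : Integrable f μ) {a : ℝ} (h : ∫ x, f x ∂μ ≤ a) :
    ∫⁻ x, ENNReal.ofReal (f x) ∂μ ≤ ENNReal.ofReal a + ∫⁻ x, ENNReal.ofReal (-f x) ∂μ := by
  have hpos : ∫⁻ x, ENNReal.ofReal (f x) ∂μ ≠ ⊤ := hf.lintegral_lt_top.ne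
  have hneg : ∫⁻ x, ENNReal.ofReal (-f x) ∂μ ≠ ⊤ := hf.neg.lintegral_lt_top.ne
  rw [integral_eq_lintegral_pos_part_sub_lintegral_neg_part hf] at h
  rw [← ENNReal.ofReal_toReal hpos, ← ENNReal.ofReal_toReal hneg]
  exact (ENNReal.ofReal_le_ofReal (by linarith)).trans ENNReal.ofReal_add_le

theorem integrable_of_lintegral_ofReal_lt_top {α : Type*} {mα : MeasurableSpace α}
    {μ : Measure α} {f : α → ℝ} (hf : Measurable f)
    (hpos : ∫⁻ x, ENNReal.ofReal (f x) ∂μ < ⊤) (hneg : ∫⁻ x, ENNReal.ofReal (-f x) ∂μ < ⊤) :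
    Integrable f μ := by
  refine ⟨hf.aestronglyMeasurable, ?_⟩
  rw [hasFiniteIntegral_iff_norm]
  have hle (y : ℝ) : ENNReal.ofReal ‖y‖ ≤ ENNReal.ofReal y + ENNReal.ofReal (-y) := by
    rcases le_total 0 y with hy | hy
    · rw [Real.norm_of_nonneg hy]
      exact le_self_add
    · rw [Real.norm_of_nonpos hy]
      exact le_add_self
  refine (lintegral_mono fun x => hle (f x)).trans_lt ?_
  rw [lintegral_add_left hf.ennreal_ofReal]
  exact ENNReal.add_lt_top.2 ⟨hpos, hneg⟩

section Wealth

variable {Ω : Type*} {d : ℕ} (S : ℕ → Ω → EuclideanSpace ℝ (Fin d)) (c : ℝ)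
  (φ : ℕ → Ω → EuclideanSpace ℝ (Fin d))

theorem wealth_zero : wealth S c φ 0 = fun _ => c := by
  funext ω
  simp [wealth]

theorem wealth_succ (t : ℕ) :
    wealth S c φ (t + 1) =
      fun ω => wealth S c φ t ω + inner ℝ (φ (t + 1) ω) (increment S (t + 1) ω) := by
  funext ω
  rw [wealth, wealth, Finset.sum_range_succ, add_assoc]

variable {S φ} {mΩ : MeasurableSpace Ω} {T : ℕ} {ℱ : Filtration ℕ mΩ}

theorem measurable_add_inner_increment (hS : ∀ t ≤ T, Measurable[ℱ t] (S t)) {t : ℕ} (ht : t < T)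
    {V : Ω → ℝ} {ξ : Ω → EuclideanSpace ℝ (Fin d)} (hV : Measurable[ℱ t] V)
    (hξ : Measurable[ℱ t] ξ) :
    Measurable[ℱ (t + 1)] fun ω => V ω + inner ℝ (ξ ω) (increment S (t + 1) ω) :=
  (hV.mono (ℱ.mono t.le_succ) le_rfl).add
    ((hξ.mono (ℱ.mono t.le_succ) le_rfl).inner (measurable_increment hS ht))

theorem measurable_wealth (hS : ∀ t ≤ T, Measurable[ℱ t] (S t)) (hφ : IsStrategy ℱ T φ) {t : ℕ}
    (ht : t ≤ T) : Measurable[ℱ t] (wealth S c φ t) := by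
  induction t with
  | zero =>
    rw [wealth_zero]
    exact measurable_const
  | succ t ih =>
    rw [wealth_succ]
    exact measurable_add_inner_increment hS ht (ih (Nat.le_of_succ_le ht)) (hφ t ht)

theorem exists_isStrategy_forall_wealth (hS : ∀ t ≤ T, Measurable[ℱ t] (S t))
    {R : ℕ → (Ω → ℝ) → (Ω → EuclideanSpace ℝ (Fin d)) → Prop}
    (hR : ∀ t < T, ∀ V, Measurable[ℱ t] V → ∃ ξ, Measurable[ℱ t] ξ ∧ R t V ξ) :
    ∃ φ, IsStrategy ℱ T φ ∧ ∀ t < T, R t (wealth S c φ t) (φ (t + 1)) := by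
  choose! F hF hRF using hR
  let V : ℕ → Ω → ℝ := fun t => Nat.rec (fun _ => c)
    (fun t V ω => V ω + inner ℝ (F t V ω) (increment S (t + 1) ω)) t
  let φ : ℕ → Ω → EuclideanSpace ℝ (Fin d) := fun t => F (t - 1) (V (t - 1))
  have hV : ∀ t ≤ T, Measurable[ℱ t] (V t) := fun t ht => by
    induction t with
    | zero => exact measurable_const
    | succ t ih =>
      have ihV := ih (Nat.le_of_succ_le ht)
      exact measurable_add_inner_increment hS ht ihV (hF t ht _ ihV)
  have hwealth (t : ℕ) : wealth S c φ t = V t := by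
    induction t with
    | zero => exact wealth_zero S c φ
    | succ t ih =>
      rw [wealth_succ, ih]
      rfl
  refine ⟨φ, fun t ht => hF t ht _ (hV t ht.le), fun t ht => ?_⟩
  rw [hwealth]
  exact hRF t ht _ (hV t ht.le)

end Wealth

section Along

variable {U : ℝ → ℝ} {θ C L : ℝ} {r : ℕ} {Ω : Type*} {mΩ : MeasurableSpace Ω}
  {P : Measure Ω} [IsProbabilityMeasure P] {T d : ℕ} {ℱ : Filtration ℕ mΩ}
  {S : ℕ → Ω → EuclideanSpace ℝ (Fin d)} [Nonempty (RegularUtility U θ C)]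
  {X : ℕ → Ω → RegularUtility U θ C} {A : ℕ → Ω → ℝ}

namespace IsValueProcess

section OneStep

variable {t : ℕ} {V : Ω → ℝ} {ξ : Ω → EuclideanSpace ℝ (Fin d)}

theorem lintegral_comp_fn_succ (hX : IsValueProcess P ℱ S T r X A)
    (hS : ∀ t ≤ T, Measurable[ℱ t] (S t)) (ht : t < T) (hV : Measurable[ℱ t] V)
    (hξ : Measurable[ℱ t] ξ) {ψ : ℝ → ℝ≥0∞} (hψ : Measurable ψ) :
    ∫⁻ ω, ψ ((X (t + 1) ω).fn (V ω + inner ℝ (ξ ω) (increment S (t + 1) ω))) ∂P =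
      ∫⁻ ω, ∫⁻ z, ψ (z.1.fn (V ω + inner ℝ (ξ ω) z.2)) ∂stepLaw P ℱ S X t ω ∂P :=
  lintegral_comp_eq_lintegral_regularLaw (ℱ.le t) (hX.measurable_pair hS ht)
    (hψ.comp (measurable_integrand hV hξ))

theorem lintegral_ofReal_neg_fn_le (hU : GrowthData U θ C L r) (hX : IsValueProcess P ℱ S T r X A)
    (hS : ∀ t ≤ T, Measurable[ℱ t] (S t)) (ht : t < T) (hV : Measurable[ℱ t] V)
    (hξ : Measurable[ℱ t] ξ) :
    ∫⁻ ω, ENNReal.ofReal (-(X t ω).fn (V ω)) ∂P ≤ ∫⁻ ω, ENNReal.ofReal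
      (-(X (t + 1) ω).fn (V ω + inner ℝ (ξ ω) (increment S (t + 1) ω))) ∂P := by
  refine le_of_le_of_eq (lintegral_mono_ae ?_)
    (hX.lintegral_comp_fn_succ hS ht hV hξ (ENNReal.measurable_ofReal.comp measurable_neg)).symm
  filter_upwards [hX.ae_expUtility_le hU ht V ξ, hX.goodLaw t ht] with ω hle hgood
  exact (ENNReal.ofReal_le_ofReal (neg_le_neg hle)).trans
    (ofReal_neg_integral_le (hgood.integrable_fn hU _ _))

theorem lintegral_ofReal_fn_succ_le (hU : GrowthData U θ C L r)
    (hX : IsValueProcess P ℱ S T r X A) (hS : ∀ t ≤ T, Measurable[ℱ t] (S t)) (ht : t < T)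
    (hV : Measurable[ℱ t] V) (hξ : Measurable[ℱ t] ξ) :
    ∫⁻ ω, ENNReal.ofReal
        ((X (t + 1) ω).fn (V ω + inner ℝ (ξ ω) (increment S (t + 1) ω))) ∂P ≤
      ∫⁻ ω, ENNReal.ofReal ((X t ω).fn (V ω)) ∂P + ∫⁻ ω, ENNReal.ofReal
        (-(X (t + 1) ω).fn (V ω + inner ℝ (ξ ω) (increment S (t + 1) ω))) ∂P := by
  have hneg := hX.lintegral_comp_fn_succ hS ht hV hξ
    (ENNReal.measurable_ofReal.comp measurable_neg)
  simp only [Function.comp_apply] at hneg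
  rw [hX.lintegral_comp_fn_succ hS ht hV hξ ENNReal.measurable_ofReal, hneg, ← lintegral_add_left
    (((hX.measurable_fn ht.le hV).mono (ℱ.le t) le_rfl).ennreal_ofReal)]
  refine lintegral_mono_ae ?_
  filter_upwards [hX.ae_expUtility_le hU ht V ξ, hX.goodLaw t ht] with ω hle hgood
  exact lintegral_ofReal_le_add (hgood.integrable_fn hU _ _) hle

theorem integrable_fn_succ (hU : GrowthData U θ C L r) (hX : IsValueProcess P ℱ S T r X A)
    (hS : ∀ t ≤ T, Measurable[ℱ t] (S t)) (ht : t < T) (hV : Measurable[ℱ t] V)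
    (hξ : Measurable[ℱ t] ξ) (hint : Integrable (fun ω => (X t ω).fn (V ω)) P)
    (hneg : ∫⁻ ω, ENNReal.ofReal
      (-(X (t + 1) ω).fn (V ω + inner ℝ (ξ ω) (increment S (t + 1) ω))) ∂P < ⊤) :
    Integrable (fun ω => (X (t + 1) ω).fn (V ω + inner ℝ (ξ ω) (increment S (t + 1) ω))) P :=
  integrable_of_lintegral_ofReal_lt_top ((hX.measurable_fn ht
      (measurable_add_inner_increment hS ht hV hξ)).mono (ℱ.le _) le_rfl)
    ((hX.lintegral_ofReal_fn_succ_le hU hS ht hV hξ).trans_lt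
      (ENNReal.add_lt_top.2 ⟨hint.lintegral_lt_top, hneg⟩)) hneg

theorem integrable_expUtility (hX : IsValueProcess P ℱ S T r X A)
    (hS : ∀ t ≤ T, Measurable[ℱ t] (S t)) (ht : t < T) (hV : Measurable[ℱ t] V)
    (hξ : Measurable[ℱ t] ξ) (hint : Integrable
      (fun ω => (X (t + 1) ω).fn (V ω + inner ℝ (ξ ω) (increment S (t + 1) ω))) P) :
    Integrable (fun ω => expUtility (stepLaw P ℱ S X t ω) (V ω) (ξ ω)) P :=
  integrable_integral_regularLaw (ℱ.le t) (hX.measurable_pair hS ht)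
    (measurable_integrand hV hξ) hint

theorem integral_fn_succ (hX : IsValueProcess P ℱ S T r X A)
    (hS : ∀ t ≤ T, Measurable[ℱ t] (S t)) (ht : t < T) (hV : Measurable[ℱ t] V)
    (hξ : Measurable[ℱ t] ξ) (hint : Integrable
      (fun ω => (X (t + 1) ω).fn (V ω + inner ℝ (ξ ω) (increment S (t + 1) ω))) P) :
    ∫ ω, (X (t + 1) ω).fn (V ω + inner ℝ (ξ ω) (increment S (t + 1) ω)) ∂P =
      ∫ ω, expUtility (stepLaw P ℱ S X t ω) (V ω) (ξ ω) ∂P :=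
  integral_comp_eq_integral_regularLaw (ℱ.le t) (hX.measurable_pair hS ht)
    (measurable_integrand hV hξ) hint

theorem hasAllMoments_fn (hU : GrowthData U θ C L r) (hX : IsValueProcess P ℱ S T r X A)
    (ht : t ≤ T) (hV : Measurable[ℱ t] V) (hVm : HasAllMoments P V) :
    HasAllMoments P fun ω => (X t ω).fn (V ω) := by
  have h1 : HasAllMoments P fun ω => 1 + |V ω| := (hasAllMoments_const 1).add hVm.abs
  have hbound := (h1.mul (hX.hasAllMoments_fn_one t ht)).add ((h1.pow r).const_mul L)
  exact hbound.mono ((hX.measurable_fn ht hV).mono (ℱ.le _) le_rfl).aestronglyMeasurable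
    (ae_of_all _ fun ω => ((X t ω).abs_fn_le hU (V ω)).trans (le_abs_self _))

theorem integrable_utility (hU : GrowthData U θ C L r) (hX : IsValueProcess P ℱ S T r X A)
    (hV : Measurable[ℱ T] V) (hVm : HasAllMoments P V) : Integrable (fun ω => U (V ω)) P := by
  simpa only [hX.terminal] using (hX.hasAllMoments_fn hU le_rfl hV hVm).integrable

theorem ae_abs_inner_increment_le (hU : GrowthData U θ C L r) (hX : IsValueProcess P ℱ S T r X A)
    (hS : ∀ t ≤ T, Measurable[ℱ t] (S t)) (ht : t < T) (hV : Measurable[ℱ t] V)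
    (hξ : Measurable[ℱ t] ξ)
    (hopt : ∀ᵐ ω ∂P, expUtility (stepLaw P ℱ S X t ω) (V ω) (ξ ω) = (X t ω).fn (V ω)) :
    ∀ᵐ ω ∂P, |(inner ℝ (ξ ω) (increment S (t + 1) ω) : ℝ)| ≤
      radius θ C (A t ω) (V ω) (L * (1 + |V ω|) ^ r) * ‖increment S (t + 1) ω‖ := by
  have hbound : ∀ᵐ ω ∂P, ∀ᵐ z ∂stepLaw P ℱ S X t ω, |(inner ℝ (ξ ω) z.2 : ℝ)| ≤
      radius θ C (A t ω) (V ω) (L * (1 + |V ω|) ^ r) * ‖z.2‖ := by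
    filter_upwards [hopt, hX.goodLaw t ht] with ω hω hgood
    have hL := hU.lower_nonneg
    exact hgood.ae_abs_inner_le hU (by positivity)
      (((hU.lower _).trans ((X t ω).le_fn _)).trans hω.ge)
  have hradius : Measurable[ℱ t] fun ω => radius θ C (A t ω) (V ω) (L * (1 + |V ω|) ^ r) := by
    have hcont : Continuous fun p : ℝ × ℝ => radius θ C p.1 p.2 (L * (1 + |p.2|) ^ r) := by
      unfold radius radiusBase
      fun_prop
    exact hcont.measurable.comp ((hX.measurable_bound t ht).prodMk hV)
  have hset : MeasurableSet[(ℱ t).prod inferInstance]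
      {p : Ω × (RegularUtility U θ C × EuclideanSpace ℝ (Fin d)) |
        |(inner ℝ (ξ p.1) p.2.2 : ℝ)| ≤
          radius θ C (A t p.1) (V p.1) (L * (1 + |V p.1|) ^ r) * ‖p.2.2‖} :=
    measurableSet_le
      (measurable_norm.comp (Measurable.inner (𝕜 := ℝ) (hξ.comp measurable_fst)
        (measurable_snd.comp measurable_snd)))
      ((hradius.comp measurable_fst).mul
        (measurable_norm.comp (measurable_snd.comp measurable_snd)))
  exact (ae_regularLaw_iff (ℱ.le t) (hX.measurable_pair hS ht) hset).1 hbound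

theorem hasAllMoments_add_inner_increment (hU : GrowthData U θ C L r)
    (hX : IsValueProcess P ℱ S T r X A) (hS : ∀ t ≤ T, Measurable[ℱ t] (S t))
    (hmom : ∀ t ≤ T, HasAllMoments P fun ω => ‖increment S t ω‖) (ht : t < T)
    (hV : Measurable[ℱ t] V) (hξ : Measurable[ℱ t] ξ) (hVm : HasAllMoments P V)
    (hopt : ∀ᵐ ω ∂P, expUtility (stepLaw P ℱ S X t ω) (V ω) (ξ ω) = (X t ω).fn (V ω)) :
    HasAllMoments P fun ω => V ω + inner ℝ (ξ ω) (increment S (t + 1) ω) := by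
  have hW : HasAllMoments P fun ω => L * (1 + |V ω|) ^ r :=
    (((hasAllMoments_const 1).add hVm.abs).pow r).const_mul L
  have hbound := ((hX.hasAllMoments_bound t ht).radius (θ := θ) (C := C) hVm hW).mul
    (hmom (t + 1) ht)
  have hmeas := (hξ.mono (ℱ.le t) le_rfl).inner (𝕜 := ℝ)
    ((measurable_increment hS ht).mono (ℱ.le _) le_rfl)
  refine hVm.add (hbound.mono hmeas.aestronglyMeasurable ?_)
  filter_upwards [hX.ae_abs_inner_increment_le hU hS ht hV hξ hopt] with ω hω
  exact hω.trans (le_abs_self _)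

end OneStep

variable {φ : ℕ → Ω → EuclideanSpace ℝ (Fin d)} {c : ℝ}

theorem integrable_fn_wealth (hU : GrowthData U θ C L r) (hX : IsValueProcess P ℱ S T r X A)
    (hS : ∀ t ≤ T, Measurable[ℱ t] (S t)) (hφ : IsStrategy ℱ T φ)
    (hneg : ∫⁻ ω, ENNReal.ofReal (-U (wealth S c φ T ω)) ∂P < ⊤) {t : ℕ} (ht : t ≤ T) :
    Integrable (fun ω => (X t ω).fn (wealth S c φ t ω)) P := by
  have hV : ∀ t ≤ T, Measurable[ℱ t] (wealth S c φ t) := fun t => measurable_wealth c hS hφ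
  have hnegt : ∀ t ≤ T, ∫⁻ ω, ENNReal.ofReal (-(X t ω).fn (wealth S c φ t ω)) ∂P < ⊤ := by
    intro t ht
    induction ht using Nat.decreasingInduction with
    | self => simpa only [hX.terminal] using hneg
    | of_succ t ht ih =>
      rw [wealth_succ] at ih
      exact (hX.lintegral_ofReal_neg_fn_le hU hS ht (hV t ht.le) (hφ t ht)).trans_lt ih
  induction t with
  | zero =>
    rw [wealth_zero]
    exact (hX.hasAllMoments_fn hU ht measurable_const (hasAllMoments_const c)).integrable
  | succ t ih =>
    have hsucc := hnegt (t + 1) ht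
    rw [wealth_succ] at hsucc ⊢
    have htT := Nat.le_of_succ_le ht
    exact hX.integrable_fn_succ hU hS ht (hV t htT) (hφ t ht) (ih htT) hsucc

theorem integral_fn_wealth_succ_le (hU : GrowthData U θ C L r)
    (hX : IsValueProcess P ℱ S T r X A) (hS : ∀ t ≤ T, Measurable[ℱ t] (S t))
    (hφ : IsStrategy ℱ T φ)
    (hint : ∀ t ≤ T, Integrable (fun ω => (X t ω).fn (wealth S c φ t ω)) P) {t : ℕ} (ht : t < T) :
    ∫ ω, (X (t + 1) ω).fn (wealth S c φ (t + 1) ω) ∂P ≤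
      ∫ ω, (X t ω).fn (wealth S c φ t ω) ∂P := by
  have hV := measurable_wealth c hS hφ ht.le
  have hsucc := hint (t + 1) ht
  rw [wealth_succ] at hsucc ⊢
  rw [hX.integral_fn_succ hS ht hV (hφ t ht) hsucc]
  exact integral_mono_ae (hX.integrable_expUtility hS ht hV (hφ t ht) hsucc) (hint t ht.le)
    (hX.ae_expUtility_le hU ht _ _)

theorem integral_fn_wealth_le (hU : GrowthData U θ C L r) (hX : IsValueProcess P ℱ S T r X A)
    (hS : ∀ t ≤ T, Measurable[ℱ t] (S t)) (hφ : IsStrategy ℱ T φ)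
    (hint : ∀ t ≤ T, Integrable (fun ω => (X t ω).fn (wealth S c φ t ω)) P) {s t : ℕ}
    (hst : s ≤ t) (ht : t ≤ T) :
    ∫ ω, (X t ω).fn (wealth S c φ t ω) ∂P ≤ ∫ ω, (X s ω).fn (wealth S c φ s ω) ∂P := by
  induction t, hst using Nat.le_induction with
  | base => exact le_rfl
  | succ t _ ih =>
    exact (hX.integral_fn_wealth_succ_le hU hS hφ hint ht).trans (ih (Nat.le_of_succ_le ht))

theorem extExp_wealth_le (hU : GrowthData U θ C L r) (hX : IsValueProcess P ℱ S T r X A)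
    (hS : ∀ t ≤ T, Measurable[ℱ t] (S t)) (hφ : IsStrategy ℱ T φ) :
    extExp P (fun ω => U (wealth S c φ T ω)) ≤ ((∫ ω, (X 0 ω).fn c ∂P : ℝ) : EReal) := by
  rcases eq_or_ne (∫⁻ ω, ENNReal.ofReal (-U (wealth S c φ T ω)) ∂P) ⊤ with hneg | hneg
  · rw [extExp, hneg, EReal.coe_ennreal_top, EReal.sub_top]
    exact bot_le
  · have hint : ∀ t ≤ T, Integrable (fun ω => (X t ω).fn (wealth S c φ t ω)) P :=
      fun t => hX.integrable_fn_wealth hU hS hφ hneg.lt_top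
    have hT := hint T le_rfl
    have hle := hX.integral_fn_wealth_le hU hS hφ hint T.zero_le le_rfl
    simp only [hX.terminal, wealth_zero] at hT hle
    rw [extExp_of_integrable hT]
    exact EReal.coe_le_coe_iff.2 hle

end IsValueProcess

/-- The strategy `φ` solves at each time the one-step problem that starts from its current wealth
(initial wealth `c`), for the conditional laws determined by the value process `X`. -/
structure IsStepOptimal (P : Measure Ω) [IsFiniteMeasure P] (ℱ : Filtration ℕ mΩ)
    (S : ℕ → Ω → EuclideanSpace ℝ (Fin d)) (T : ℕ) (X : ℕ → Ω → RegularUtility U θ C) (c : ℝ)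
    (φ : ℕ → Ω → EuclideanSpace ℝ (Fin d)) : Prop where
  isStrategy : IsStrategy ℱ T φ
  expUtility_eq : ∀ t < T, ∀ᵐ ω ∂P,
    expUtility (stepLaw P ℱ S X t ω) (wealth S c φ t ω) (φ (t + 1) ω) =
      (X t ω).fn (wealth S c φ t ω)

variable {c : ℝ} {φ : ℕ → Ω → EuclideanSpace ℝ (Fin d)}

theorem IsStepOptimal.hasAllMoments_wealth (hφ : IsStepOptimal P ℱ S T X c φ)
    (hU : GrowthData U θ C L r) (hX : IsValueProcess P ℱ S T r X A)
    (hS : ∀ t ≤ T, Measurable[ℱ t] (S t))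
    (hmom : ∀ t ≤ T, HasAllMoments P fun ω => ‖increment S t ω‖) {t : ℕ} (ht : t ≤ T) :
    HasAllMoments P (wealth S c φ t) := by
  induction t with
  | zero =>
    rw [wealth_zero]
    exact hasAllMoments_const c
  | succ t ih =>
    rw [wealth_succ]
    have htT := Nat.le_of_succ_le ht
    exact hX.hasAllMoments_add_inner_increment hU hS hmom ht
      (measurable_wealth c hS hφ.isStrategy htT) (hφ.isStrategy t ht) (ih htT)
      (hφ.expUtility_eq t ht)

theorem IsStepOptimal.integral_fn_wealth (hφ : IsStepOptimal P ℱ S T X c φ)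
    (hX : IsValueProcess P ℱ S T r X A) (hS : ∀ t ≤ T, Measurable[ℱ t] (S t))
    (hint : ∀ t ≤ T, Integrable (fun ω => (X t ω).fn (wealth S c φ t ω)) P) {t : ℕ} (ht : t ≤ T) :
    ∫ ω, (X t ω).fn (wealth S c φ t ω) ∂P = ∫ ω, (X 0 ω).fn c ∂P := by
  induction t with
  | zero => rw [wealth_zero]
  | succ t ih =>
    have hsucc := hint (t + 1) ht
    rw [wealth_succ] at hsucc ⊢
    have htT := Nat.le_of_succ_le ht
    rw [hX.integral_fn_succ hS ht (measurable_wealth c hS hφ.isStrategy htT) (hφ.isStrategy t ht)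
      hsucc, integral_congr_ae (hφ.expUtility_eq t ht), ih htT]

theorem IsStepOptimal.integrable_utility (hφ : IsStepOptimal P ℱ S T X c φ)
    (hU : GrowthData U θ C L r) (hX : IsValueProcess P ℱ S T r X A)
    (hS : ∀ t ≤ T, Measurable[ℱ t] (S t))
    (hmom : ∀ t ≤ T, HasAllMoments P fun ω => ‖increment S t ω‖) :
    Integrable (fun ω => U (wealth S c φ T ω)) P :=
  hX.integrable_utility hU (measurable_wealth c hS hφ.isStrategy le_rfl)
    (hφ.hasAllMoments_wealth hU hX hS hmom le_rfl)

theorem IsStepOptimal.extExp_wealth_eq (hφ : IsStepOptimal P ℱ S T X c φ)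
    (hU : GrowthData U θ C L r) (hX : IsValueProcess P ℱ S T r X A)
    (hS : ∀ t ≤ T, Measurable[ℱ t] (S t))
    (hmom : ∀ t ≤ T, HasAllMoments P fun ω => ‖increment S t ω‖) :
    extExp P (fun ω => U (wealth S c φ T ω)) = ((∫ ω, (X 0 ω).fn c ∂P : ℝ) : EReal) := by
  have hUint := hφ.integrable_utility hU hX hS hmom
  have hint : ∀ t ≤ T, Integrable (fun ω => (X t ω).fn (wealth S c φ t ω)) P := fun t ht =>
    hX.integrable_fn_wealth hU hS hφ.isStrategy hUint.neg.lintegral_lt_top ht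
  rw [extExp_of_integrable hUint, ← hφ.integral_fn_wealth hX hS hint le_rfl]
  simp only [hX.terminal]

namespace IsValueProcess

theorem exists_isStepOptimal (hU : GrowthData U θ C L r) (hX : IsValueProcess P ℱ S T r X A)
    (hnull : ∀ s, MeasurableSet s → P s = 0 → MeasurableSet[ℱ 0] s)
    (hS : ∀ t ≤ T, Measurable[ℱ t] (S t)) (c : ℝ) : ∃ φ, IsStepOptimal P ℱ S T X c φ := by
  obtain ⟨φ, hφ, hopt⟩ := exists_isStrategy_forall_wealth c hS
    (R := fun t V ξ => ∀ᵐ ω ∂P, expUtility (stepLaw P ℱ S X t ω) (V ω) (ξ ω) = (X t ω).fn (V ω))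
    fun t ht V hV => hX.exists_measurable_expUtility_eq hU hnull ht hV
  exact ⟨φ, hφ, hopt⟩

/-- Expected values decrease along any strategy, so a strategy that reaches the value at time `0`
loses nothing at any step. -/
theorem isStepOptimal_of_le_extExp (hU : GrowthData U θ C L r) (hX : IsValueProcess P ℱ S T r X A)
    (hS : ∀ t ≤ T, Measurable[ℱ t] (S t)) (hφ : IsStrategy ℱ T φ)
    (hge : ((∫ ω, (X 0 ω).fn c ∂P : ℝ) : EReal) ≤ extExp P (fun ω => U (wealth S c φ T ω))) :
    IsStepOptimal P ℱ S T X c φ := by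
  have hneg : ∫⁻ ω, ENNReal.ofReal (-U (wealth S c φ T ω)) ∂P ≠ ⊤ := fun h => by
    rw [extExp, h, EReal.coe_ennreal_top, EReal.sub_top, le_bot_iff] at hge
    exact EReal.coe_ne_bot _ hge
  have hint : ∀ t ≤ T, Integrable (fun ω => (X t ω).fn (wealth S c φ t ω)) P :=
    fun t => hX.integrable_fn_wealth hU hS hφ hneg.lt_top
  have hT := hint T le_rfl
  simp only [hX.terminal] at hT
  rw [extExp_of_integrable hT, EReal.coe_le_coe_iff] at hge
  refine ⟨hφ, fun t ht => ?_⟩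
  have hV := measurable_wealth c hS hφ ht.le
  have hle := hX.ae_expUtility_le hU ht (wealth S c φ t) (φ (t + 1))
  have hfirst := hX.integral_fn_wealth_le hU hS hφ hint t.zero_le ht.le
  have hlast := hX.integral_fn_wealth_le hU hS hφ hint (Nat.succ_le_of_lt ht) le_rfl
  have hsucc := hint (t + 1) ht
  simp only [hX.terminal, wealth_zero] at hfirst hlast
  rw [wealth_succ] at hsucc hlast
  rw [hX.integral_fn_succ hS ht hV (hφ t ht) hsucc] at hlast
  have hexp := hX.integrable_expUtility hS ht hV (hφ t ht) hsucc
  exact (integral_eq_iff_of_ae_le hexp (hint t ht.le) hle).1 <|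
    (integral_mono_ae hexp (hint t ht.le) hle).antisymm (hfirst.trans (hge.trans hlast))

theorem optValue_eq (hU : GrowthData U θ C L r) (hX : IsValueProcess P ℱ S T r X A)
    (hnull : ∀ s, MeasurableSet s → P s = 0 → MeasurableSet[ℱ 0] s)
    (hS : ∀ t ≤ T, Measurable[ℱ t] (S t))
    (hmom : ∀ t ≤ T, HasAllMoments P fun ω => ‖increment S t ω‖) (c : ℝ) :
    optValue P ℱ S T U c = ((∫ ω, (X 0 ω).fn c ∂P : ℝ) : EReal) := by
  obtain ⟨φ, hφ⟩ := hX.exists_isStepOptimal hU hnull hS c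
  refine le_antisymm (iSup₂_le fun ψ hψ => hX.extExp_wealth_le hU hS hψ.1) ?_
  rw [← hφ.extExp_wealth_eq hU hX hS hmom]
  exact le_iSup₂ (f := fun ψ (_ : ψ ∈ admissible P ℱ S T U c) =>
    extExp P (fun ω => U (wealth S c ψ T ω))) φ
    ⟨hφ.isStrategy, Or.inl (hφ.integrable_utility hU hX hS hmom).lintegral_lt_top.ne⟩

theorem exists_isOptimal (hU : GrowthData U θ C L r) (hX : IsValueProcess P ℱ S T r X A)
    (hnull : ∀ s, MeasurableSet s → P s = 0 → MeasurableSet[ℱ 0] s)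
    (hS : ∀ t ≤ T, Measurable[ℱ t] (S t))
    (hmom : ∀ t ≤ T, HasAllMoments P fun ω => ‖increment S t ω‖) (c : ℝ) :
    ∃ φ, IsOptimal P ℱ S T U c φ := by
  obtain ⟨φ, hφ⟩ := hX.exists_isStepOptimal hU hnull hS c
  have hext := hφ.extExp_wealth_eq hU hX hS hmom
  refine ⟨φ, ⟨hφ.isStrategy,
    Or.inl (hφ.integrable_utility hU hX hS hmom).lintegral_lt_top.ne⟩, ?_, ?_⟩
  · rw [hX.optValue_eq hU hnull hS hmom, hext]
  · rw [hext]
    exact EReal.coe_lt_top _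

theorem isStepOptimal_of_isOptimal (hU : GrowthData U θ C L r) (hX : IsValueProcess P ℱ S T r X A)
    (hnull : ∀ s, MeasurableSet s → P s = 0 → MeasurableSet[ℱ 0] s)
    (hS : ∀ t ≤ T, Measurable[ℱ t] (S t))
    (hmom : ∀ t ≤ T, HasAllMoments P fun ω => ‖increment S t ω‖)
    (hφ : IsOptimal P ℱ S T U c φ) : IsStepOptimal P ℱ S T X c φ :=
  hX.isStepOptimal_of_le_extExp hU hS hφ.1.1
    ((hX.optValue_eq hU hnull hS hmom c).symm.trans hφ.2.1).le

end IsValueProcess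

end Along

/-! ### The martingale measure -/

theorem deriv_pos_of_concaveOn_of_strictMono {U : ℝ → ℝ} (hc : ConcaveOn ℝ Set.univ U)
    (hm : StrictMono U) (hd : Differentiable ℝ U) (x : ℝ) : 0 < deriv U x := by
  have hslope := hc.slope_le_of_hasDerivAt (Set.mem_univ x) (Set.mem_univ (x + 1)) (by linarith)
    (hd x).hasDerivAt
  rw [slope_def_field, add_sub_cancel_left, div_one] at hslope
  exact (sub_pos.2 (hm (lt_add_one x))).trans_le hslope

theorem exists_growthData {U : ℝ → ℝ} (hel : ElasticAtTop U ∨ ElasticAtBot U)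
    (hd : Differentiable ℝ U) {L : ℝ} (hL : 0 ≤ L) {r : ℕ}
    (hderiv : ∀ x, deriv U x ≤ L * (1 + |x|) ^ r) :
    ∃ θ C, GrowthData U θ C L (r + 1) ∧ ∀ x l : ℝ, 1 ≤ l → U (l * x) ≤ l ^ θ * (U x + C) := by
  have hm : Monotone U := hel.elim (·.2.1) (·.2.1)
  have h0 : U 0 = 0 := hel.elim (·.2.2.1) (·.2.2.1)
  obtain ⟨θ, C, hθ, hθ1, hC, hUC⟩ :=
    hel.elim ElasticAtTop.exists_le_rpow_mul ElasticAtBot.exists_le_rpow_mul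
  exact ⟨θ, C, ⟨h0, hm, hθ, hθ1, hC, hL,
    neg_mul_one_add_abs_pow_le_of_deriv_le h0 hm hd hL hderiv⟩, hUC⟩

section FirstOrder

variable {Ω : Type*} {mΩ : MeasurableSpace Ω} {P : Measure Ω} [IsProbabilityMeasure P]
  {U : ℝ → ℝ} {L : ℝ} {q : ℕ} {V Y : Ω → ℝ}

theorem HasAllMoments.deriv_comp (hd : Continuous (deriv U)) (hpos : ∀ x, 0 ≤ deriv U x)
    (hL : ∀ x, deriv U x ≤ L * (1 + |x|) ^ q) (hV : HasAllMoments P V) :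
    HasAllMoments P fun ω => deriv U (V ω) :=
  ((((hasAllMoments_const 1).add hV.abs).pow q).const_mul L).mono
    (hd.comp_aestronglyMeasurable hV.aestronglyMeasurable) (ae_of_all _ fun ω => by
      rw [abs_of_nonneg (hpos _)]
      exact (hL _).trans (le_abs_self _))

theorem abs_deriv_add_mul_mul_le (hpos : ∀ x, 0 ≤ deriv U x)
    (hL : ∀ x, deriv U x ≤ L * (1 + |x|) ^ q) {ε : ℝ} (hε : |ε| ≤ 1) (v y : ℝ) :
    |deriv U (v + ε * y) * y| ≤ L * (1 + (|v| + |y|)) ^ q * |y| := by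
  have hL0 : 0 ≤ L := by simpa using (hpos 0).trans (hL 0)
  have harg : |v + ε * y| ≤ |v| + |y| :=
    calc |v + ε * y| ≤ |v| + |ε * y| := abs_add_le _ _
      _ = |v| + |ε| * |y| := by rw [abs_mul]
      _ ≤ |v| + |y| := by gcongr; exact mul_le_of_le_one_left (abs_nonneg _) hε
  rw [abs_mul, abs_of_nonneg (hpos _)]
  gcongr
  exact (hL _).trans (by gcongr)

theorem hasDerivAt_integral_comp_add_mul (hUd : Differentiable ℝ U) (hd : Continuous (deriv U))
    (hpos : ∀ x, 0 ≤ deriv U x) (hL : ∀ x, deriv U x ≤ L * (1 + |x|) ^ q)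
    (hV : HasAllMoments P V) (hY : HasAllMoments P Y) (hint : Integrable (fun ω => U (V ω)) P) :
    HasDerivAt (fun ε : ℝ => ∫ ω, U (V ω + ε * Y ω) ∂P) (∫ ω, deriv U (V ω) * Y ω ∂P) 0 := by
  have hbound : HasAllMoments P fun ω => L * (1 + (|V ω| + |Y ω|)) ^ q * |Y ω| :=
    ((((hasAllMoments_const 1).add (hV.abs.add hY.abs)).pow q).const_mul L).mul hY.abs
  have hmeas (ε : ℝ) : AEStronglyMeasurable (fun ω => V ω + ε * Y ω) P :=
    hV.aestronglyMeasurable.add (hY.aestronglyMeasurable.const_mul ε)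
  have hderiv := (hasDerivAt_integral_of_dominated_loc_of_deriv_le (μ := P) (x₀ := (0 : ℝ))
    (F := fun ε ω => U (V ω + ε * Y ω)) (F' := fun ε ω => deriv U (V ω + ε * Y ω) * Y ω)
    (Metric.ball_mem_nhds (0 : ℝ) one_pos)
    (Eventually.of_forall fun ε => hUd.continuous.comp_aestronglyMeasurable (hmeas ε))
    (by simpa using hint)
    ((hd.comp_aestronglyMeasurable (hmeas 0)).mul hY.aestronglyMeasurable)
    (ae_of_all _ fun ω ε hε =>
      abs_deriv_add_mul_mul_le hpos hL (mem_ball_zero_iff.1 hε).le (V ω) (Y ω))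
    hbound.integrable
    (ae_of_all _ fun ω ε _ => (hUd _).hasDerivAt.comp ε
      (by simpa using ((hasDerivAt_id ε).mul_const (Y ω)).const_add (V ω)))).2
  simpa only [zero_mul, add_zero] using hderiv

theorem integral_deriv_mul_eq_zero (hUd : Differentiable ℝ U) (hd : Continuous (deriv U))
    (hpos : ∀ x, 0 ≤ deriv U x) (hL : ∀ x, deriv U x ≤ L * (1 + |x|) ^ q)
    (hV : HasAllMoments P V) (hY : HasAllMoments P Y) (hint : Integrable (fun ω => U (V ω)) P)
    (hmax : ∀ ε : ℝ, ∫ ω, U (V ω + ε * Y ω) ∂P ≤ ∫ ω, U (V ω) ∂P) :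
    ∫ ω, deriv U (V ω) * Y ω ∂P = 0 := by
  have hlocal : IsLocalMax (fun ε : ℝ => ∫ ω, U (V ω + ε * Y ω) ∂P) 0 :=
    Eventually.of_forall fun ε => by simpa only [zero_mul, add_zero] using hmax ε
  exact hlocal.hasDerivAt_eq_zero (hasDerivAt_integral_comp_add_mul hUd hd hpos hL hV hY hint)

end FirstOrder

section MartingaleMeasure

variable {Ω : Type*} {mΩ : MeasurableSpace Ω} {T d : ℕ} {ℱ : Filtration ℕ mΩ}
  {S : ℕ → Ω → EuclideanSpace ℝ (Fin d)}

theorem condExp_ae_eq_of_setIntegral_increment_eq_zero {Q : Measure Ω} [IsFiniteMeasure Q]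
    (hS : ∀ t ≤ T, Measurable[ℱ t] (S t)) (hint : ∀ t ≤ T, Integrable (S t) Q)
    (hzero : ∀ t < T, ∀ B, MeasurableSet[ℱ t] B → ∫ ω in B, increment S (t + 1) ω ∂Q = 0)
    {s t : ℕ} (hst : s ≤ t) (ht : t ≤ T) : Q[S t | ℱ s] =ᵐ[Q] S s := by
  refine (ae_eq_condExp_of_forall_setIntegral_eq (ℱ.le s) (hint t ht)
    (fun B _ _ => (hint s (hst.trans ht)).integrableOn) (fun B hB _ => ?_)
    (hS s (hst.trans ht)).aestronglyMeasurable).symm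
  induction t, hst using Nat.le_induction with
  | base => rfl
  | succ t hst ih =>
    have htT := Nat.le_of_succ_le ht
    have hsub : ∫ ω in B, increment S (t + 1) ω ∂Q =
        ∫ ω in B, S (t + 1) ω ∂Q - ∫ ω in B, S t ω ∂Q :=
      integral_sub (hint (t + 1) ht).integrableOn (hint t htT).integrableOn
    rw [hzero t ht B (ℱ.mono hst _ hB)] at hsub
    exact (ih htT).trans (sub_eq_zero.1 hsub.symm).symm

variable {P : Measure Ω} {D : Ω → ℝ}

theorem HasAllMoments.integrable_smul (hD : HasAllMoments P D)
    (hS : ∀ t ≤ T, Measurable[ℱ t] (S t))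
    (hmom : ∀ t ≤ T, HasAllMoments P fun ω => ‖increment S t ω‖) {t : ℕ} (ht : t ≤ T) :
    Integrable (fun ω => D ω • S t ω) P := by
  have hincr : ∀ t ≤ T, Integrable (fun ω => D ω • increment S t ω) P := fun t ht =>
    (hD.mul (hmom t ht)).integrable.mono (hD.aestronglyMeasurable.smul
      ((measurable_increment hS ht).mono (ℱ.le _) le_rfl).aestronglyMeasurable)
      (ae_of_all _ fun ω => by simp [norm_smul])
  induction t with
  | zero => exact hincr 0 ht
  | succ t ih =>
    refine ((ih (Nat.le_of_succ_le ht)).add (hincr (t + 1) ht)).congr (ae_of_all _ fun ω => ?_)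
    simp [increment, smul_sub]

theorem isProbabilityMeasure_withDensity_div_integral (hD0 : ∀ ω, 0 ≤ D ω) (hD : Integrable D P)
    (hpos : 0 < ∫ ω, D ω ∂P) :
    IsProbabilityMeasure (P.withDensity fun ω => ENNReal.ofReal (D ω / ∫ ω', D ω' ∂P)) := by
  constructor
  rw [withDensity_apply _ MeasurableSet.univ, Measure.restrict_univ,
    ← ofReal_integral_eq_lintegral_ofReal (hD.div_const _)
    (ae_of_all _ fun ω => div_nonneg (hD0 ω) hpos.le), integral_div, div_self hpos.ne',
    ENNReal.ofReal_one]

theorem setIntegral_increment_withDensity_eq_zero (hDm : Measurable D)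
    (hD0 : ∀ ω, 0 ≤ D ω) {t : ℕ} {B : Set Ω} (hB : MeasurableSet B)
    (hint : Integrable (increment S (t + 1)) (P.withDensity fun ω => ENNReal.ofReal (D ω)))
    (horth : ∀ e : EuclideanSpace ℝ (Fin d),
      ∫ ω in B, D ω * inner ℝ e (increment S (t + 1) ω) ∂P = 0) :
    ∫ ω in B, increment S (t + 1) ω ∂P.withDensity (fun ω => ENNReal.ofReal (D ω)) = 0 := by
  refine (inner_self_eq_zero (𝕜 := ℝ)).1 ?_
  rw [← integral_inner hint.integrableOn, setIntegral_withDensity_eq_setIntegral_toReal_smul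
    hDm.ennreal_ofReal (ae_of_all _ fun ω => ENNReal.ofReal_lt_top) _ hB]
  simp only [ENNReal.toReal_ofReal (hD0 _), smul_eq_mul]
  exact horth _

theorem isEquivMartingaleMeasure_withDensity [IsProbabilityMeasure P] (hDm : Measurable D)
    (hD0 : ∀ ω, 0 < D ω) (hD : HasAllMoments P D) (hS : ∀ t ≤ T, Measurable[ℱ t] (S t))
    (hmom : ∀ t ≤ T, HasAllMoments P fun ω => ‖increment S t ω‖)
    (horth : ∀ t < T, ∀ B, MeasurableSet[ℱ t] B → ∀ e : EuclideanSpace ℝ (Fin d),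
      ∫ ω in B, D ω * inner ℝ e (increment S (t + 1) ω) ∂P = 0) :
    IsEquivMartingaleMeasure P
      (P.withDensity fun ω => ENNReal.ofReal (D ω / ∫ ω', D ω' ∂P)) ℱ S T := by
  have hmean : 0 < ∫ ω, D ω ∂P := by
    rw [integral_pos_iff_support_of_nonneg (fun ω => (hD0 ω).le) hD.integrable,
      show Function.support D = Set.univ from Set.eq_univ_of_forall fun ω => (hD0 ω).ne',
      measure_univ]
    exact one_pos
  have hpos (ω : Ω) : 0 < D ω / ∫ ω', D ω' ∂P := div_pos (hD0 ω) hmean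
  have hmeas : Measurable fun ω => D ω / ∫ ω', D ω' ∂P := hDm.div_const _
  have hdens : HasAllMoments P fun ω => D ω / ∫ ω', D ω' ∂P := by
    simpa only [div_eq_inv_mul] using hD.const_mul (∫ ω', D ω' ∂P)⁻¹
  have hprob := isProbabilityMeasure_withDensity_div_integral (fun ω => (hD0 ω).le)
    hD.integrable hmean
  have hint : ∀ t ≤ T, Integrable (S t)
      (P.withDensity fun ω => ENNReal.ofReal (D ω / ∫ ω', D ω' ∂P)) := fun t ht => by
    rw [integrable_withDensity_iff_integrable_smul' hmeas.ennreal_ofReal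
      (ae_of_all _ fun ω => ENNReal.ofReal_lt_top)]
    simpa only [ENNReal.toReal_ofReal (hpos _).le] using hdens.integrable_smul hS hmom ht
  refine ⟨hprob, withDensity_absolutelyContinuous _ _, withDensity_absolutelyContinuous'
    hmeas.ennreal_ofReal.aemeasurable (ae_of_all _ fun ω => (ENNReal.ofReal_pos.2 (hpos ω)).ne'),
    hint, fun s t => condExp_ae_eq_of_setIntegral_increment_eq_zero hS hint fun t ht B hB => ?_⟩
  refine setIntegral_increment_withDensity_eq_zero hmeas (fun ω => (hpos ω).le) (ℱ.le t _ hB)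
    ((hint (t + 1) ht).sub (hint t ht.le)) fun e => ?_
  simp only [div_mul_eq_mul_div]
  rw [integral_div, horth t ht B hB, zero_div]

end MartingaleMeasure

theorem wealth_add_smul {Ω : Type*} {T d : ℕ} (S : ℕ → Ω → EuclideanSpace ℝ (Fin d)) (c ε : ℝ)
    (φ ψ : ℕ → Ω → EuclideanSpace ℝ (Fin d)) (ω : Ω) :
    wealth S c (fun s ω => φ s ω + ε • ψ s ω) T ω =
      wealth S c φ T ω + ε * wealth S 0 ψ T ω := by
  simp only [wealth, inner_add_left, real_inner_smul_left, Finset.sum_add_distrib,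
    ← Finset.mul_sum]
  ring

section Optimal

variable {U : ℝ → ℝ} {θ C L L' : ℝ} {r q : ℕ} {Ω : Type*} {mΩ : MeasurableSpace Ω}
  {P : Measure Ω} [IsProbabilityMeasure P] {T d : ℕ} {ℱ : Filtration ℕ mΩ}
  {S : ℕ → Ω → EuclideanSpace ℝ (Fin d)} [Nonempty (RegularUtility U θ C)]
  {X : ℕ → Ω → RegularUtility U θ C} {A : ℕ → Ω → ℝ} {c : ℝ}
  {φ ψ : ℕ → Ω → EuclideanSpace ℝ (Fin d)}

theorem IsStepOptimal.integral_utility_add_mul_le (hφ : IsStepOptimal P ℱ S T X c φ)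
    (hU : GrowthData U θ C L r) (hX : IsValueProcess P ℱ S T r X A)
    (hS : ∀ t ≤ T, Measurable[ℱ t] (S t))
    (hmom : ∀ t ≤ T, HasAllMoments P fun ω => ‖increment S t ω‖) (hψ : IsStrategy ℱ T ψ)
    (hψm : HasAllMoments P (wealth S 0 ψ T)) (ε : ℝ) :
    ∫ ω, U (wealth S c φ T ω + ε * wealth S 0 ψ T ω) ∂P ≤ ∫ ω, U (wealth S c φ T ω) ∂P := by
  have hint : Integrable (fun ω => U (wealth S c φ T ω + ε * wealth S 0 ψ T ω)) P :=
    hX.integrable_utility hU ((measurable_wealth c hS hφ.isStrategy le_rfl).add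
      ((measurable_wealth 0 hS hψ le_rfl).const_mul ε))
      ((hφ.hasAllMoments_wealth hU hX hS hmom le_rfl).add (hψm.const_mul ε))
  have hle := hX.extExp_wealth_le (c := c) hU hS (φ := fun s ω => φ s ω + ε • ψ s ω)
    fun s hs => (hφ.isStrategy s hs).add ((hψ s hs).const_smul ε)
  rw [← hφ.extExp_wealth_eq hU hX hS hmom,
    extExp_of_integrable (hφ.integrable_utility hU hX hS hmom)] at hle
  simp only [wealth_add_smul] at hle
  rwa [extExp_of_integrable hint, EReal.coe_le_coe_iff] at hle

theorem IsStepOptimal.integral_deriv_mul_wealth_eq_zero (hφ : IsStepOptimal P ℱ S T X c φ)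
    (hU : GrowthData U θ C L r) (hX : IsValueProcess P ℱ S T r X A)
    (hS : ∀ t ≤ T, Measurable[ℱ t] (S t))
    (hmom : ∀ t ≤ T, HasAllMoments P fun ω => ‖increment S t ω‖)
    (hUd : Differentiable ℝ U) (hd : Continuous (deriv U)) (hpos : ∀ x, 0 ≤ deriv U x)
    (hL : ∀ x, deriv U x ≤ L' * (1 + |x|) ^ q) (hψ : IsStrategy ℱ T ψ)
    (hψm : HasAllMoments P (wealth S 0 ψ T)) :
    ∫ ω, deriv U (wealth S c φ T ω) * wealth S 0 ψ T ω ∂P = 0 :=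
  integral_deriv_mul_eq_zero hUd hd hpos hL (hφ.hasAllMoments_wealth hU hX hS hmom le_rfl) hψm
    (hφ.integrable_utility hU hX hS hmom)
    (hφ.integral_utility_add_mul_le hU hX hS hmom hψ hψm)

theorem IsStepOptimal.setIntegral_deriv_mul_inner_eq_zero (hφ : IsStepOptimal P ℱ S T X c φ)
    (hU : GrowthData U θ C L r) (hX : IsValueProcess P ℱ S T r X A)
    (hS : ∀ t ≤ T, Measurable[ℱ t] (S t))
    (hmom : ∀ t ≤ T, HasAllMoments P fun ω => ‖increment S t ω‖)
    (hUd : Differentiable ℝ U) (hd : Continuous (deriv U)) (hpos : ∀ x, 0 ≤ deriv U x)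
    (hL : ∀ x, deriv U x ≤ L' * (1 + |x|) ^ q) {t : ℕ} (ht : t < T) {B : Set Ω}
    (hB : MeasurableSet[ℱ t] B) (e : EuclideanSpace ℝ (Fin d)) :
    ∫ ω in B, deriv U (wealth S c φ T ω) * inner ℝ e (increment S (t + 1) ω) ∂P = 0 := by
  let p : Ω → EuclideanSpace ℝ (Fin d) := B.indicator fun _ => e
  have hψ : IsStrategy ℱ T fun s => if s = t + 1 then p else 0 :=
    isStrategy_single (measurable_const.indicator hB)
  have hwealth : wealth S 0 (fun s => if s = t + 1 then p else 0) T =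
      B.indicator fun ω => inner ℝ e (increment S (t + 1) ω) := funext fun ω => by
    rw [wealth_single ht, zero_add]
    by_cases hω : ω ∈ B <;> simp [p, hω]
  have hψm : HasAllMoments P (wealth S 0 (fun s => if s = t + 1 then p else 0) T) := by
    refine ((hmom (t + 1) ht).const_mul ‖e‖).mono
      ((measurable_wealth 0 hS hψ le_rfl).mono (ℱ.le T) le_rfl).aestronglyMeasurable
      (ae_of_all _ fun ω => ?_)
    rw [hwealth, abs_of_nonneg (by positivity : 0 ≤ ‖e‖ * ‖increment S (t + 1) ω‖)]
    exact (norm_indicator_le_norm_self (fun ω => inner ℝ e (increment S (t + 1) ω)) ω).trans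
      (norm_inner_le_norm _ _)
  rw [← integral_indicator (ℱ.le t _ hB),
    ← hφ.integral_deriv_mul_wealth_eq_zero hU hX hS hmom hUd hd hpos hL hψ hψm, hwealth]
  simp only [Set.indicator_mul_right]

theorem IsStepOptimal.hasAllMoments_deriv_wealth (hφ : IsStepOptimal P ℱ S T X c φ)
    (hU : GrowthData U θ C L r) (hX : IsValueProcess P ℱ S T r X A)
    (hS : ∀ t ≤ T, Measurable[ℱ t] (S t))
    (hmom : ∀ t ≤ T, HasAllMoments P fun ω => ‖increment S t ω‖)
    (hd : Continuous (deriv U)) (hpos : ∀ x, 0 ≤ deriv U x)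
    (hL : ∀ x, deriv U x ≤ L' * (1 + |x|) ^ q) :
    HasAllMoments P fun ω => deriv U (wealth S c φ T ω) :=
  (hφ.hasAllMoments_wealth hU hX hS hmom le_rfl).deriv_comp hd hpos hL

theorem IsStepOptimal.isEquivMartingaleMeasure (hφ : IsStepOptimal P ℱ S T X c φ)
    (hU : GrowthData U θ C L r) (hX : IsValueProcess P ℱ S T r X A)
    (hS : ∀ t ≤ T, Measurable[ℱ t] (S t))
    (hmom : ∀ t ≤ T, HasAllMoments P fun ω => ‖increment S t ω‖)
    (hUd : Differentiable ℝ U) (hd : Continuous (deriv U)) (hpos : ∀ x, 0 < deriv U x)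
    (hL : ∀ x, deriv U x ≤ L' * (1 + |x|) ^ q) :
    IsEquivMartingaleMeasure P (marginalMeasure P U (wealth S c φ T)) ℱ S T :=
  isEquivMartingaleMeasure_withDensity
    (hd.measurable.comp ((measurable_wealth c hS hφ.isStrategy le_rfl).mono (ℱ.le T) le_rfl))
    (fun _ => hpos _)
    (hφ.hasAllMoments_deriv_wealth hU hX hS hmom hd (fun x => (hpos x).le) hL) hS hmom
    fun _ ht _ hB =>
      hφ.setIntegral_deriv_mul_inner_eq_zero hU hX hS hmom hUd hd (fun x => (hpos x).le) hL ht hB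

end Optimal

end UtilityMax

end

theorem proposition7p1 {Ω : Type*} {mΩ : MeasurableSpace Ω} (P : Measure Ω)
    [IsProbabilityMeasure P] (T d : ℕ) (ℱ : Filtration ℕ mΩ)
    (h_null : ∀ s : Set Ω, MeasurableSet s → P s = 0 → MeasurableSet[ℱ 0] s)
    (S : ℕ → Ω → EuclideanSpace ℝ (Fin d)) (h_adapted : ∀ t ≤ T, Measurable[ℱ t] (S t))
    (U : ℝ → ℝ) (h_elastic : UtilityMax.ElasticAtTop U ∨ UtilityMax.ElasticAtBot U)
    (h_smooth : ContDiff ℝ 1 U) (h_strict : StrictMono U)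
    (k l M K : ℝ) (hk : 0 ≤ k) (hl : 0 ≤ l) (hM : 0 ≤ M) (hK : 0 ≤ K)
    (h_lower : ∀ x : ℝ, 1 ≤ |x| → M * |x| ^ (-l) ≤ deriv U x)
    (h_upper : ∀ x : ℝ, deriv U x ≤ K * (|x| ^ k + 1))
    (h_moments : ∀ t ≤ T,
      UtilityMax.HasAllMoments P (fun ω => ‖UtilityMax.increment S t ω‖))
    (h_na : UtilityMax.NoArbitrage P ℱ S T)
    (β κ : ℕ → Ω → ℝ) (h_bound : ∀ t < T, UtilityMax.IsNABound P ℱ S t (β t) (κ t))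
    (h_beta : ∀ t < T, UtilityMax.HasAllMoments P (fun ω => 1 / β t ω))
    (h_kappa : ∀ t < T, UtilityMax.HasAllMoments P (fun ω => 1 / κ t ω)) :
    UtilityMax.WellPosed P ℱ S T U ∧
    ∀ c : ℝ, (∃ φ, UtilityMax.IsOptimal P ℱ S T U c φ) ∧
      ∀ φ, UtilityMax.IsOptimal P ℱ S T U c φ →
        Integrable (fun ω => deriv U (UtilityMax.wealth S c φ T ω)) P ∧
        UtilityMax.IsEquivMartingaleMeasure P
          (UtilityMax.marginalMeasure P U (UtilityMax.wealth S c φ T)) ℱ S T := by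
  have hc : ConcaveOn ℝ Set.univ U := h_elastic.elim (·.1) (·.1)
  have hdiff : Differentiable ℝ U := h_smooth.differentiable one_ne_zero
  have hd : Continuous (deriv U) := h_smooth.continuous_deriv le_rfl
  have hpos := UtilityMax.deriv_pos_of_concaveOn_of_strictMono hc h_strict hdiff
  have hderiv := UtilityMax.le_mul_one_add_abs_pow_of_le_rpow hK hk h_upper
  obtain ⟨θ, C, hU, hUC⟩ :=
    UtilityMax.exists_growthData h_elastic hdiff (mul_nonneg zero_le_two hK) hderiv
  obtain ⟨s, hs⟩ := UtilityMax.exists_regularUtility_fn_eq hc h_strict hU.zero hUC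
  have : Nonempty (UtilityMax.RegularUtility U θ C) := ⟨s⟩
  obtain ⟨X, A, hX⟩ := UtilityMax.exists_isValueProcess hU hs h_null h_adapted h_moments h_na
    h_bound h_beta h_kappa
  refine ⟨hX.wellPosed hU h_null h_adapted, fun c =>
    ⟨hX.exists_isOptimal hU h_null h_adapted h_moments c, fun φ hφ => ?_⟩⟩
  have hstep := hX.isStepOptimal_of_isOptimal hU h_null h_adapted h_moments hφ
  exact ⟨(hstep.hasAllMoments_deriv_wealth hU hX h_adapted h_moments hd
      (fun x => (hpos x).le) hderiv).integrable,
    hstep.isEquivMartingaleMeasure hU hX h_adapted h_moments hdiff hd hpos hderiv⟩
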